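/- **Setting.** For a finite signed Borel measure $\mu$ on $\mathbb{R}$ consider $$i\psi_t=-\psi_{xx}+|\psi|^2\psi\,d\mu .\tag{NLS$_\mu$}$$ Let $C(\mathbb{R})$ denote the bounded continuous functions $\mathbb{R}\to\mathbb{C}$ with the supremum norm. A *solution* of (NLS$_\mu$) on an interval $I\subseteq\mathbb{R}$ is a bounded continuous function $\psi:I\to L^2(\mathbb{R})$ with $\psi\in L^4_{\mathrm{loc}}(I;C(\mathbb{R}))$ such that, for some $t_0\in I$ and all $t\in I$, $$\psi(t)=e^{i(t-t_0)\partial_x^2}\psi(t_0)-i\int_{t_0}^t e^{i(t-s)\partial_x^2}\bigl[|\psi(s)|^2\psi(s)\,d\mu\bigr]\,ds .$$ The equation is *globally well-posed at the initial data* $\psi_0\in L^2(\mathbb{R})$ if there is a solution $\psi$ on $\mathbb{R}$ with $\psi(0)=\psi_0$; every solution with these initial data, on any interval containing $0$, is a restriction of $\psi$; and for each $T>0$, all initial data sufficiently close to $\psi_0$ in $L^2(\mathbb{R})$ lead to solutions on $[-T,T]$, which converge to $\psi$ in $C([-T,T];L^2(\mathbb{R}))\cap L^4([-T,T];C(\mathbb{R}))$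 as the initial data converge to $\psi_0$. A solution $\psi$ on $\mathbb{R}$ *scatters* if there are $\psi_\pm\in L^2(\mathbb{R})$ with $\|\psi(t)-e^{it\partial_x^2}\psi_\pm\|_{L^2}\to0$ as $t\to\pm\infty$. **Theorem.** Let $g\in L^1(\mathbb{R})$ be real-valued (not necessarily nonnegative) with $\int_{\mathbb{R}} g\,dx=1$, and for $\varepsilon>0$ put $g_\varepsilon(x)=\varepsilon^{-1}g(x/\varepsilon)$. Let $\psi_0\in L^2(\mathbb{R})$ and let $\psi^\varepsilon_0\in L^2(\mathbb{R})$, $\varepsilon>0$, satisfy $\psi_0^\varepsilon\to\psi_0$ in $L^2(\mathbb{R})$ as $\varepsilon\downarrow0$. Then the point-concentrated equation $$i\psi_t=-\psi_{xx}+\delta(x)|\psi|^2\psi$$ (that is, $\mu=\delta$, the unit mass at $0$) has a unique global solution $\psi$ with $\psi(0)=\psi_0$, and there exists $\varepsilon_0>0$ such that for all $0<\varepsilon\le\varepsilon_0$ the equation $$i\psi^\varepsilon_t=-\psi^\varepsilon_{xx}+g_\varepsilon(x)|\psi^\varepsilon|^2\psi^\varepsilon$$ (that is, $d\mu=g_\varepsilon\,dx$)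 is globally well-posed at the initial data $\psi^\varepsilon_0$, and its solution $\psi^\varepsilon$ with $\psi^\varepsilon(0)=\psi^\varepsilon_0$ scatters. Moreover, $$\lim_{\varepsilon\downarrow0}\ \sup_{t\in\mathbb{R}}\ \|\psi^\varepsilon(t)-\psi(t)\|_{L^2(\mathbb{R})}=0 .$$ -/

import Mathlib

open MeasureTheory Filter Topology Set
open scoped FourierTransform BoundedContinuousFunction ENNReal

noncomputable section

/-- The complex Hilbert space `L²(ℝ)`, with respect to Lebesgue measure. -/
abbrev L2R : Type := Lp ℂ 2 (volume : Measure ℝ)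

/-- The symbol of the free propagator `e^{it∂ₓ²}`. With the convention
`𝓕 f (ξ) = ∫ e^{-2πi x ξ} f(x) dx` the operator `∂ₓ²` is multiplication by `-4π²ξ²` on the
Fourier side, so that `e^{it∂ₓ²}` is multiplication by `e^{-4π² i t ξ²}`. -/
def freeSymbol (t ξ : ℝ) : ℂ :=
  Complex.exp ((-(4 * Real.pi ^ 2 * t * ξ ^ 2) : ℝ) * Complex.I)

theorem norm_freeSymbol (t ξ : ℝ) : ‖freeSymbol t ξ‖ = 1 :=
  Complex.norm_exp_ofReal_mul_I _

theorem continuous_freeSymbol (t : ℝ) : Continuous (freeSymbol t) := by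
  unfold freeSymbol
  fun_prop

theorem memLp_freeSymbol_mul (t : ℝ) (f : L2R) :
    MemLp (fun ξ : ℝ => freeSymbol t ξ * f ξ) 2 (volume : Measure ℝ) := by
  refine (Lp.memLp f).of_le
    ((continuous_freeSymbol t).aestronglyMeasurable.mul (Lp.aestronglyMeasurable f)) ?_
  exact ae_of_all _ fun ξ => by simp [norm_freeSymbol]

/-- The free Schrödinger propagator `e^{it∂ₓ²}` on `L²(ℝ)`, as a Fourier multiplier. -/
def freeEvolution (t : ℝ) (f : L2R) : L2R :=
  𝓕⁻ ((memLp_freeSymbol_mul t (𝓕 f)).toLp _)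

/-- The Fourier transform `ξ ↦ ∫ e^{-2πi y ξ} |v(y)|² v(y) dμ(y)` of the finite complex measure
`|v|² v dμ`, for a finite signed Borel measure `μ` and a bounded continuous function `v`. -/
def cubicFourier (μ : SignedMeasure ℝ) (v : ℝ →ᵇ ℂ) (ξ : ℝ) : ℂ :=
  ∫ᵛ y, Complex.exp ((-(2 * Real.pi * y * ξ) : ℝ) * Complex.I) * ((‖v y‖ ^ 2 : ℝ) * v y) ∂<•μ

/-- `w ∈ L²(ℝ)` is the Duhamel integral
`∫_{t₀}^{t} e^{i(t-s)∂ₓ²} [ |u(s)|² u(s) dμ ] ds`.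
The propagator acts on finite measures (as on all tempered distributions) as the Fourier multiplier
with symbol `freeSymbol`; the integral is therefore evaluated on the Fourier side, where the
integrand is a scalar function of `s`, absolutely integrable for `u ∈ L³([t₀, t]; C(ℝ))`. -/
def IsDuhamelIntegral (μ : SignedMeasure ℝ) (u : ℝ → (ℝ →ᵇ ℂ)) (t₀ t : ℝ) (w : L2R) : Prop :=
  ∀ᵐ ξ : ℝ, (𝓕 w : L2R) ξ = ∫ s in t₀..t, freeSymbol (t - s) ξ * cubicFourier μ (u s) ξ

/-- `ψ` is a (strong) solution on the interval `I` of
`i ψ_t = - ψ_xx + |ψ|² ψ dμ`, where `μ` is a finite signed Borel measure on `ℝ`: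
* `ψ` is a bounded continuous function from `I` to `L²(ℝ)`;
* `ψ` is in `L⁴_loc(I; C(ℝ))`, where `C(ℝ)` is the Banach space of bounded continuous functions:
  there is a representative `u` with values in `C(ℝ)`, whose `L⁴` norm on compact subsets of `I`
  is finite;
* the Duhamel formula holds for some initial time `t₀ ∈ I` and all `t ∈ I`.
Values of `ψ` outside of `I` play no role. -/
def IsNLSSolution (μ : SignedMeasure ℝ) (I : Set ℝ) (ψ : ℝ → L2R) : Prop :=
  I.OrdConnected ∧
  ContinuousOn ψ I ∧
  (∃ C : ℝ, ∀ t ∈ I, ‖ψ t‖ ≤ C) ∧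
  ∃ u : ℝ → (ℝ →ᵇ ℂ),
    (∀ J : Set ℝ, IsCompact J → J ⊆ I → MemLp u 4 (volume.restrict J)) ∧
    (∀ᵐ s ∂(volume.restrict I), (ψ s : ℝ → ℂ) =ᵐ[volume] (u s : ℝ → ℂ)) ∧
    ∃ t₀ ∈ I, ∀ t ∈ I, ∃ w : L2R, IsDuhamelIntegral μ u t₀ t w ∧
      ψ t = freeEvolution (t - t₀) (ψ t₀) - Complex.I • w

/-- `ψ` is the unique global solution with initial data `ψ₀`: it solves the equation for all times
`t ∈ ℝ`, and every solution with this initial data, on any interval containing `0`, is a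
restriction of `ψ`. -/
def IsUniqueGlobalSolution (μ : SignedMeasure ℝ) (ψ₀ : L2R) (ψ : ℝ → L2R) : Prop :=
  IsNLSSolution μ univ ψ ∧ ψ 0 = ψ₀ ∧
  ∀ (I : Set ℝ) (φ : ℝ → L2R), 0 ∈ I → IsNLSSolution μ I φ → φ 0 = ψ₀ → EqOn φ ψ I

/-- Continuous dependence on the initial data at the global solution `ψ`: on each compact time
interval `[-T, T]`, initial data `φ₀` close to `ψ(0)` in `L²` lead to solutions on the whole of
`[-T, T]`, which are close to `ψ` in `C([-T, T]; L²)` and in `L⁴([-T, T]; C(ℝ))`. -/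
def DependsContinuouslyAt (μ : SignedMeasure ℝ) (ψ : ℝ → L2R) : Prop :=
  ∀ T > (0 : ℝ), ∀ η > (0 : ℝ), ∃ δ > (0 : ℝ), ∀ φ₀ : L2R, ‖φ₀ - ψ 0‖ < δ →
    (∃ φ : ℝ → L2R, IsNLSSolution μ (Icc (-T) T) φ ∧ φ 0 = φ₀) ∧
    ∀ φ : ℝ → L2R, IsNLSSolution μ (Icc (-T) T) φ → φ 0 = φ₀ →
      (∀ t ∈ Icc (-T) T, ‖φ t - ψ t‖ ≤ η) ∧
      (∫⁻ t in Icc (-T) T, eLpNorm (φ t - ψ t : L2R) ∞ volume ^ 4) ≤ ENNReal.ofReal (η ^ 4)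

/-- The equation is globally well-posed at the initial data `ψ₀`, with solution `ψ`: existence of a
global solution, uniqueness, and continuous dependence on the initial data. -/
def IsGloballyWellPosedAt (μ : SignedMeasure ℝ) (ψ₀ : L2R) (ψ : ℝ → L2R) : Prop :=
  IsUniqueGlobalSolution μ ψ₀ ψ ∧ DependsContinuouslyAt μ ψ

/-- `ψ` scatters in `L²(ℝ)`, in both time directions. -/
def Scatters (ψ : ℝ → L2R) : Prop :=
  (∃ ψp : L2R, Tendsto (fun t : ℝ => ‖ψ t - freeEvolution t ψp‖) atTop (𝓝 0)) ∧
  (∃ ψm : L2R, Tendsto (fun t : ℝ => ‖ψ t - freeEvolution t ψm‖) atBot (𝓝 0))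

/-- The rescaled coupling `g_ε(x) = ε⁻¹ g(x / ε)`. -/
def rescaledCoupling (g : ℝ → ℝ) (ε : ℝ) (x : ℝ) : ℝ := ε⁻¹ * g (x / ε)

/-- The finite signed measure `g_ε(x) dx`, for integrable `g` and `ε > 0`. -/
def couplingMeasure (g : ℝ → ℝ) (ε : ℝ) : SignedMeasure ℝ :=
  (volume : Measure ℝ).withDensityᵥ (rescaledCoupling g ε)

/-- The Dirac delta at the origin, as a signed measure. -/
def deltaMeasure : SignedMeasure ℝ := VectorMeasure.dirac (0 : ℝ) (1 : ℝ)

end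

/-! The unknown is the continuous representative `u` of the solution in L⁴(ℝ; C(ℝ)), and the L²
function at time t is handled through its profile, the Fourier transform with the free phase
removed. The Schrödinger kernel is bounded by |t-s|^{-1/2} at every position, so a coupling measure
enters the linear estimates only through its total mass. Together with TT* and the
Hardy–Littlewood–Sobolev inequality L^{4/3} → L⁴ (`lintegral_fracInt_pow_four_le`) this gives
Strichartz estimates for free solutions (`lintegral_iSup_regInv_phase_le`) and for Duhamel integrals
(`enorm_duhL2_le`, `lintegral_duhRep_le`), with constants independent of ε. Rescaling the variable
in g_ε gives the Fourier transform `cplFourier g ε`, which makes sense at ε = 0 and is then that of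
the point mass, because g has integral one. The limit equation thus belongs to the same family, at ε
= 0.

Large data are treated by perturbation around a solution `u` whose L⁴ norm is bounded by A. The
linearized Duhamel operator is of Volterra type with coefficient |u|². The time line is cut into
shells around 0 on which u has small L⁴ mass, and the k-th shell receives the weight η^k.
Contributions from earlier shells then gain a factor η, and those from the same shell are small, so
the operator is a contraction in a weighted L⁴ norm comparable to the original one with constants
depending on A only (`exists_volterra_weight`). This gives uniqueness (`ae_eq_zero_of_le_volterra`)
and, through a fixed point, stability uniform in ε (`exists_perturbation`, `exists_stability`).

A global bound is needed for the point interaction only. The trace q(t) = u(t, 0) solves a scalar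
Volterra equation whose kernel, multiplied by i, has a causal quadratic form with nonnegative real
part (`integral_causal_kernelForm_nonneg`): the full form is an integral of squares over
frequencies, and Hermitian symmetry makes the causal half contribute exactly half of it. Testing the
equation with |q|² q therefore bounds the L⁴ norm of q by that of the free trace
(`lintegral_trace_le`), and Strichartz bounds `u`. Since the bound is uniform, increasing the
amplitude of the forcing from 0 to 1 in finitely many perturbation steps produces the solution
(`exists_isMild_zero`). No sign of g is used, because for small ε the equation is only treated as a
perturbation of the limit.

It remains to see that the solution `u` of the limit equation almost solves the equation with
coupling g_ε. Its forcing F = |u|² u is fixed, so only linear convergence is needed. The difference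
between F and its value at the origin has vanishing total variation against g_ε. For a forcing that
is constant in space the Duhamel integral is an average of translates by εy, and uniform continuity
applies (`tendsto_eLpNorm_duhRep_sub`, `eventually_enorm_duhL2_sub_le`). Stability yields the nearby
solutions, their L⁴ bounds yield scattering, and the convergence is uniform over all times because
the L^{4/3} mass of F has a primitive with relatively compact range. -/

noncomputable section

/-! ### The dispersive kernel and the Hardy–Littlewood–Sobolev inequality -/

/-- The size `|τ|^{-1/2}` of the Schrödinger kernel, infinite at `τ = 0`. -/
def dispKernel (τ : ℝ) : ℝ≥0∞ := ‖τ‖ₑ ^ (-(1 / 2) : ℝ)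

theorem measurable_dispKernel : Measurable dispKernel := by
  unfold dispKernel; fun_prop

theorem dispKernel_neg (τ : ℝ) : dispKernel (-τ) = dispKernel τ := by simp [dispKernel]

theorem dispKernel_sub_comm (s t : ℝ) : dispKernel (s - t) = dispKernel (t - s) := by
  rw [← dispKernel_neg, neg_sub]

theorem lintegral_comp_abs_eq (φ : ℝ → ℝ≥0∞) :
    ∫⁻ s, φ |s| = 2 * ∫⁻ s in Ioi (0 : ℝ), φ s := by
  have h1 : ∫⁻ s in Ioi (0 : ℝ), φ |s| = ∫⁻ s in Ioi (0 : ℝ), φ s :=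
    setLIntegral_congr_fun measurableSet_Ioi fun s hs => by simp [abs_of_pos (mem_Ioi.1 hs)]
  have h2 : ∫⁻ s in Iic (0 : ℝ), φ |s| = ∫⁻ s in Ioi (0 : ℝ), φ s := by
    rw [← h1, ← setLIntegral_congr (Iio_ae_eq_Iic (μ := (volume : Measure ℝ)) (a := 0))]
    have := (Measure.measurePreserving_neg (volume : Measure ℝ)).setLIntegral_comp_preimage_emb
      (MeasurableEquiv.neg ℝ).measurableEmbedding (fun s => φ |s|) (Ioi 0)
    simpa using this
  rw [← lintegral_add_compl _ measurableSet_Ioi, compl_Ioi, h1, h2, two_mul]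

theorem lintegral_dispKernel_ball {R : ℝ} (hR : 0 < R) :
    ∫⁻ s, indicator (Iic R) dispKernel |s| = ENNReal.ofReal (4 * R ^ (1 / 2 : ℝ)) := by
  rw [lintegral_comp_abs_eq, setLIntegral_indicator measurableSet_Iic, Iic_inter_Ioi]
  have h1 : ∫⁻ s in Ioc 0 R, dispKernel s = ∫⁻ s in Ioc 0 R, ENNReal.ofReal (s ^ (-(1 / 2) : ℝ)) := by
    refine setLIntegral_congr_fun measurableSet_Ioc fun s hs => ?_
    rw [dispKernel, Real.enorm_of_nonneg hs.1.le, ENNReal.ofReal_rpow_of_pos hs.1]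
  have h2 : IntegrableOn (fun s : ℝ => s ^ (-(1 / 2) : ℝ)) (Ioc 0 R) :=
    (intervalIntegrable_iff_integrableOn_Ioc_of_le hR.le).1
      (intervalIntegral.intervalIntegrable_rpow' (by norm_num))
  rw [h1, ← ofReal_integral_eq_lintegral_ofReal h2
    (ae_restrict_of_forall_mem measurableSet_Ioc fun s hs => Real.rpow_nonneg hs.1.le _),
    ← intervalIntegral.integral_of_le hR.le, integral_rpow (Or.inl (by norm_num)),
    show (2 : ℝ≥0∞) = ENNReal.ofReal 2 by simp, ← ENNReal.ofReal_mul (by norm_num)]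
  congr 1
  rw [show (-(1 / 2) + 1 : ℝ) = 1 / 2 by norm_num, Real.zero_rpow (by norm_num)]
  ring

theorem lintegral_dispKernel_pow_four_compl_ball {R : ℝ} (hR : 0 < R) :
    ∫⁻ s, indicator (Ioi R) (fun s => dispKernel s ^ (4 : ℝ)) |s| = ENNReal.ofReal (2 * R⁻¹) := by
  rw [lintegral_comp_abs_eq, setLIntegral_indicator measurableSet_Ioi, Ioi_inter_Ioi,
    sup_eq_left.2 hR.le]
  have h1 : ∫⁻ s in Ioi R, dispKernel s ^ (4 : ℝ)
      = ∫⁻ s in Ioi R, ENNReal.ofReal (s ^ (-2 : ℝ)) := by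
    refine setLIntegral_congr_fun measurableSet_Ioi fun s hs => ?_
    have hs : 0 < s := hR.trans hs
    simp only [dispKernel]
    rw [Real.enorm_of_nonneg hs.le, ← ENNReal.rpow_mul, ENNReal.ofReal_rpow_of_pos hs]
    norm_num
  rw [h1, ← ofReal_integral_eq_lintegral_ofReal (integrableOn_Ioi_rpow_of_lt (by norm_num) hR)
    (ae_restrict_of_forall_mem measurableSet_Ioi fun s hs =>
      Real.rpow_nonneg (hR.le.trans (mem_Ioi.1 hs).le) _),
    integral_Ioi_rpow_of_lt (by norm_num) hR,
    show (2 : ℝ≥0∞) = ENNReal.ofReal 2 by simp, ← ENNReal.ofReal_mul (by norm_num)]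
  congr 1
  rw [show (-2 + 1 : ℝ) = -1 by norm_num, Real.rpow_neg_one]
  ring

/-- A function bounded by `a` has a potential bounded in terms of `a` and of its `L^{4/3}` norm. -/
theorem lintegral_dispKernel_mul_le_of_le (t : ℝ) {k : ℝ → ℝ≥0∞} (hk : Measurable k) {a : ℝ≥0∞}
    (hka : ∀ s, k s ≤ a) :
    ∫⁻ s, dispKernel (t - s) * k s ≤
      6 * ((∫⁻ s, k s ^ (4 / 3 : ℝ)) ^ (1 / 2 : ℝ) * a ^ (1 / 3 : ℝ)) := by
  set H := ∫⁻ s, k s ^ (4 / 3 : ℝ) with hH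
  rcases eq_or_ne a 0 with rfl | ha0
  · have : k = 0 := funext fun s => le_antisymm (hka s) bot_le
    simp [this]
  rcases eq_or_ne H 0 with hH0 | hH0
  · have h0 := (lintegral_eq_zero_iff (by fun_prop)).1 (hH ▸ hH0)
    have : ∫⁻ s, dispKernel (t - s) * k s = 0 := by
      rw [lintegral_eq_zero_iff (by have := measurable_dispKernel; fun_prop)]
      filter_upwards [h0] with s hs
      have : k s = 0 := (ENNReal.rpow_eq_zero_iff_of_pos (by norm_num)).1 hs
      simp [this]
    simp [this]
  rcases eq_or_ne H ∞ with hHt | hHt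
  · rw [hHt, ENNReal.top_rpow_of_pos (by norm_num), ENNReal.top_mul, ENNReal.mul_top]
    · exact le_top
    · norm_num
    · simp [ha0]
  rcases eq_or_ne a ∞ with rfl | hat
  · rw [ENNReal.top_rpow_of_pos (by norm_num), ENNReal.mul_top, ENNReal.mul_top]
    · exact le_top
    · norm_num
    · simp [hH0, hHt]
  have hHp : 0 < H.toReal := ENNReal.toReal_pos hH0 hHt
  have hap : 0 < a.toReal := ENNReal.toReal_pos ha0 hat
  set h := H.toReal
  set b := a.toReal
  have eH : H = ENNReal.ofReal h := (ENNReal.ofReal_toReal hHt).symm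
  have ea : a = ENNReal.ofReal b := (ENNReal.ofReal_toReal hat).symm
  -- This radius balances the near part, of size a R^{1/2}, against the far part, of size R^{-1/4}
  -- H^{3/4} by Hölder. Both become multiples of H^{1/2} a^{1/3}, with constants 4 and 2^{1/4} ≤ 2.
  set R : ℝ := h * b ^ (-(4 / 3) : ℝ)
  have hR : 0 < R := by positivity
  have hmd := measurable_dispKernel
  have hsplit : ∀ s, dispKernel (t - s) * k s ≤
      indicator (Iic R) dispKernel |t - s| * a
        + indicator (Ioi R) dispKernel |t - s| * k s := by
    intro s
    have habs : dispKernel |t - s| = dispKernel (t - s) := by simp [dispKernel]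
    rcases le_or_gt |t - s| R with h | h
    · simp only [indicator, mem_Iic, h, if_true, habs]
      exact le_add_right (by gcongr; exact hka s)
    · simp only [indicator, mem_Ioi, h, if_true, habs]
      exact le_add_self
  have e1 : ∫⁻ s, indicator (Iic R) dispKernel |t - s| * a
      = ENNReal.ofReal (4 * R ^ (1 / 2 : ℝ)) * a := by
    rw [lintegral_mul_const', lintegral_sub_left_eq_self (fun s => indicator (Iic R) dispKernel |s|),
      lintegral_dispKernel_ball hR]
    exact hat
  have e2 : ∫⁻ s, indicator (Ioi R) dispKernel |t - s| * k s
      ≤ (ENNReal.ofReal (2 * R⁻¹)) ^ (1 / 4 : ℝ) * H ^ (3 / 4 : ℝ) := by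
    have := ENNReal.lintegral_mul_le_Lp_mul_Lq (volume : Measure ℝ) (p := 4) (q := 4 / 3)
      ⟨by norm_num, by norm_num, by norm_num⟩
      (f := fun s => indicator (Ioi R) dispKernel |t - s|) (g := k)
      ((hmd.indicator measurableSet_Ioi).comp (by fun_prop)).aemeasurable hk.aemeasurable
    simp only [Pi.mul_apply] at this
    refine this.trans (le_of_eq ?_)
    congr 1
    · rw [← lintegral_dispKernel_pow_four_compl_ball hR,
        ← lintegral_sub_left_eq_self (fun s =>
          indicator (Ioi R) (fun s => dispKernel s ^ (4 : ℝ)) |s|) t]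
      congr 2 with s
      by_cases h : |t - s| ∈ Ioi R <;> simp [h]
    · norm_num [hH]
  calc ∫⁻ s, dispKernel (t - s) * k s
      ≤ ENNReal.ofReal (4 * R ^ (1 / 2 : ℝ)) * a
        + (ENNReal.ofReal (2 * R⁻¹)) ^ (1 / 4 : ℝ) * H ^ (3 / 4 : ℝ) := by
        refine (lintegral_mono hsplit).trans ?_
        rw [lintegral_add_right _ (by
          exact ((hmd.indicator measurableSet_Ioi).comp (by fun_prop)).mul hk), e1]
        gcongr
    _ ≤ _ := by
        rw [eH, ea, ENNReal.ofReal_rpow_of_pos (by positivity), ENNReal.ofReal_rpow_of_pos (by positivity),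
          ENNReal.ofReal_rpow_of_pos (by positivity), ENNReal.ofReal_rpow_of_pos (by positivity),
          ← ENNReal.ofReal_mul (by positivity), ← ENNReal.ofReal_mul (by positivity),
          ← ENNReal.ofReal_mul (by positivity), ← ENNReal.ofReal_add (by positivity) (by positivity),
          show (6 : ℝ≥0∞) = ENNReal.ofReal 6 by simp, ← ENNReal.ofReal_mul (by norm_num)]
        refine ENNReal.ofReal_le_ofReal ?_
        have r1 : R ^ (1 / 2 : ℝ) * b = h ^ (1 / 2 : ℝ) * b ^ (1 / 3 : ℝ) := by
          rw [Real.mul_rpow (by positivity) (by positivity), ← Real.rpow_mul (by positivity), mul_assoc]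
          congr 1
          nth_rewrite 2 [← Real.rpow_one b]
          rw [← Real.rpow_add hap]; norm_num
        have r2 : (R⁻¹) ^ (1 / 4 : ℝ) * h ^ (3 / 4 : ℝ) = h ^ (1 / 2 : ℝ) * b ^ (1 / 3 : ℝ) := by
          rw [mul_inv, Real.mul_rpow (by positivity) (by positivity), ← Real.rpow_neg_one h,
            ← Real.rpow_neg_one, ← Real.rpow_mul (by positivity), ← Real.rpow_mul (by positivity),
            ← Real.rpow_mul (by positivity), mul_right_comm, ← Real.rpow_add hHp]
          norm_num
        have r3 : (2 : ℝ) ^ (1 / 4 : ℝ) ≤ 2 := by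
          calc (2 : ℝ) ^ (1 / 4 : ℝ) ≤ 2 ^ (1 : ℝ) :=
                Real.rpow_le_rpow_of_exponent_le (by norm_num) (by norm_num)
            _ = 2 := by simp
        rw [mul_assoc, r1, Real.mul_rpow (x := 2) (by positivity) (by positivity), mul_assoc, r2]
        have : 0 ≤ h ^ (1 / 2 : ℝ) * b ^ (1 / 3 : ℝ) := by positivity
        nlinarith

/-- The fractional integral of order `1/2`. -/
def fracInt (f : ℝ → ℝ≥0∞) (t : ℝ) : ℝ≥0∞ := ∫⁻ s, dispKernel (t - s) * f s

theorem measurable_fracInt {f : ℝ → ℝ≥0∞} (hf : Measurable f) : Measurable (fracInt f) := by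
  have := measurable_dispKernel
  exact Measurable.lintegral_prod_right' (f := fun p : ℝ × ℝ => dispKernel (p.1 - p.2) * f p.2)
    (by fun_prop)

/-- Bilinear Hardy–Littlewood–Sobolev inequality, before optimizing the splitting parameter `m`. -/
theorem lintegral_mul_fracInt_le {f h : ℝ → ℝ≥0∞} (hf : Measurable f) (hh : Measurable h)
    {m : ℝ≥0∞} (hm0 : m ≠ 0) (hmt : m ≠ ∞) :
    ∫⁻ t, h t * fracInt f t ≤
      6 * (m * ((∫⁻ s, h s ^ (4 / 3 : ℝ)) ^ (1 / 2 : ℝ) * ∫⁻ s, f s ^ (4 / 3 : ℝ)))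
      + 6 * (m⁻¹ * ((∫⁻ s, f s ^ (4 / 3 : ℝ)) ^ (1 / 2 : ℝ) * ∫⁻ s, h s ^ (4 / 3 : ℝ))) := by
  have hmd := measurable_dispKernel
  -- For fixed t, the part of φ below the level c³ χ(t) is a bounded function. The previous lemma
  -- produces the cube root c χ(t)^{1/3} of the level, and the factor χ(t) completes it to χ^{4/3}.
  have key : ∀ {φ χ : ℝ → ℝ≥0∞}, Measurable φ → Measurable χ → ∀ c : ℝ≥0∞,
      ∫⁻ t, χ t * ∫⁻ s, dispKernel (t - s) * indicator {s | φ s ≤ c ^ (3 : ℝ) * χ t} φ s ≤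
      6 * (c * ((∫⁻ s, φ s ^ (4 / 3 : ℝ)) ^ (1 / 2 : ℝ) * ∫⁻ s, χ s ^ (4 / 3 : ℝ))) := by
    intro φ χ hφ hχ c
    have hb : ∀ t, χ t * ∫⁻ s, dispKernel (t - s) * indicator {s | φ s ≤ c ^ (3 : ℝ) * χ t} φ s
        ≤ (6 * (c * (∫⁻ s, φ s ^ (4 / 3 : ℝ)) ^ (1 / 2 : ℝ))) * χ t ^ (4 / 3 : ℝ) := by
      intro t
      have hS : MeasurableSet {s | φ s ≤ c ^ (3 : ℝ) * χ t} := measurableSet_le hφ measurable_const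
      have := lintegral_dispKernel_mul_le_of_le t (hφ.indicator hS) (a := c ^ (3 : ℝ) * χ t) fun s => by
        simp only [indicator, mem_ofPred_eq]
        split_ifs with hs
        exacts [hs, bot_le]
      have hmono : ∫⁻ s, indicator {s | φ s ≤ c ^ (3 : ℝ) * χ t} φ s ^ (4 / 3 : ℝ)
          ≤ ∫⁻ s, φ s ^ (4 / 3 : ℝ) :=
        lintegral_mono fun s => by gcongr; exact indicator_le_self _ _ _
      calc _ ≤ χ t * (6 * ((∫⁻ s, φ s ^ (4 / 3 : ℝ)) ^ (1 / 2 : ℝ)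
            * (c ^ (3 : ℝ) * χ t) ^ (1 / 3 : ℝ))) := by
            gcongr; exact this.trans (by gcongr)
        _ = (6 * (c * (∫⁻ s, φ s ^ (4 / 3 : ℝ)) ^ (1 / 2 : ℝ))) * (χ t * χ t ^ (1 / 3 : ℝ)) := by
            rw [ENNReal.mul_rpow_of_nonneg _ _ (by norm_num), ← ENNReal.rpow_mul]
            norm_num
            ring
        _ = _ := by
            congr 1
            nth_rewrite 1 [← ENNReal.rpow_one (χ t)]
            rw [← ENNReal.rpow_add_of_nonneg _ _ (by norm_num) (by norm_num)]
            norm_num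
    refine (lintegral_mono hb).trans (le_of_eq ?_)
    rw [lintegral_const_mul _ (by fun_prop)]
    ring
  have hjm : ∀ {φ χ : ℝ → ℝ≥0∞}, Measurable φ → Measurable χ → ∀ c : ℝ≥0∞,
      Measurable fun p : ℝ × ℝ => χ p.1 * (dispKernel (p.1 - p.2)
        * indicator {s | φ s ≤ c ^ (3 : ℝ) * χ p.1} φ p.2) := by
    intro φ χ hφ hχ c
    have : (fun p : ℝ × ℝ => indicator {s | φ s ≤ c ^ (3 : ℝ) * χ p.1} φ p.2)
        = indicator {p : ℝ × ℝ | φ p.2 ≤ c ^ (3 : ℝ) * χ p.1} (fun p => φ p.2) := rfl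
    have hm : Measurable fun p : ℝ × ℝ => indicator {s | φ s ≤ c ^ (3 : ℝ) * χ p.1} φ p.2 := by
      rw [this]
      exact (hφ.comp measurable_snd).indicator (measurableSet_le (by fun_prop) (by fun_prop))
    fun_prop
  -- At each pair (t, s) either f is below its level in terms of h or h is below its level in terms
  -- of f. The second alternative is integrated in the other order, which the symmetry of the kernel
  -- permits.
  have hpt : ∀ t s, h t * (dispKernel (t - s) * f s) ≤
      h t * (dispKernel (t - s) * indicator {s | f s ≤ (m⁻¹) ^ (3 : ℝ) * h t} f s)
      + f s * (dispKernel (s - t) * indicator {t | h t ≤ m ^ (3 : ℝ) * f s} h t) := by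
    intro t s
    by_cases hc : f s ≤ (m⁻¹) ^ (3 : ℝ) * h t
    · simp only [indicator, mem_ofPred_eq, hc, if_true]
      exact le_self_add
    · have : h t ≤ m ^ (3 : ℝ) * f s := by
        rw [not_le] at hc
        calc h t = m ^ (3 : ℝ) * ((m⁻¹) ^ (3 : ℝ) * h t) := by
              rw [← mul_assoc, ← ENNReal.mul_rpow_of_nonneg _ _ (by norm_num),
                ENNReal.mul_inv_cancel hm0 hmt]; simp
          _ ≤ _ := by gcongr
      simp only [indicator, mem_ofPred_eq, this, if_true, dispKernel_sub_comm s t]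
      refine le_add_left (le_of_eq (by ring))
  calc ∫⁻ t, h t * fracInt f t = ∫⁻ t, ∫⁻ s, h t * (dispKernel (t - s) * f s) := by
        refine lintegral_congr fun t => ?_
        rw [fracInt, lintegral_const_mul _ (by fun_prop)]
    _ ≤ ∫⁻ t, ∫⁻ s, (h t * (dispKernel (t - s) * indicator {s | f s ≤ (m⁻¹) ^ (3 : ℝ) * h t} f s)
      + f s * (dispKernel (s - t) * indicator {t | h t ≤ m ^ (3 : ℝ) * f s} h t)) :=
        lintegral_mono fun t => lintegral_mono fun s => hpt t s
    _ = (∫⁻ t, h t * ∫⁻ s, dispKernel (t - s) * indicator {s | f s ≤ (m⁻¹) ^ (3 : ℝ) * h t} f s)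
        + ∫⁻ s, f s * ∫⁻ t, dispKernel (s - t) * indicator {t | h t ≤ m ^ (3 : ℝ) * f s} h t := by
        have m1 := hjm hf hh m⁻¹
        have m2 := hjm hh hf m
        have m2' := m2.comp measurable_swap
        have e : ∀ t, ∫⁻ s, (h t * (dispKernel (t - s)
              * indicator {s | f s ≤ (m⁻¹) ^ (3 : ℝ) * h t} f s)
            + f s * (dispKernel (s - t) * indicator {t | h t ≤ m ^ (3 : ℝ) * f s} h t))
            = (∫⁻ s, h t * (dispKernel (t - s)
              * indicator {s | f s ≤ (m⁻¹) ^ (3 : ℝ) * h t} f s))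
            + ∫⁻ s, f s * (dispKernel (s - t) * indicator {t | h t ≤ m ^ (3 : ℝ) * f s} h t) :=
          fun t => lintegral_add_left (m1.comp measurable_prodMk_left) _
        rw [lintegral_congr e, lintegral_add_left m1.lintegral_prod_right']
        congr 1
        · refine lintegral_congr fun t => ?_
          rw [← lintegral_const_mul]
          · exact (hmd.comp (by fun_prop)).mul (hf.indicator (measurableSet_le hf measurable_const))
        · rw [lintegral_lintegral_swap (f := fun t s => f s * (dispKernel (s - t)
            * indicator {t | h t ≤ m ^ (3 : ℝ) * f s} h t)) m2'.aemeasurable]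
          refine lintegral_congr fun t => ?_
          rw [← lintegral_const_mul]
          · exact (hmd.comp (by fun_prop)).mul (hh.indicator (measurableSet_le hh measurable_const))
    _ ≤ _ := by
        rw [add_comm]
        exact add_le_add (key hh hf m) (key hf hh m⁻¹)

/-- No optimization is needed on the diagonal: m = 1 already balances the two terms, and 12 = 6 + 6.
This is the form that TT* arguments consume. -/
theorem lintegral_mul_fracInt_self_le {f : ℝ → ℝ≥0∞} (hf : Measurable f) :
    ∫⁻ t, f t * fracInt f t ≤ 12 * (∫⁻ s, f s ^ (4 / 3 : ℝ)) ^ (3 / 2 : ℝ) := by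
  refine (lintegral_mul_fracInt_le hf hf one_ne_zero ENNReal.one_ne_top).trans (le_of_eq ?_)
  have : ∀ F : ℝ≥0∞, F ^ (1 / 2 : ℝ) * F = F ^ (3 / 2 : ℝ) := fun F => by
    nth_rewrite 2 [← ENNReal.rpow_one F]
    rw [← ENNReal.rpow_add_of_nonneg _ _ (by norm_num) (by norm_num)]
    norm_num
  rw [this, inv_one, one_mul, ← add_mul]
  norm_num

/-- The Hardy–Littlewood–Sobolev inequality `L^{4/3} → L^4` on the line. -/
theorem lintegral_fracInt_pow_four_le {f : ℝ → ℝ≥0∞} (hf : Measurable f) :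
    ∫⁻ t, fracInt f t ^ (4 : ℝ) ≤ 144 ^ 2 * (∫⁻ s, f s ^ (4 / 3 : ℝ)) ^ (3 : ℝ) := by
  set F := ∫⁻ s, f s ^ (4 / 3 : ℝ) with hF
  have hmd := measurable_dispKernel
  have hJ := measurable_fracInt hf
  rcases eq_or_ne F ∞ with hFt | hFt
  · rw [hFt]; simp [ENNReal.mul_top]
  rcases eq_or_ne F 0 with hF0 | hF0
  · have h0 := (lintegral_eq_zero_iff (by fun_prop)).1 (hF ▸ hF0)
    have : ∀ t, fracInt f t = 0 := fun t => by
      rw [fracInt, lintegral_eq_zero_iff (by fun_prop)]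
      filter_upwards [h0] with s hs
      have : f s = 0 := (ENNReal.rpow_eq_zero_iff_of_pos (by norm_num)).1 hs
      simp [this]
    simp [this]
  have hn : ∀ n : ℕ, ∫⁻ t in Icc (-n : ℝ) n, min (fracInt f t) n ^ (4 : ℝ)
      ≤ 144 ^ 2 * F ^ (3 : ℝ) := by
    intro n
    -- Duality with the cube of the fractional integral. Truncating in time and height makes the
    -- integral H finite, so that it can be absorbed below.
    set h : ℝ → ℝ≥0∞ := indicator (Icc (-n : ℝ) n) fun t => min (fracInt f t) n ^ (3 : ℝ) with hh
    have hhm : Measurable h := by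
      rw [hh]; exact Measurable.indicator (by fun_prop) measurableSet_Icc
    have e1 : ∫⁻ t, h t ^ (4 / 3 : ℝ) = ∫⁻ t in Icc (-n : ℝ) n, min (fracInt f t) n ^ (4 : ℝ) := by
      rw [← lintegral_indicator measurableSet_Icc]
      refine lintegral_congr fun t => ?_
      by_cases ht : t ∈ Icc (-n : ℝ) n
      · simp only [hh, indicator_of_mem ht]
        rw [← ENNReal.rpow_mul]; norm_num
      · simp [hh, indicator_of_notMem ht]
    rw [← e1]
    set H := ∫⁻ t, h t ^ (4 / 3 : ℝ) with hH
    have hHt : H ≠ ∞ := by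
      rw [e1]
      have hle : ∫⁻ t in Icc (-n : ℝ) n, min (fracInt f t) n ^ (4 : ℝ)
          ≤ ∫⁻ t in Icc (-n : ℝ) n, (n : ℝ≥0∞) ^ (4 : ℝ) := lintegral_mono fun t => ?_
      refine (hle.trans_lt ?_).ne
      · rw [setLIntegral_const]
        exact ENNReal.mul_lt_top (by simp) (by simp)
      · gcongr; exact min_le_right _ _
    have hle : H ≤ ∫⁻ t, h t * fracInt f t := by
      refine lintegral_mono fun t => ?_
      by_cases ht : t ∈ Icc (-n : ℝ) n
      · simp only [hh, indicator_of_mem ht]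
        rw [← ENNReal.rpow_mul]
        calc min (fracInt f t) n ^ ((3 : ℝ) * (4 / 3))
            = min (fracInt f t) n ^ (3 : ℝ) * min (fracInt f t) n := by
              nth_rewrite 3 [← ENNReal.rpow_one (min (fracInt f t) n)]
              rw [← ENNReal.rpow_add_of_nonneg _ _ (by norm_num) (by norm_num)]
              norm_num
          _ ≤ _ := by gcongr; exact min_le_left _ _
      · simp [hh, indicator_of_notMem ht]
    -- With m = 12 F^{1/2} the second term of the bilinear bound is exactly H/2. Absorbing it leaves
    -- H ≤ 144 F^{3/2} H^{1/2}.
    have hmain := hle.trans (lintegral_mul_fracInt_le hf hhm (m := 12 * F ^ (1 / 2 : ℝ))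
      (by simp [hF0]) (ENNReal.mul_ne_top (by norm_num) (by simp [hFt])))
    rw [← hF, ← hH] at hmain
    set a := F.toReal
    set b := H.toReal
    have eF : F = ENNReal.ofReal a := (ENNReal.ofReal_toReal hFt).symm
    have eH : H = ENNReal.ofReal b := (ENNReal.ofReal_toReal hHt).symm
    have hap : 0 < a := ENNReal.toReal_pos hF0 hFt
    have hb0 : 0 ≤ b := ENNReal.toReal_nonneg
    have hs : F ^ (1 / 2 : ℝ) = ENNReal.ofReal (√a) := by
      rw [eF, ENNReal.ofReal_rpow_of_pos hap, Real.sqrt_eq_rpow]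
    have hs' : H ^ (1 / 2 : ℝ) = ENNReal.ofReal (√b) := by
      rw [eH, ENNReal.ofReal_rpow_of_nonneg hb0 (by norm_num), Real.sqrt_eq_rpow]
    rw [hs, hs', eF, eH, show (12 : ℝ≥0∞) = ENNReal.ofReal 12 by simp,
      ← ENNReal.ofReal_mul (by norm_num), ← ENNReal.ofReal_inv_of_pos (by positivity),
      show (6 : ℝ≥0∞) = ENNReal.ofReal 6 by simp,
      ← ENNReal.ofReal_mul (by positivity), ← ENNReal.ofReal_mul (by positivity),
      ← ENNReal.ofReal_mul (by positivity), ← ENNReal.ofReal_mul (by positivity),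
      ← ENNReal.ofReal_mul (by positivity), ← ENNReal.ofReal_mul (by positivity),
      ← ENNReal.ofReal_add (by positivity) (by positivity),
      ENNReal.ofReal_le_ofReal_iff (by positivity)] at hmain
    have hsa : 0 < √a := Real.sqrt_pos.2 hap
    have hsa2 : √a ^ 2 = a := Real.sq_sqrt hap.le
    have hsb2 : √b ^ 2 = b := Real.sq_sqrt hb0
    have e2 : (12 * √a)⁻¹ * (√a * b) = b / 12 := by field_simp
    rw [e2] at hmain
    have h3 : √b * √b ≤ (144 * (√a * a)) * √b := by nlinarith
    have h4 : √b ≤ 144 * (√a * a) := by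
      rcases (Real.sqrt_nonneg b).eq_or_lt with h0 | h0
      · rw [← h0]; positivity
      · exact le_of_mul_le_mul_right h3 h0
    rw [eF, eH, ENNReal.ofReal_rpow_of_pos hap, show (144 : ℝ≥0∞) ^ 2 = ENNReal.ofReal (144 ^ 2) by norm_num,
      ← ENNReal.ofReal_mul (by norm_num)]
    refine ENNReal.ofReal_le_ofReal ?_
    have h5 : √b ^ 2 ≤ (144 * (√a * a)) ^ 2 := by gcongr
    rw [hsb2] at h5
    refine h5.trans (le_of_eq ?_)
    rw [show (3 : ℝ) = (3 : ℕ) by norm_num, Real.rpow_natCast, mul_pow, mul_pow, hsa2]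
    ring
  have hlim : ∫⁻ t, fracInt f t ^ (4 : ℝ)
      = ⨆ n : ℕ, ∫⁻ t in Icc (-n : ℝ) n, min (fracInt f t) n ^ (4 : ℝ) := by
    have : ∀ n : ℕ, ∫⁻ t in Icc (-n : ℝ) n, min (fracInt f t) n ^ (4 : ℝ)
        = ∫⁻ t, indicator (Icc (-n : ℝ) n) (fun t => min (fracInt f t) n ^ (4 : ℝ)) t := fun n =>
      (lintegral_indicator measurableSet_Icc _).symm
    simp_rw [this]
    rw [← lintegral_iSup (fun n => Measurable.indicator (by fun_prop) measurableSet_Icc)]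
    · refine lintegral_congr fun t => ?_
      refine le_antisymm ?_ (iSup_le fun n => ?_)
      · have hlim : Tendsto (fun n : ℕ => min (fracInt f t) (n : ℝ≥0∞) ^ (4 : ℝ)) atTop
            (𝓝 (fracInt f t ^ (4 : ℝ))) := by
          have h1 := (tendsto_const_nhds (x := fracInt f t)).min ENNReal.tendsto_nat_nhds_top
          rw [min_eq_left le_top] at h1
          exact (ENNReal.continuous_rpow_const.tendsto _).comp h1
        refine le_of_tendsto hlim ?_
        obtain ⟨N, hN⟩ := exists_nat_ge |t|
        filter_upwards [eventually_ge_atTop N] with n hn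
        have : t ∈ Icc (-n : ℝ) n := abs_le.1 (hN.trans (by exact_mod_cast hn))
        refine le_trans (le_of_eq ?_) (le_iSup _ n)
        rw [indicator_of_mem this]
      · refine (indicator_le_self _ _ _).trans ?_
        gcongr; exact min_le_left _ _
    · intro n k hnk t
      refine indicator_le_indicator_of_subset ?_ (fun _ => bot_le) t |>.trans ?_ (b := indicator (Icc (-k : ℝ) k) (fun t => min (fracInt f t) n ^ (4 : ℝ)) t)
      · have : (n : ℝ) ≤ k := by exact_mod_cast hnk
        exact Icc_subset_Icc (by linarith) this
      · refine indicator_le_indicator ?_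
        gcongr
  rw [hlim]
  exact iSup_le hn

theorem fracInt_congr {f f' : ℝ → ℝ≥0∞} (h : f =ᵐ[volume] f') : fracInt f = fracInt f' := by
  funext t
  refine lintegral_congr_ae ?_
  filter_upwards [h] with s hs
  rw [hs]

theorem measurable_fracInt_of_aemeasurable {f : ℝ → ℝ≥0∞} (hf : AEMeasurable f volume) :
    Measurable (fracInt f) := by
  rw [fracInt_congr hf.ae_eq_mk]
  exact measurable_fracInt hf.measurable_mk

theorem lintegral_mul_fracInt_self_le_of_aemeasurable {f : ℝ → ℝ≥0∞} (hf : AEMeasurable f volume) :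
    ∫⁻ t, f t * fracInt f t ≤ 12 * (∫⁻ s, f s ^ (4 / 3 : ℝ)) ^ (3 / 2 : ℝ) := by
  have e1 : ∫⁻ t, f t * fracInt f t = ∫⁻ t, hf.mk f t * fracInt (hf.mk f) t := by
    rw [fracInt_congr hf.ae_eq_mk]
    exact lintegral_congr_ae (hf.ae_eq_mk.mul (EventuallyEq.refl _ _))
  have e2 : ∫⁻ s, f s ^ (4 / 3 : ℝ) = ∫⁻ s, hf.mk f s ^ (4 / 3 : ℝ) :=
    lintegral_congr_ae (hf.ae_eq_mk.fun_comp (· ^ (4 / 3 : ℝ)))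
  rw [e1, e2]
  exact lintegral_mul_fracInt_self_le hf.measurable_mk

theorem lintegral_fracInt_pow_four_le_of_aemeasurable {f : ℝ → ℝ≥0∞} (hf : AEMeasurable f volume) :
    ∫⁻ t, fracInt f t ^ (4 : ℝ) ≤ 144 ^ 2 * (∫⁻ s, f s ^ (4 / 3 : ℝ)) ^ (3 : ℝ) := by
  have e2 : ∫⁻ s, f s ^ (4 / 3 : ℝ) = ∫⁻ s, hf.mk f s ^ (4 / 3 : ℝ) :=
    lintegral_congr_ae (hf.ae_eq_mk.fun_comp (· ^ (4 / 3 : ℝ)))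
  rw [fracInt_congr hf.ae_eq_mk, e2]
  exact lintegral_fracInt_pow_four_le hf.measurable_mk

/-! ### Damped plane waves and the dispersive estimate -/

/-- The damped wave `e^{-rξ²} e^{2πi x ξ} e^{-4π² i τ ξ²}`. -/
def wave (r τ x ξ : ℝ) : ℂ :=
  Complex.exp ((-(r * ξ ^ 2) : ℝ)
    + (2 * Real.pi * x * ξ - 4 * Real.pi ^ 2 * τ * ξ ^ 2 : ℝ) * Complex.I)

theorem norm_wave (r τ x ξ : ℝ) : ‖wave r τ x ξ‖ = Real.exp (-(r * ξ ^ 2)) := by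
  rw [wave, Complex.norm_exp, Complex.add_re, Complex.ofReal_re, Complex.re_ofReal_mul,
    Complex.I_re, mul_zero, add_zero]

theorem norm_wave_le_one {r : ℝ} (hr : 0 ≤ r) (τ x ξ : ℝ) : ‖wave r τ x ξ‖ ≤ 1 := by
  rw [norm_wave]
  exact Real.exp_le_one_iff.2 (by have := mul_nonneg hr (sq_nonneg ξ); linarith)

theorem continuous_wave : Continuous fun p : ℝ × ℝ × ℝ × ℝ => wave p.1 p.2.1 p.2.2.1 p.2.2.2 := by
  unfold wave; fun_prop

theorem Continuous.wave {Y : Type*} [TopologicalSpace Y] {r τ x ξ : Y → ℝ} (hr : Continuous r)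
    (hτ : Continuous τ) (hx : Continuous x) (hξ : Continuous ξ) :
    Continuous fun y => wave (r y) (τ y) (x y) (ξ y) :=
  continuous_wave.comp (hr.prodMk (hτ.prodMk (hx.prodMk hξ)))

theorem Measurable.wave {Y : Type*} [MeasurableSpace Y] {r τ x ξ : Y → ℝ} (hr : Measurable r)
    (hτ : Measurable τ) (hx : Measurable x) (hξ : Measurable ξ) :
    Measurable fun y => wave (r y) (τ y) (x y) (ξ y) :=
  continuous_wave.measurable.comp (hr.prodMk (hτ.prodMk (hx.prodMk hξ)))

theorem wave_mul_wave (r τ x r' τ' x' ξ : ℝ) :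
    wave r τ x ξ * wave r' τ' x' ξ = wave (r + r') (τ + τ') (x + x') ξ := by
  rw [wave, wave, wave, ← Complex.exp_add]
  congr 1
  push_cast
  ring

theorem conj_wave (r τ x ξ : ℝ) :
    (starRingEnd ℂ) (wave r τ x ξ) = wave r (-τ) (-x) ξ := by
  rw [wave, wave, ← Complex.exp_conj]
  congr 1
  simp only [map_add, map_mul, Complex.conj_ofReal, Complex.conj_I]
  push_cast
  ring

theorem freeSymbol_eq_wave (t ξ : ℝ) : freeSymbol t ξ = wave 0 t 0 ξ := by
  simp [freeSymbol, wave]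

theorem wave_zero_zero_zero (ξ : ℝ) : wave 0 0 0 ξ = 1 := by simp [wave]

theorem integrable_wave {r : ℝ} (hr : 0 < r) (τ x : ℝ) : Integrable (wave r τ x) := by
  refine (integrable_exp_neg_mul_sq hr).mono'
    (Continuous.wave continuous_const continuous_const continuous_const
      continuous_id).aestronglyMeasurable
    (ae_of_all _ fun ξ => ?_)
  rw [norm_wave, neg_mul]

theorem integral_wave {r : ℝ} (hr : 0 < r) (τ x : ℝ) :
    ∫ ξ, wave r τ x ξ = (Real.pi / (r + 4 * Real.pi ^ 2 * τ * Complex.I)) ^ (1 / 2 : ℂ)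
      * Complex.exp (-(2 * Real.pi * x) ^ 2 / (4 * (r + 4 * Real.pi ^ 2 * τ * Complex.I))) := by
  have hre : 0 < (r + 4 * Real.pi ^ 2 * τ * Complex.I : ℂ).re := by
    have : (4 * Real.pi ^ 2 * τ * Complex.I : ℂ) = ((4 * Real.pi ^ 2 * τ : ℝ) : ℂ) * Complex.I := by
      push_cast; ring
    rw [this, Complex.add_re, Complex.ofReal_re, Complex.re_ofReal_mul, Complex.I_re]
    simpa using hr
  rw [← fourierIntegral_gaussian hre]
  refine integral_congr_ae (ae_of_all _ fun ξ => ?_)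
  simp only [wave]
  rw [← Complex.exp_add]
  congr 1
  push_cast
  ring

/-- The dispersive estimate, uniform in the damping. -/
theorem enorm_integral_wave_le {r : ℝ} (hr : 0 < r) (τ x : ℝ) :
    ‖∫ ξ, wave r τ x ξ‖ₑ ≤ dispKernel τ := by
  rcases eq_or_ne τ 0 with rfl | hτ
  · simp [dispKernel]
  set b : ℂ := r + 4 * Real.pi ^ 2 * τ * Complex.I with hb
  have hb' : b = (r : ℂ) + ((4 * Real.pi ^ 2 * τ : ℝ) : ℂ) * Complex.I := by
    rw [hb]; push_cast; ring
  have hre : b.re = r := by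
    rw [hb', Complex.add_re, Complex.ofReal_re, Complex.re_ofReal_mul, Complex.I_re]; simp
  have him : b.im = 4 * Real.pi ^ 2 * τ := by
    rw [hb', Complex.add_im, Complex.ofReal_im, Complex.im_ofReal_mul, Complex.I_im]; simp
  have hb0 : b ≠ 0 := fun h => hr.ne' (by rw [← hre, h]; simp)
  have hτ' : 0 < |τ| := abs_pos.2 hτ
  -- The lower bound uses only the imaginary part of b, hence is uniform in the damping r. The real
  -- part r > 0 serves only to keep the Gaussian factor bounded by one.
  have hbn : 4 * Real.pi ^ 2 * |τ| ≤ ‖b‖ := by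
    have := Complex.abs_im_le_norm b
    rwa [him, abs_mul, abs_of_pos (by positivity)] at this
  have h1 : ‖Complex.exp (-(2 * Real.pi * x) ^ 2 / (4 * b))‖ ≤ 1 := by
    rw [Complex.norm_exp, Real.exp_le_one_iff]
    have : (-(2 * Real.pi * x) ^ 2 / (4 * b) : ℂ) = ((-(2 * Real.pi * x) ^ 2 / 4 : ℝ) : ℂ) * b⁻¹ := by
      push_cast; field_simp
    rw [this, Complex.re_ofReal_mul, Complex.inv_re, hre]
    have h3 : 0 ≤ r / Complex.normSq b := div_nonneg hr.le (Complex.normSq_nonneg _)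
    have h4 : 0 ≤ (2 * Real.pi * x) ^ 2 := sq_nonneg _
    nlinarith
  have h2 : ‖((Real.pi : ℂ) / b) ^ (1 / 2 : ℂ)‖ ≤ |τ| ^ (-(1 / 2) : ℝ) := by
    have : (1 / 2 : ℂ) = ((1 / 2 : ℝ) : ℂ) := by push_cast; ring
    rw [this, Complex.norm_cpow_real, norm_div, Complex.norm_real, Real.norm_of_nonneg Real.pi_pos.le,
      Real.rpow_neg hτ'.le, ← Real.inv_rpow hτ'.le]
    refine Real.rpow_le_rpow (by positivity) ?_ (by norm_num)
    rw [div_le_iff₀ (norm_pos_iff.2 hb0), inv_mul_eq_div, le_div_iff₀ hτ']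
    have : Real.pi * 1 ≤ 4 * Real.pi * Real.pi := by
      have := Real.pi_gt_three
      nlinarith
    nlinarith
  rw [integral_wave hr, ← hb, enorm_mul, dispKernel, Real.enorm_eq_ofReal_abs,
    ENNReal.ofReal_rpow_of_pos hτ', ← ofReal_norm, ← ofReal_norm,
    ← ENNReal.ofReal_mul (norm_nonneg _)]
  refine ENNReal.ofReal_le_ofReal ?_
  calc _ ≤ |τ| ^ (-(1 / 2) : ℝ) * 1 := by gcongr
    _ = _ := mul_one _

/-! ### The TT* estimate for superpositions of waves -/

section TTStar

variable {Y : Type*} [MeasurableSpace Y] {σ : Measure Y} {A : Y → ℂ} {r τ x : Y → ℝ}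

theorem integrable_mul_wave (hA : Integrable A σ) (hr : Measurable r) (hτ : Measurable τ)
    (hx : Measurable x) (hr0 : ∀ y, 0 ≤ r y) (ξ : ℝ) :
    Integrable (fun y => A y * wave (r y) (τ y) (x y) ξ) σ := by
  refine hA.mul_bdd (c := 1) (hr.wave hτ hx measurable_const).aestronglyMeasurable
    (ae_of_all _ fun y => norm_wave_le_one (hr0 y) _ _ _)

theorem continuous_integral_mul_wave (hA : Integrable A σ) (hr : Measurable r) (hτ : Measurable τ)
    (hx : Measurable x) (hr0 : ∀ y, 0 ≤ r y) :
    Continuous fun ξ => ∫ y, A y * wave (r y) (τ y) (x y) ξ ∂σ := by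
  refine continuous_of_dominated (bound := fun y => ‖A y‖)
    (fun ξ => (integrable_mul_wave hA hr hτ hx hr0 ξ).aestronglyMeasurable)
    (fun ξ => ae_of_all _ fun y => ?_) hA.norm
    (ae_of_all _ fun y => continuous_const.mul
      (Continuous.wave continuous_const continuous_const continuous_const continuous_id))
  rw [norm_mul]
  exact mul_le_of_le_one_right (norm_nonneg _) (norm_wave_le_one (hr0 y) _ _ _)

/-- The `TT*` estimate: the `L²` norm of a superposition of waves is controlled by the decay of
the dispersive kernel. -/
theorem lintegral_enorm_integral_wave_sq_le [SFinite σ] (hA : Integrable A σ) (hr : Measurable r)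
    (hτ : Measurable τ) (hx : Measurable x) (hr0 : ∀ y, 0 ≤ r y) :
    ∫⁻ ξ, ‖∫ y, A y * wave (r y) (τ y) (x y) ξ ∂σ‖ₑ ^ (2 : ℝ) ≤
      ∫⁻ y, ∫⁻ y', ‖A y‖ₑ * ‖A y'‖ₑ * dispKernel (τ y - τ y') ∂σ ∂σ := by
  set h : ℝ → ℂ := fun ξ => ∫ y, A y * wave (r y) (τ y) (x y) ξ ∂σ with hh
  have hcont : Continuous h := continuous_integral_mul_wave hA hr hτ hx hr0
  have hbd : ∀ ξ, ‖h ξ‖ ≤ ∫ y, ‖A y‖ ∂σ := fun ξ => by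
    refine norm_integral_le_of_norm_le hA.norm (ae_of_all _ fun y => ?_)
    rw [norm_mul]
    exact mul_le_of_le_one_right (norm_nonneg _) (norm_wave_le_one (hr0 y) _ _ _)
  have hAA : Integrable (fun p : Y × Y => A p.1 * (starRingEnd ℂ) (A p.2)) (σ.prod σ) :=
    hA.mul_prod (Complex.conjCLE.toContinuousLinearMap.integrable_comp hA)
  have hW : ∀ a : ℝ, Measurable fun q : ℝ × (Y × Y) => wave (a + r q.2.1 + r q.2.2)
      (τ q.2.1 - τ q.2.2) (x q.2.1 - x q.2.2) q.1 := fun a =>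
    Measurable.wave (by fun_prop) (by fun_prop) (by fun_prop) (by fun_prop)
  -- A Gaussian weight makes the frequency integral absolutely convergent, so that Fubini applies to
  -- the squared superposition. The extra damping a is harmless because the dispersive estimate does
  -- not see it.
  have hreg : ∀ a : ℝ, 0 < a → ∫⁻ ξ, ENNReal.ofReal (Real.exp (-(a * ξ ^ 2))) * ‖h ξ‖ₑ ^ (2 : ℝ) ≤
      ∫⁻ y, ∫⁻ y', ‖A y‖ₑ * ‖A y'‖ₑ * dispKernel (τ y - τ y') ∂σ ∂σ := by
    intro a ha
    have e1 : ∀ ξ, ((Real.exp (-(a * ξ ^ 2)) * ‖h ξ‖ ^ 2 : ℝ) : ℂ) =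
        ∫ p, A p.1 * (starRingEnd ℂ) (A p.2) * wave (a + r p.1 + r p.2) (τ p.1 - τ p.2)
          (x p.1 - x p.2) ξ ∂(σ.prod σ) := by
      intro ξ
      have e2 : ((‖h ξ‖ ^ 2 : ℝ) : ℂ) = ∫ p, (A p.1 * wave (r p.1) (τ p.1) (x p.1) ξ)
          * (starRingEnd ℂ) (A p.2 * wave (r p.2) (τ p.2) (x p.2) ξ) ∂(σ.prod σ) := by
        rw [integral_prod_mul (fun y => A y * wave (r y) (τ y) (x y) ξ)
          (fun y => (starRingEnd ℂ) (A y * wave (r y) (τ y) (x y) ξ)), integral_conj,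
          Complex.mul_conj, Complex.normSq_eq_norm_sq]
      have e3 : ((Real.exp (-(a * ξ ^ 2)) : ℝ) : ℂ) = wave a 0 0 ξ := by simp [wave]
      rw [Complex.ofReal_mul, e2, e3, ← integral_const_mul]
      refine integral_congr_ae (ae_of_all _ fun p => ?_)
      simp only [map_mul, conj_wave]
      rw [show a + r p.1 + r p.2 = a + (r p.1 + r p.2) by ring,
        show τ p.1 - τ p.2 = 0 + (τ p.1 + -τ p.2) by ring,
        show x p.1 - x p.2 = 0 + (x p.1 + -x p.2) by ring, ← wave_mul_wave, ← wave_mul_wave]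
      ring
    have hint : Integrable (fun ξ => Real.exp (-(a * ξ ^ 2)) * ‖h ξ‖ ^ 2) := by
      have hg : Integrable fun ξ : ℝ => Real.exp (-(a * ξ ^ 2)) := by
        simpa [neg_mul] using integrable_exp_neg_mul_sq ha
      refine hg.mul_bdd (c := (∫ y, ‖A y‖ ∂σ) ^ 2)
        (hcont.norm.pow 2).aestronglyMeasurable (ae_of_all _ fun ξ => ?_)
      rw [Real.norm_of_nonneg (by positivity)]
      gcongr
      exact hbd ξ
    have hfub : Integrable (fun q : ℝ × (Y × Y) => A q.2.1 * (starRingEnd ℂ) (A q.2.2)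
        * wave (a + r q.2.1 + r q.2.2) (τ q.2.1 - τ q.2.2) (x q.2.1 - x q.2.2) q.1)
        ((volume : Measure ℝ).prod (σ.prod σ)) := by
      have h1 : Integrable (fun q : ℝ × (Y × Y) => Real.exp (-a * q.1 ^ 2)
          * ‖A q.2.1 * (starRingEnd ℂ) (A q.2.2)‖) ((volume : Measure ℝ).prod (σ.prod σ)) :=
        (integrable_exp_neg_mul_sq ha).mul_prod hAA.norm
      refine h1.mono' ((hAA.aestronglyMeasurable.comp_snd).mul (hW a).aestronglyMeasurable)
        (ae_of_all _ fun q => ?_)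
      rw [norm_mul, norm_wave, mul_comm]
      gcongr
      have h1 := mul_nonneg (hr0 q.2.1) (sq_nonneg q.1)
      have h2 := mul_nonneg (hr0 q.2.2) (sq_nonneg q.1)
      nlinarith
    have e4 : ∫⁻ ξ, ENNReal.ofReal (Real.exp (-(a * ξ ^ 2))) * ‖h ξ‖ₑ ^ (2 : ℝ)
        = ‖∫ p, A p.1 * (starRingEnd ℂ) (A p.2) * (∫ ξ, wave (a + r p.1 + r p.2) (τ p.1 - τ p.2)
          (x p.1 - x p.2) ξ) ∂(σ.prod σ)‖ₑ := by
      have e5 : ∀ ξ, ENNReal.ofReal (Real.exp (-(a * ξ ^ 2))) * ‖h ξ‖ₑ ^ (2 : ℝ)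
          = ENNReal.ofReal (Real.exp (-(a * ξ ^ 2)) * ‖h ξ‖ ^ 2) := fun ξ => by
        rw [ENNReal.ofReal_mul (by positivity), ENNReal.ofReal_pow (norm_nonneg _), ofReal_norm]
        norm_num
      rw [lintegral_congr e5, ← ofReal_integral_eq_lintegral_ofReal hint
        (ae_of_all _ fun ξ => by positivity)]
      rw [← Real.enorm_of_nonneg (integral_nonneg fun ξ => by positivity), ← enorm_norm,
        ← Complex.norm_real, enorm_norm, ← integral_complex_ofReal]
      congr 1
      simp_rw [e1]
      rw [integral_integral_swap hfub]
      refine integral_congr_ae (ae_of_all _ fun p => ?_)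
      exact integral_const_mul _ _
    rw [e4]
    refine (enorm_integral_le_lintegral_enorm _).trans ?_
    refine (lintegral_mono (g := fun p : Y × Y => ‖A p.1‖ₑ * ‖A p.2‖ₑ * dispKernel (τ p.1 - τ p.2))
      fun p => ?_).trans (le_of_eq (lintegral_prod _ ?_))
    · rw [enorm_mul, enorm_mul, RCLike.enorm_conj]
      exact mul_le_mul' le_rfl
        (enorm_integral_wave_le (by have := hr0 p.1; have := hr0 p.2; linarith) _ _)
    · exact ((hA.aestronglyMeasurable.comp_fst.enorm).mul
        (hA.aestronglyMeasurable.comp_snd.enorm)).mul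
        (measurable_dispKernel.comp (by fun_prop)).aemeasurable
  have hmeas : ∀ n : ℕ, Measurable fun ξ : ℝ =>
      ENNReal.ofReal (Real.exp (-(1 / ((n : ℝ) + 1) * ξ ^ 2))) * ‖h ξ‖ₑ ^ (2 : ℝ) := fun n => by
    have := hcont.measurable
    fun_prop
  have hlim : ∀ ξ, Tendsto (fun n : ℕ =>
      ENNReal.ofReal (Real.exp (-(1 / ((n : ℝ) + 1) * ξ ^ 2))) * ‖h ξ‖ₑ ^ (2 : ℝ)) atTop
      (𝓝 (‖h ξ‖ₑ ^ (2 : ℝ))) := by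
    intro ξ
    have h1 : Tendsto (fun n : ℕ => -(1 / ((n : ℝ) + 1) * ξ ^ 2)) atTop (𝓝 (-(0 * ξ ^ 2))) :=
      (tendsto_one_div_add_atTop_nhds_zero_nat.mul_const _).neg
    have h2 := (ENNReal.continuous_ofReal.comp Real.continuous_exp).tendsto _ |>.comp h1
    have h3 := ENNReal.Tendsto.mul_const (b := ‖h ξ‖ₑ ^ (2 : ℝ)) h2 (Or.inl (by simp))
    simpa using h3
  -- The weight is removed by Fatou's lemma; finiteness of the left side need not be known
  -- beforehand.
  calc ∫⁻ ξ, ‖h ξ‖ₑ ^ (2 : ℝ)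
      = ∫⁻ ξ, liminf (fun n : ℕ =>
          ENNReal.ofReal (Real.exp (-(1 / ((n : ℝ) + 1) * ξ ^ 2))) * ‖h ξ‖ₑ ^ (2 : ℝ)) atTop :=
        lintegral_congr fun ξ => (hlim ξ).liminf_eq.symm
    _ ≤ liminf (fun n : ℕ => ∫⁻ ξ,
          ENNReal.ofReal (Real.exp (-(1 / ((n : ℝ) + 1) * ξ ^ 2))) * ‖h ξ‖ₑ ^ (2 : ℝ)) atTop :=
        lintegral_liminf_le hmeas
    _ ≤ _ := by
        refine liminf_le_of_le (by isBoundedDefault) fun b hb => ?_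
        obtain ⟨n, hn⟩ := hb.exists
        exact hn.trans (hreg _ (by positivity))

end TTStar

/-! ### Continuous representatives through Gaussian regularization -/

/-- Dominated convergence for uniformly bounded Fourier multipliers. It serves for removing the
damping, for the strong continuity of the propagator, and for the Fourier transforms of the
concentrating couplings. -/
theorem tendsto_eLpNorm_mul_sub {ι : Type*} {l : Filter ι} [l.IsCountablyGenerated]
    {m : ι → ℝ → ℂ} {m₀ : ℝ → ℂ} {C : ℝ} (hm : ∀ i, AEStronglyMeasurable (m i) volume)
    (hC : ∀ i ξ, ‖m i ξ‖ ≤ C) (hlim : ∀ ξ, Tendsto (fun i => m i ξ) l (𝓝 (m₀ ξ)))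
    (hC₀ : ∀ ξ, ‖m₀ ξ‖ ≤ C) (hm₀ : AEStronglyMeasurable m₀ volume)
    {h : ℝ → ℂ} (hh : MemLp h 2 volume) :
    Tendsto (fun i => eLpNorm (fun ξ => m i ξ * h ξ - m₀ ξ * h ξ) 2 volume) l (𝓝 0) := by
  have key : Tendsto (fun i => ∫⁻ ξ, ‖m i ξ * h ξ - m₀ ξ * h ξ‖ₑ ^ (2 : ℝ)) l
      (𝓝 (∫⁻ _ : ℝ, (0 : ℝ≥0∞))) := by
    refine tendsto_lintegral_filter_of_dominated_convergence'
      (fun ξ => (ENNReal.ofReal (2 * C) * ‖h ξ‖ₑ) ^ (2 : ℝ)) ?_ ?_ ?_ ?_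
    · exact Eventually.of_forall fun i =>
        (((hm i).mul hh.1).sub (hm₀.mul hh.1)).enorm.pow_const _
    · refine Eventually.of_forall fun i => ae_of_all _ fun ξ => ?_
      rw [← sub_mul, enorm_mul]
      gcongr
      rw [← ofReal_norm]
      refine ENNReal.ofReal_le_ofReal ((norm_sub_le _ _).trans ?_)
      have h1 := hC i ξ
      have h2 := hC₀ ξ
      linarith
    · have h1 := hh.2
      rw [eLpNorm_lt_top_iff_lintegral_rpow_enorm_lt_top (by norm_num) (by norm_num)] at h1
      have h2 : ∀ ξ, (ENNReal.ofReal (2 * C) * ‖h ξ‖ₑ) ^ (2 : ℝ)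
          = ENNReal.ofReal (2 * C) ^ (2 : ℝ) * ‖h ξ‖ₑ ^ (2 : ℝ) := fun ξ =>
        ENNReal.mul_rpow_of_nonneg _ _ (by norm_num)
      simp_rw [h2]
      rw [lintegral_const_mul' _ _ (by finiteness)]
      exact (ENNReal.mul_lt_top (by finiteness) (by simpa using h1)).ne
    · refine ae_of_all _ fun ξ => ?_
      have h1 : Tendsto (fun i => m i ξ * h ξ - m₀ ξ * h ξ) l (𝓝 0) := by
        simpa using ((hlim ξ).mul_const (h ξ)).sub_const (m₀ ξ * h ξ)
      have h2 := (ENNReal.continuous_rpow_const (y := 2)).tendsto _ |>.comp h1.enorm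
      simpa [Function.comp_def] using h2
  have h3 := (ENNReal.continuous_rpow_const (y := 1 / 2)).tendsto _ |>.comp key
  simp only [lintegral_zero] at h3
  refine (h3.congr fun i => ?_).trans_eq (by simp)
  rw [eLpNorm_eq_lintegral_rpow_enorm_toReal (by norm_num) (by norm_num)]
  simp

theorem memLp_two_wave {r : ℝ} (hr : 0 < r) (τ x : ℝ) : MemLp (wave r τ x) 2 volume := by
  refine (memLp_two_iff_integrable_sq_norm
    (integrable_wave hr τ x).aestronglyMeasurable).2 ?_
  have : ∀ ξ, ‖wave r τ x ξ‖ ^ 2 = Real.exp (-(2 * r) * ξ ^ 2) := fun ξ => by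
    rw [norm_wave, ← Real.exp_nat_mul]; congr 1; push_cast; ring
  simp_rw [this]
  exact integrable_exp_neg_mul_sq (by positivity)

/-- The Gaussian damping rates used to regularize inverse Fourier transforms. -/
def dampRate (n : ℕ) : ℝ := 1 / ((n : ℝ) + 1)

theorem dampRate_pos (n : ℕ) : 0 < dampRate n := by unfold dampRate; positivity

theorem tendsto_dampRate : Tendsto dampRate atTop (𝓝 0) :=
  tendsto_one_div_add_atTop_nhds_zero_nat

/-- The regularized inverse Fourier transform from `L²` to bounded continuous functions. -/
def regInv (n : ℕ) : L2R →L[ℂ] (ℝ →ᵇ ℂ) :=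
  Real.Lp.fourierTransformInvCLM ℝ ℂ ∘L
    ((ContinuousLinearMap.mul ℂ ℂ).holderL volume 2 2 1
      ((memLp_two_wave (dampRate_pos n) 0 0).toLp _))

theorem fourierInv_eq_integral_wave (k : ℝ → ℂ) (x : ℝ) :
    (𝓕⁻ k : ℝ → ℂ) x = ∫ ξ, wave 0 0 x ξ * k ξ := by
  rw [Real.fourierInv_eq']
  refine integral_congr_ae (ae_of_all _ fun ξ => ?_)
  simp only [wave, smul_eq_mul]
  congr 2
  simp [mul_assoc, mul_comm, mul_left_comm]

theorem regInv_apply (n : ℕ) (h : L2R) (x : ℝ) :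
    regInv n h x = ∫ ξ, wave (dampRate n) 0 x ξ * h ξ := by
  simp only [regInv, ContinuousLinearMap.comp_apply, Real.Lp.fourierTransformInvCLM_apply,
    Real.Lp.fourierTransformInv_apply, ContinuousLinearMap.holderL_apply_apply]
  rw [fourierInv_eq_integral_wave]
  refine integral_congr_ae ?_
  filter_upwards [(ContinuousLinearMap.mul ℂ ℂ).coeFn_holder (r := 1)
    ((memLp_two_wave (dampRate_pos n) 0 0).toLp _) h,
    (memLp_two_wave (dampRate_pos n) 0 0).coeFn_toLp] with ξ h1 h2
  rw [h1, ContinuousLinearMap.mul_apply', h2, ← mul_assoc, wave_mul_wave]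
  simp

theorem integrable_wave_mul {r : ℝ} (hr : 0 < r) (τ x : ℝ) (h : L2R) :
    Integrable fun ξ => wave r τ x ξ * h ξ :=
  (memLp_two_wave hr τ x).integrable_mul (Lp.memLp h)

/-- Inverse Fourier transform of an integrable function, as a bounded continuous function. -/
def invBCF {k : ℝ → ℂ} (hk : Integrable k) : ℝ →ᵇ ℂ :=
  Real.Lp.fourierTransformInv (memLp_one_iff_integrable.2 hk).toLp

theorem invBCF_apply {k : ℝ → ℂ} (hk : Integrable k) (x : ℝ) :
    invBCF hk x = ∫ ξ, wave 0 0 x ξ * k ξ := by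
  rw [invBCF, Real.Lp.fourierTransformInv_toLp, fourierInv_eq_integral_wave]

/-- The increment over a distance z is bounded, uniformly in position, by the integral of |e^{2πizξ}
- 1| |k(ξ)|, which tends to zero by dominated convergence. Averages of small translates are later
controlled by this uniform continuity. -/
theorem uniformContinuous_invBCF {k : ℝ → ℂ} (hk : Integrable k) :
    UniformContinuous (invBCF hk) := by
  refine Metric.uniformContinuous_iff.2 fun δ hδ => ?_
  have hlim : Tendsto (fun z : ℝ => ∫ ξ, ‖(wave 0 0 z ξ - 1) * k ξ‖) (𝓝 0)
      (𝓝 (∫ ξ, ‖(wave 0 0 0 ξ - 1) * k ξ‖)) := by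
    refine tendsto_integral_filter_of_dominated_convergence (fun ξ => 2 * ‖k ξ‖) ?_ ?_
      (hk.norm.const_mul 2) ?_
    · exact Eventually.of_forall fun z => ((((Continuous.wave continuous_const continuous_const
        continuous_const continuous_id).sub continuous_const).aestronglyMeasurable).mul hk.1).norm
    · refine Eventually.of_forall fun z => ae_of_all _ fun ξ => ?_
      rw [norm_norm, norm_mul]
      gcongr
      refine (norm_sub_le _ _).trans ?_
      have := norm_wave_le_one le_rfl 0 z ξ
      rw [norm_one]; linarith
    · refine ae_of_all _ fun ξ => ?_
      have : Continuous fun z : ℝ => ‖(wave 0 0 z ξ - 1) * k ξ‖ :=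
        (((Continuous.wave continuous_const continuous_const continuous_id
          continuous_const).sub continuous_const).mul continuous_const).norm
      exact this.tendsto 0
  simp only [wave_zero_zero_zero, sub_self, zero_mul, norm_zero, integral_zero] at hlim
  obtain ⟨ρ, hρ, hρ'⟩ := Metric.eventually_nhds_iff.1 (hlim.eventually (gt_mem_nhds hδ))
  refine ⟨ρ, hρ, fun {x y} hxy => ?_⟩
  have hint : ∀ x, Integrable fun ξ => wave 0 0 x ξ * k ξ := fun x =>
    hk.bdd_mul (c := 1) (Continuous.wave continuous_const continuous_const continuous_const
      continuous_id).aestronglyMeasurable (ae_of_all _ fun ξ => norm_wave_le_one le_rfl _ _ _)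
  rw [dist_eq_norm, invBCF_apply, invBCF_apply, ← integral_sub (hint x) (hint y)]
  refine (norm_integral_le_integral_norm _).trans_lt ((integral_congr_ae (ae_of_all _ fun ξ => ?_)).trans_lt
    (hρ' (y := x - y) (by simpa [dist_eq_norm] using hxy)))
  have : wave 0 0 x ξ * k ξ - wave 0 0 y ξ * k ξ = wave 0 0 y ξ * ((wave 0 0 (x - y) ξ - 1) * k ξ) := by
    have := wave_mul_wave 0 0 y 0 0 (x - y) ξ
    simp only [add_zero, add_sub_cancel] at this
    rw [← this]; ring
  simp only [this]
  rw [norm_mul, norm_wave]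
  simp

theorem uniformContinuous_regInv (n : ℕ) (h : L2R) : UniformContinuous (regInv n h) := by
  have : regInv n h = invBCF (integrable_wave_mul (dampRate_pos n) 0 0 h) := by
    ext x
    rw [regInv_apply, invBCF_apply]
    refine integral_congr_ae (ae_of_all _ fun ξ => ?_)
    simp only
    rw [← mul_assoc, wave_mul_wave]
    simp
  rw [this]
  exact uniformContinuous_invBCF _

/-- `u` is the continuous representative of the inverse Fourier transform of `h ∈ L²`, in the sense
that the Gaussian regularizations converge uniformly to `u`. -/
def HasRep (h : L2R) (u : ℝ →ᵇ ℂ) : Prop := Tendsto (fun n => regInv n h) atTop (𝓝 u)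

theorem HasRep.unique {h : L2R} {u v : ℝ →ᵇ ℂ} (hu : HasRep h u) (hv : HasRep h v) : u = v :=
  tendsto_nhds_unique hu hv

theorem HasRep.add {h k : L2R} {u v : ℝ →ᵇ ℂ} (hu : HasRep h u) (hv : HasRep k v) :
    HasRep (h + k) (u + v) := by
  simpa only [HasRep, map_add] using Tendsto.add hu hv

theorem HasRep.sub {h k : L2R} {u v : ℝ →ᵇ ℂ} (hu : HasRep h u) (hv : HasRep k v) :
    HasRep (h - k) (u - v) := by
  simpa only [HasRep, map_sub] using Tendsto.sub hu hv

theorem HasRep.smul {h : L2R} {u : ℝ →ᵇ ℂ} (hu : HasRep h u) (c : ℂ) : HasRep (c • h) (c • u) := by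
  simpa only [HasRep, map_smul] using Tendsto.const_smul hu c

/-- Linear estimates are proved for `regInv n` uniformly in n, and reach the representative through
this limit. -/
theorem HasRep.norm_le {h : L2R} {u : ℝ →ᵇ ℂ} (hu : HasRep h u) {B : ℝ≥0∞}
    (hB : ∀ n, ‖regInv n h‖ₑ ≤ B) : ‖u‖ₑ ≤ B :=
  le_of_tendsto (Tendsto.enorm hu) (Eventually.of_forall hB)

theorem HasRep.uniformContinuous {h : L2R} {u : ℝ →ᵇ ℂ} (hu : HasRep h u) :
    UniformContinuous u := by
  have h1 : TendstoUniformly (fun n => (regInv n h : ℝ → ℂ)) u atTop :=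
    BoundedContinuousFunction.tendsto_iff_tendstoUniformly.1 hu
  exact h1.uniformContinuous (Eventually.of_forall fun n => uniformContinuous_regInv n h).frequently

/-- The sup-norm error is at most the integral of |1 - e^{-rξ²}| |h|. Integrable transforms form the
class from which representability extends by density. -/
theorem hasRep_of_integrable {h : L2R} (hh : Integrable h) : HasRep h (invBCF hh) := by
  rw [HasRep, tendsto_iff_norm_sub_tendsto_zero]
  have hlim : Tendsto (fun n : ℕ => ∫ ξ, ‖(wave (dampRate n) 0 0 ξ - 1) * h ξ‖) atTop
      (𝓝 (∫ ξ : ℝ, (0 : ℝ))) := by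
    refine tendsto_integral_of_dominated_convergence (fun ξ => 2 * ‖h ξ‖) ?_
      (hh.norm.const_mul 2) ?_ ?_
    · exact fun z => ((((Continuous.wave continuous_const continuous_const
        continuous_const continuous_id).sub continuous_const).aestronglyMeasurable).mul hh.1).norm
    · refine fun n => ae_of_all _ fun ξ => ?_
      rw [norm_norm, norm_mul]
      gcongr
      refine (norm_sub_le _ _).trans ?_
      have := norm_wave_le_one (dampRate_pos n).le 0 0 ξ
      rw [norm_one]; linarith
    · refine ae_of_all _ fun ξ => ?_
      have : Continuous fun a : ℝ => ‖(wave a 0 0 ξ - 1) * h ξ‖ :=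
        (((Continuous.wave continuous_id continuous_const continuous_const
          continuous_const).sub continuous_const).mul continuous_const).norm
      simpa [wave_zero_zero_zero, Function.comp_def] using (this.tendsto 0).comp tendsto_dampRate
  rw [integral_zero] at hlim
  refine squeeze_zero (fun n => norm_nonneg _) (fun n => ?_) hlim
  refine (BoundedContinuousFunction.norm_le (integral_nonneg fun ξ => norm_nonneg _)).2 fun x => ?_
  have hint : Integrable fun ξ => wave 0 0 x ξ * h ξ :=
    hh.bdd_mul (c := 1) (Continuous.wave continuous_const continuous_const continuous_const
      continuous_id).aestronglyMeasurable (ae_of_all _ fun ξ => norm_wave_le_one le_rfl _ _ _)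
  rw [BoundedContinuousFunction.sub_apply, regInv_apply, invBCF_apply,
    ← integral_sub (integrable_wave_mul (dampRate_pos n) 0 x h) hint]
  refine (norm_integral_le_integral_norm _).trans (le_of_eq ?_)
  refine integral_congr_ae (ae_of_all _ fun ξ => ?_)
  have : wave (dampRate n) 0 x ξ * h ξ - wave 0 0 x ξ * h ξ
      = wave 0 0 x ξ * ((wave (dampRate n) 0 0 ξ - 1) * h ξ) := by
    have := wave_mul_wave 0 0 x (dampRate n) 0 0 ξ
    simp only [add_zero, zero_add] at this
    rw [← this]; ring
  simp only [this]
  rw [norm_mul, norm_wave]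
  simp

/-- The `L²` inverse Fourier transform of an integrable function is given by the integral. -/
theorem fourierInv_ae_eq_of_integrable {k : L2R} (hk : Integrable k) :
    (𝓕⁻ k : L2R) =ᵐ[volume] invBCF hk := by
  have hloc : LocallyIntegrable (fun x => (𝓕⁻ k : L2R) x - invBCF hk x) := by
    refine ((Lp.memLp (𝓕⁻ k : L2R)).locallyIntegrable (by norm_num)).sub ?_
    exact (invBCF hk).continuous.locallyIntegrable
  have h0 : ∀ᵐ x, (𝓕⁻ k : L2R) x - invBCF hk x = 0 := by
    -- The L² transform has no pointwise formula. Tested against a smooth compactly supported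
    -- function, it moves onto that function, where it is an integral, and Fubini moves it back.
    refine ae_eq_zero_of_integral_contDiff_smul_eq_zero hloc fun φ hφ hφc => ?_
    have hg₁ : HasCompactSupport (Complex.ofRealCLM ∘ φ) := hφc.comp_left rfl
    have hg₂ := Complex.ofRealCLM.contDiff.comp hφ
    set G := hg₁.toSchwartzMap hg₂ with hG
    have hGa : ∀ x, G x = (φ x : ℂ) := fun x => rfl
    have e1 := congrArg (fun d => d G) (Lp.fourierInv_toTemperedDistribution_eq k)
    simp only [TemperedDistribution.fourierInv_apply, Lp.toTemperedDistribution_apply] at e1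
    have e2 : ∫ x, (φ x) • ((𝓕⁻ k : L2R) x) = ∫ ξ, (𝓕⁻ G) ξ • k ξ := by
      rw [e1]
      refine integral_congr_ae (ae_of_all _ fun x => ?_)
      simp [hGa]
    have hGi : Integrable G := G.integrable
    have e3 : ∫ ξ, (𝓕⁻ G) ξ • k ξ = ∫ x, (φ x) • invBCF hk x := by
      have hw : Integrable (fun p : ℝ × ℝ => wave 0 0 p.1 p.2 * (G p.2 * k p.1))
          ((volume : Measure ℝ).prod volume) := by
        refine (Integrable.bdd_mul (c := 1) ?_ ?_ (ae_of_all _ fun p => norm_wave_le_one le_rfl _ _ _))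
        · have := hk.mul_prod hGi
          refine this.congr (ae_of_all _ fun p => mul_comm _ _)
        · exact (Continuous.wave continuous_const continuous_const continuous_fst
            continuous_snd).aestronglyMeasurable
      calc ∫ ξ, (𝓕⁻ G) ξ • k ξ = ∫ ξ, ∫ x, wave 0 0 ξ x * (G x * k ξ) := by
            refine integral_congr_ae (ae_of_all _ fun ξ => ?_)
            simp only
            rw [SchwartzMap.fourierInv_coe, fourierInv_eq_integral_wave, smul_eq_mul,
              ← integral_mul_const]
            simp only [mul_assoc]
        _ = ∫ x, ∫ ξ, wave 0 0 ξ x * (G x * k ξ) := integral_integral_swap hw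
        _ = _ := by
            refine integral_congr_ae (ae_of_all _ fun x => ?_)
            simp only
            rw [invBCF_apply, Complex.real_smul, ← hGa, ← integral_const_mul]
            refine integral_congr_ae (ae_of_all _ fun ξ => ?_)
            have : wave 0 0 ξ x = wave 0 0 x ξ := by
              simp only [wave]; congr 1; push_cast; ring
            simp only [this]
            ring
    have i1 : Integrable fun x => φ x • ((𝓕⁻ k : L2R) x) := by
      refine ((Lp.memLp (𝓕⁻ k : L2R)).locallyIntegrable (by norm_num)).integrable_smul_left_of_hasCompactSupport
        hφ.continuous hφc
    have i2 : Integrable fun x => φ x • invBCF hk x :=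
      (invBCF hk).continuous.locallyIntegrable.integrable_smul_left_of_hasCompactSupport
        hφ.continuous hφc
    simp only [smul_sub]
    rw [integral_sub i1 i2, e2, e3, sub_self]
  filter_upwards [h0] with x hx
  exact sub_eq_zero.1 hx

theorem memLp_wave_mul {r : ℝ} (hr : 0 ≤ r) (τ x : ℝ) (h : L2R) :
    MemLp (fun ξ => wave r τ x ξ * h ξ) 2 volume := by
  refine (Lp.memLp h).of_le ((Continuous.wave continuous_const continuous_const continuous_const
      continuous_id).aestronglyMeasurable.mul (Lp.aestronglyMeasurable h)) (ae_of_all _ fun ξ => ?_)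
  rw [norm_mul]
  exact mul_le_of_le_one_left (norm_nonneg _) (norm_wave_le_one hr _ _ _)

/-- The Gaussian truncation of an `L²` function. -/
def damp (n : ℕ) (h : L2R) : L2R := (memLp_wave_mul (dampRate_pos n).le 0 0 h).toLp _

theorem damp_ae (n : ℕ) (h : L2R) : damp n h =ᵐ[volume] fun ξ => wave (dampRate n) 0 0 ξ * h ξ :=
  MemLp.coeFn_toLp _

theorem integrable_damp (n : ℕ) (h : L2R) : Integrable (damp n h) :=
  (integrable_wave_mul (dampRate_pos n) 0 0 h).congr (damp_ae n h).symm

theorem tendsto_damp (h : L2R) : Tendsto (fun n => damp n h) atTop (𝓝 h) := by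
  rw [Lp.tendsto_Lp_iff_tendsto_eLpNorm']
  have := tendsto_eLpNorm_mul_sub (l := atTop) (m := fun n : ℕ => wave (dampRate n) 0 0)
    (m₀ := fun _ => 1) (C := 1) (fun n => (Continuous.wave continuous_const continuous_const
      continuous_const continuous_id).aestronglyMeasurable)
    (fun n ξ => norm_wave_le_one (dampRate_pos n).le _ _ _) (fun ξ => by
      have : Continuous fun a : ℝ => wave a 0 0 ξ :=
        Continuous.wave continuous_id continuous_const continuous_const continuous_const
      simpa [wave_zero_zero_zero, Function.comp_def] using (this.tendsto 0).comp tendsto_dampRate)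
    (by simp) aestronglyMeasurable_const (Lp.memLp h)
  refine this.congr fun n => eLpNorm_congr_ae ?_
  filter_upwards [damp_ae n h] with ξ hξ
  simp [hξ]

theorem invBCF_damp (n : ℕ) (h : L2R) : invBCF (integrable_damp n h) = regInv n h := by
  ext x
  rw [regInv_apply, invBCF_apply]
  refine integral_congr_ae ?_
  filter_upwards [damp_ae n h] with ξ hξ
  simp only [hξ]
  rw [← mul_assoc, wave_mul_wave]
  simp

/-- The transforms of the damped data have two limits: in L², hence almost everywhere along a
subsequence, the transform of h, and uniformly the representative. -/
theorem HasRep.ae_eq {h : L2R} {u : ℝ →ᵇ ℂ} (hu : HasRep h u) : (𝓕⁻ h : L2R) =ᵐ[volume] u := by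
  have hlim2 : Tendsto (fun n => (𝓕⁻ (damp n h) : L2R)) atTop (𝓝 (𝓕⁻ h)) :=
    ((Lp.fourierTransformₗᵢ ℝ ℂ).symm.continuous.tendsto h).comp (tendsto_damp h)
  obtain ⟨ns, hns, hae⟩ := (tendstoInMeasure_of_tendsto_Lp hlim2).exists_seq_tendsto_ae
  have hall : ∀ᵐ x, ∀ n, (𝓕⁻ (damp n h) : L2R) x = regInv n h x := by
    rw [ae_all_iff]
    intro n
    filter_upwards [fourierInv_ae_eq_of_integrable (integrable_damp n h)] with x hx
    rw [hx, invBCF_damp]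
  filter_upwards [hae, hall] with x h1 h2
  refine tendsto_nhds_unique h1 ?_
  have h3 : Tendsto (fun n => regInv n h x) atTop (𝓝 (u x)) :=
    ((BoundedContinuousFunction.tendsto_iff_tendstoUniformly.1 hu).tendsto_at x)
  refine (h3.comp hns.tendsto_atTop).congr fun i => ?_
  rw [Function.comp_apply, h2]

/-! ### The free propagator in the Fourier variable -/

/-- The free propagator on the Fourier side. -/
def phase (t : ℝ) (h : L2R) : L2R := (memLp_freeSymbol_mul t h).toLp _

theorem phase_ae (t : ℝ) (h : L2R) : phase t h =ᵐ[volume] fun ξ => freeSymbol t ξ * h ξ :=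
  MemLp.coeFn_toLp _

theorem freeEvolution_eq (t : ℝ) (f : L2R) : freeEvolution t f = 𝓕⁻ (phase t (𝓕 f)) := rfl

theorem phase_add (t : ℝ) (h k : L2R) : phase t (h + k) = phase t h + phase t k := by
  refine Lp.ext ?_
  filter_upwards [phase_ae t (h + k), phase_ae t h, phase_ae t k, Lp.coeFn_add h k,
    Lp.coeFn_add (phase t h) (phase t k)] with ξ h1 h2 h3 h4 h5
  rw [h1, h5, Pi.add_apply, h2, h3, h4, Pi.add_apply]; ring

theorem phase_smul (t : ℝ) (c : ℂ) (h : L2R) : phase t (c • h) = c • phase t h := by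
  refine Lp.ext ?_
  filter_upwards [phase_ae t (c • h), phase_ae t h, Lp.coeFn_smul c h,
    Lp.coeFn_smul c (phase t h)] with ξ h1 h2 h3 h4
  rw [h1, h4, Pi.smul_apply, h2, h3, Pi.smul_apply, smul_eq_mul, smul_eq_mul]; ring

theorem phase_sub (t : ℝ) (h k : L2R) : phase t (h - k) = phase t h - phase t k := by
  have : h - k = h + (-1 : ℂ) • k := by rw [neg_one_smul, sub_eq_add_neg]
  rw [this, phase_add, phase_smul, neg_one_smul, sub_eq_add_neg]

theorem phase_phase (s t : ℝ) (h : L2R) : phase s (phase t h) = phase (s + t) h := by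
  refine Lp.ext ?_
  filter_upwards [phase_ae s (phase t h), phase_ae t h, phase_ae (s + t) h] with ξ h1 h2 h3
  rw [h1, h2, h3, ← mul_assoc, freeSymbol_eq_wave, freeSymbol_eq_wave, freeSymbol_eq_wave,
    wave_mul_wave, add_zero]

theorem phase_zero (h : L2R) : phase 0 h = h := by
  refine Lp.ext ?_
  filter_upwards [phase_ae 0 h] with ξ h1
  rw [h1, freeSymbol_eq_wave, wave_zero_zero_zero, one_mul]

theorem norm_phase (t : ℝ) (h : L2R) : ‖phase t h‖ = ‖h‖ := by
  rw [Lp.norm_def, Lp.norm_def]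
  congr 1
  refine eLpNorm_congr_norm_ae ?_
  filter_upwards [phase_ae t h] with ξ h1
  rw [h1, norm_mul, norm_freeSymbol, one_mul]

theorem continuous_phase (h : L2R) : Continuous fun t => phase t h := by
  refine continuous_iff_continuousAt.2 fun t₀ => ?_
  rw [ContinuousAt, Lp.tendsto_Lp_iff_tendsto_eLpNorm']
  have := tendsto_eLpNorm_mul_sub (l := 𝓝 t₀) (m := freeSymbol) (m₀ := freeSymbol t₀) (C := 1)
    (fun t => (continuous_freeSymbol t).aestronglyMeasurable)
    (fun t ξ => (norm_freeSymbol t ξ).le) (fun ξ => by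
      have : Continuous fun t => freeSymbol t ξ := by unfold freeSymbol; fun_prop
      exact this.tendsto t₀) (fun ξ => (norm_freeSymbol t₀ ξ).le)
    (continuous_freeSymbol t₀).aestronglyMeasurable (Lp.memLp h)
  refine this.congr fun t => eLpNorm_congr_ae ?_
  filter_upwards [phase_ae t h, phase_ae t₀ h] with ξ h1 h2
  rw [Pi.sub_apply, h1, h2]

/-- The propagator is only strongly continuous in time. Isometry moves the variation of the argument
out of it, so that strong continuity is needed at the single vector f(t₀). -/
theorem continuousOn_phase_comp {f : ℝ → L2R} {S : Set ℝ} (hf : ContinuousOn f S) :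
    ContinuousOn (fun t => phase t (f t)) S := by
  intro t₀ ht₀
  rw [ContinuousWithinAt, tendsto_iff_norm_sub_tendsto_zero]
  have h1 : Tendsto (fun t => ‖f t - f t₀‖ + ‖phase t (f t₀) - phase t₀ (f t₀)‖) (𝓝[S] t₀) (𝓝 0) := by
    have h2 := tendsto_iff_norm_sub_tendsto_zero.1 (hf t₀ ht₀)
    have h3 := tendsto_iff_norm_sub_tendsto_zero.1
      (((continuous_phase (f t₀)).tendsto t₀).mono_left (nhdsWithin_le_nhds (s := S)))
    simpa using h2.add h3
  refine squeeze_zero (fun t => norm_nonneg _) (fun t => ?_) h1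
  calc ‖phase t (f t) - phase t₀ (f t₀)‖
      = ‖phase t (f t - f t₀) + (phase t (f t₀) - phase t₀ (f t₀))‖ := by
        rw [phase_sub]; congr 1; abel
    _ ≤ _ := by rw [← norm_phase t (f t - f t₀)]; exact norm_add_le _ _

theorem regInv_phase_apply (n : ℕ) (t : ℝ) (h : L2R) (x : ℝ) :
    regInv n (phase t h) x = ∫ ξ, wave (dampRate n) t x ξ * h ξ := by
  rw [regInv_apply]
  refine integral_congr_ae ?_
  filter_upwards [phase_ae t h] with ξ h1
  rw [h1, ← mul_assoc, freeSymbol_eq_wave, wave_mul_wave]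
  simp

theorem continuous_regInv_phase (n : ℕ) (h : L2R) : Continuous fun t => regInv n (phase t h) :=
  (regInv n).continuous.comp (continuous_phase h)

/-! ### Strichartz estimates for free solutions -/

theorem enorm_le_of_forall_rat {f : ℝ →ᵇ ℂ} {B : ℝ≥0∞} (hB : ∀ q : ℚ, ‖f q‖ₑ ≤ B) : ‖f‖ₑ ≤ B := by
  rcases eq_or_ne B ∞ with rfl | hBt
  · exact le_top
  have hcl : IsClosed {x : ℝ | ‖f x‖ₑ ≤ B} := isClosed_le (by fun_prop) continuous_const
  have hx : ∀ x : ℝ, ‖f x‖ₑ ≤ B := fun x =>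
    Rat.isDenseEmbedding_coe_real.dense.induction_on (p := fun x => ‖f x‖ₑ ≤ B) x hcl
      fun q => hB q
  rw [← ofReal_norm, ← ENNReal.ofReal_toReal hBt]
  refine ENNReal.ofReal_le_ofReal ((BoundedContinuousFunction.norm_le ENNReal.toReal_nonneg).2
    fun x => ?_)
  have := (ENNReal.toReal_le_toReal (by simp) hBt).2 (hx x)
  simpa using this

/-- The selection is updated only where a new entry is strictly larger, so measurability passes
through the induction. It linearizes the maximal function over finitely many positions and damping
rates. -/
theorem exists_measurable_argmax {Y : Type*} [MeasurableSpace Y] {φ : ℕ → Y → ℝ}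
    (hφ : ∀ j, Measurable (φ j)) (J : ℕ) :
    ∃ s : Y → ℕ, Measurable s ∧ (Measurable fun y => φ (s y) y) ∧
      ∀ y, s y ≤ J ∧ ∀ j ≤ J, φ j y ≤ φ (s y) y := by
  induction J with
  | zero => exact ⟨fun _ => 0, measurable_const, hφ 0, fun y => ⟨le_rfl, fun j hj => by
      rw [Nat.le_zero.1 hj]⟩⟩
  | succ J ih =>
    obtain ⟨s, hs, hm, hs'⟩ := ih
    have hm' : Measurable fun y => if φ (s y) y < φ (J + 1) y then φ (J + 1) y else φ (s y) y :=
      Measurable.ite (measurableSet_lt hm (hφ _)) (hφ _) hm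
    refine ⟨fun y => if φ (s y) y < φ (J + 1) y then J + 1 else s y,
      Measurable.ite (measurableSet_lt hm (hφ _)) measurable_const hs, ?_, fun y => ?_⟩
    · convert! hm' using 2 with y
      by_cases h : φ (s y) y < φ (J + 1) y <;> simp [h]
    simp only
    split_ifs with hlt
    · refine ⟨le_rfl, fun j hj => ?_⟩
      rcases Nat.le_succ_iff.1 hj with h | h
      · exact ((hs' y).2 j h).trans hlt.le
      · rw [h]
    · refine ⟨(hs' y).1.trans (Nat.le_succ _), fun j hj => ?_⟩
      rcases Nat.le_succ_iff.1 hj with h | h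
      · exact (hs' y).2 j h
      · rw [h]; exact not_lt.1 hlt

theorem lintegral_enorm_sq_eq (h : L2R) : ∫⁻ ξ, ‖h ξ‖ₑ ^ (2 : ℝ) = ‖h‖ₑ ^ (2 : ℝ) := by
  rw [Lp.enorm_def, eLpNorm_eq_lintegral_rpow_enorm_toReal (by norm_num) (by norm_num),
    ← ENNReal.rpow_mul]
  simp

/-- Strichartz estimate along a measurable choice of positions and damping rates. -/
theorem lintegral_enorm_wave_pow_four_le (h : L2R) {a x : ℝ → ℝ} (ha : Measurable a)
    (hx : Measurable x) {a₀ : ℝ} (ha₀ : 0 < a₀) (haa : ∀ t, a₀ ≤ a t) :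
    ∫⁻ t, ‖∫ ξ, wave (a t) t (x t) ξ * h ξ‖ₑ ^ (4 : ℝ) ≤ 144 * ‖h‖ₑ ^ (4 : ℝ) := by
  set v : ℝ → ℂ := fun t => ∫ ξ, wave (a t) t (x t) ξ * h ξ with hv
  have hWm : Measurable fun p : ℝ × ℝ => wave (a p.1) p.1 (x p.1) p.2 :=
    Measurable.wave (by fun_prop) (by fun_prop) (by fun_prop) (by fun_prop)
  have hvm : StronglyMeasurable v := by
    refine StronglyMeasurable.integral_prod_right
      (f := fun t ξ => wave (a t) t (x t) ξ * h ξ) ?_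
    exact hWm.stronglyMeasurable.mul ((Lp.stronglyMeasurable h).comp_measurable measurable_snd)
  set w : ℝ → ℝ := fun ξ => ‖wave a₀ 0 0 ξ * h ξ‖ with hw
  have hwi : Integrable w := (integrable_wave_mul ha₀ 0 0 h).norm
  have hle : ∀ t ξ, ‖wave (a t) t (x t) ξ * h ξ‖ ≤ w ξ := fun t ξ => by
    rw [hw, norm_mul]
    simp only [norm_mul, norm_wave]
    gcongr
    exact haa t
  have hvb : ∀ t, ‖v t‖ ≤ ∫ ξ, w ξ := fun t =>
    norm_integral_le_of_norm_le hwi (ae_of_all _ (hle t))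
  -- On a bounded time interval the integral is finite, since the damping a₀ bounds v uniformly.
  -- This finiteness is what allows a power of V to be cancelled at the end.
  have hm : ∀ m : ℕ, ∫⁻ t in Icc (-m : ℝ) m, ‖v t‖ₑ ^ (4 : ℝ) ≤ 144 * ‖h‖ₑ ^ (4 : ℝ) := by
    intro m
    set V := ∫⁻ t in Icc (-m : ℝ) m, ‖v t‖ₑ ^ (4 : ℝ) with hV
    have hVt : V ≠ ∞ := by
      have : V ≤ ∫⁻ t in Icc (-m : ℝ) m, ENNReal.ofReal (∫ ξ, w ξ) ^ (4 : ℝ) := by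
        refine lintegral_mono fun t => ?_
        gcongr
        rw [← ofReal_norm]
        exact ENNReal.ofReal_le_ofReal (hvb t)
      refine (this.trans_lt ?_).ne
      rw [setLIntegral_const]
      exact ENNReal.mul_lt_top (by finiteness) (by simp)
    -- The extremal dual function: its pairing with v and its 4/3-power integral both equal V.
    -- Moving the integral over frequencies outside puts h against the superposition k, whose L²
    -- norm is bounded by TT*.
    set G : ℝ → ℂ := indicator (Icc (-m : ℝ) m) fun t => (starRingEnd ℂ) (v t) * (‖v t‖ ^ 2 : ℝ)
      with hG
    have hGm : StronglyMeasurable G := by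
      refine StronglyMeasurable.indicator ?_ measurableSet_Icc
      exact (Complex.continuous_conj.comp_stronglyMeasurable hvm).mul
        (Complex.continuous_ofReal.comp_stronglyMeasurable (hvm.norm.pow 2))
    have hGn : ∀ t, ‖G t‖ₑ = indicator (Icc (-m : ℝ) m) (fun t => ‖v t‖ₑ ^ (3 : ℝ)) t := fun t => by
      by_cases ht : t ∈ Icc (-m : ℝ) m
      · rw [hG, indicator_of_mem ht, indicator_of_mem ht, enorm_mul, RCLike.enorm_conj,
          ← enorm_norm (Complex.ofReal _), Complex.norm_real, enorm_norm, enorm_pow, enorm_norm]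
        rw [show (3 : ℝ) = ((3 : ℕ) : ℝ) by norm_num, ENNReal.rpow_natCast]
        ring
      · simp [hG, ht]
    have hGi : Integrable G := by
      refine ⟨hGm.aestronglyMeasurable, ?_⟩
      rw [hasFiniteIntegral_iff_enorm, lintegral_congr hGn, lintegral_indicator measurableSet_Icc]
      have : ∫⁻ t in Icc (-m : ℝ) m, ‖v t‖ₑ ^ (3 : ℝ)
          ≤ ∫⁻ t in Icc (-m : ℝ) m, ENNReal.ofReal (∫ ξ, w ξ) ^ (3 : ℝ) := by
        refine lintegral_mono fun t => ?_
        gcongr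
        rw [← ofReal_norm]
        exact ENNReal.ofReal_le_ofReal (hvb t)
      refine this.trans_lt ?_
      rw [setLIntegral_const]
      exact ENNReal.mul_lt_top (by finiteness) (by simp)
    have hG43 : ∫⁻ t, ‖G t‖ₑ ^ (4 / 3 : ℝ) = V := by
      rw [hV, ← lintegral_indicator measurableSet_Icc]
      refine lintegral_congr fun t => ?_
      rw [hGn]
      by_cases ht : t ∈ Icc (-m : ℝ) m
      · rw [indicator_of_mem ht, indicator_of_mem ht, ← ENNReal.rpow_mul]; norm_num
      · simp [ht]
    set k : ℝ → ℂ := fun ξ => ∫ t, G t * wave (a t) t (x t) ξ with hk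
    have hk2 : ∫⁻ ξ, ‖k ξ‖ₑ ^ (2 : ℝ) ≤ 12 * V ^ (3 / 2 : ℝ) := by
      refine (lintegral_enorm_integral_wave_sq_le hGi ha measurable_id hx
        (fun t => ha₀.le.trans (haa t))).trans ?_
      rw [← hG43]
      refine le_trans (le_of_eq ?_) (lintegral_mul_fracInt_self_le hGm.enorm)
      refine lintegral_congr fun t => ?_
      have := measurable_dispKernel
      have := hGm.enorm
      rw [fracInt, ← lintegral_const_mul _ (by fun_prop)]
      refine lintegral_congr fun s => ?_
      simp only [id]
      ring
    have hkm : AEStronglyMeasurable k volume := by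
      refine (StronglyMeasurable.integral_prod_right'
        (f := fun p : ℝ × ℝ => G p.2 * wave (a p.2) p.2 (x p.2) p.1) ?_).aestronglyMeasurable
      exact (hGm.comp_measurable measurable_snd).mul
        (hWm.comp measurable_swap).stronglyMeasurable
    have hVle : V ≤ ∫⁻ ξ, ‖h ξ‖ₑ * ‖k ξ‖ₑ := by
      have e1 : V = ‖∫ t, G t * v t‖ₑ := by
        have e2 : ∀ t, G t * v t
            = ((indicator (Icc (-m : ℝ) m) (fun t => ‖v t‖ ^ 4) t : ℝ) : ℂ) := fun t => by
          by_cases ht : t ∈ Icc (-m : ℝ) m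
          · rw [hG, indicator_of_mem ht, indicator_of_mem ht, mul_right_comm, mul_comm _ (v t),
              Complex.mul_conj, Complex.normSq_eq_norm_sq, ← Complex.ofReal_mul]
            congr 1; ring
          · simp [hG, ht]
        simp_rw [e2]
        rw [integral_complex_ofReal, ← enorm_norm, Complex.norm_real, enorm_norm,
          integral_indicator measurableSet_Icc,
          Real.enorm_of_nonneg (integral_nonneg fun t => by positivity),
          ofReal_integral_eq_lintegral_ofReal]
        · refine lintegral_congr fun t => ?_
          rw [ENNReal.ofReal_pow (norm_nonneg _), ofReal_norm]
          norm_cast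
        · refine Measure.integrableOn_of_bounded (M := (∫ ξ, w ξ) ^ 4) (by simp)
            (hvm.norm.pow 4).aestronglyMeasurable (ae_of_all _ fun t => ?_)
          rw [Real.norm_of_nonneg (by positivity)]
          gcongr
          exact hvb t
        · exact ae_of_all _ fun t => by positivity
      have e3 : ∫ t, G t * v t = ∫ ξ, h ξ * k ξ := by
        have hF : Integrable (fun p : ℝ × ℝ => G p.1 * (wave (a p.1) p.1 (x p.1) p.2 * h p.2))
            ((volume : Measure ℝ).prod volume) := by
          refine (hGi.norm.mul_prod hwi).mono' ?_ (ae_of_all _ fun p => ?_)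
          · exact ((hGm.comp_measurable measurable_fst).mul (hWm.stronglyMeasurable.mul
              ((Lp.stronglyMeasurable h).comp_measurable measurable_snd))).aestronglyMeasurable
          · rw [norm_mul]
            gcongr
            exact hle _ _
        calc ∫ t, G t * v t = ∫ t, ∫ ξ, G t * (wave (a t) t (x t) ξ * h ξ) :=
              integral_congr_ae (ae_of_all _ fun t => (integral_const_mul _ _).symm)
          _ = ∫ ξ, ∫ t, G t * (wave (a t) t (x t) ξ * h ξ) := integral_integral_swap hF
          _ = _ := by
              refine integral_congr_ae (ae_of_all _ fun ξ => ?_)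
              simp only [hk]
              rw [← integral_const_mul]
              refine integral_congr_ae (ae_of_all _ fun t => ?_)
              simp only
              ring
      rw [e1, e3]
      refine (enorm_integral_le_lintegral_enorm _).trans (le_of_eq ?_)
      simp_rw [enorm_mul]
    have hH := ENNReal.lintegral_mul_le_Lp_mul_Lq (volume : Measure ℝ) Real.HolderConjugate.two_two
      (f := fun ξ => ‖h ξ‖ₑ) (g := fun ξ => ‖k ξ‖ₑ) (Lp.aestronglyMeasurable h).enorm hkm.enorm
    simp only [Pi.mul_apply] at hH
    rw [lintegral_enorm_sq_eq, ← ENNReal.rpow_mul] at hH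
    have hmain : V ≤ ‖h‖ₑ * (12 * V ^ (3 / 2 : ℝ)) ^ (1 / 2 : ℝ) := by
      refine hVle.trans (hH.trans ?_)
      rw [show (2 : ℝ) * (1 / 2) = 1 by norm_num, ENNReal.rpow_one]
      gcongr
    -- Cauchy–Schwarz, squared. Dividing by V^{3/2} gives V^{1/2} ≤ 12 ‖h‖², hence the constant 144.
    have hsq : V ^ (2 : ℝ) ≤ ‖h‖ₑ ^ (2 : ℝ) * 12 * V ^ (3 / 2 : ℝ) := by
      calc V ^ (2 : ℝ) ≤ (‖h‖ₑ * (12 * V ^ (3 / 2 : ℝ)) ^ (1 / 2 : ℝ)) ^ (2 : ℝ) := by gcongr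
        _ = _ := by
            rw [ENNReal.mul_rpow_of_nonneg _ _ (by norm_num), ← ENNReal.rpow_mul]
            norm_num
            ring
    rcases eq_or_ne V 0 with hV0 | hV0
    · rw [hV0]; exact bot_le
    have hsq2 : V ^ (1 / 2 : ℝ) ≤ ‖h‖ₑ ^ (2 : ℝ) * 12 := by
      have e : V ^ (2 : ℝ) = V ^ (1 / 2 : ℝ) * V ^ (3 / 2 : ℝ) := by
        rw [← ENNReal.rpow_add _ _ hV0 hVt]; norm_num
      rw [e] at hsq
      exact (ENNReal.mul_le_mul_iff_left (by simp [hV0, hVt]) (by simp [hV0, hVt])).1 hsq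
    calc V = (V ^ (1 / 2 : ℝ)) ^ (2 : ℝ) := by rw [← ENNReal.rpow_mul]; norm_num
      _ ≤ (‖h‖ₑ ^ (2 : ℝ) * 12) ^ (2 : ℝ) := by gcongr
      _ = _ := by
          rw [ENNReal.mul_rpow_of_nonneg _ _ (by norm_num), ← ENNReal.rpow_mul, mul_comm]
          norm_num
  have hU : ⋃ m : ℕ, Icc (-m : ℝ) m = univ := by
    refine eq_univ_of_forall fun t => mem_iUnion.2 ?_
    obtain ⟨N, hN⟩ := exists_nat_ge |t|
    exact ⟨N, abs_le.1 hN⟩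
  rw [← setLIntegral_univ, ← hU, setLIntegral_iUnion_of_directed]
  · exact iSup_le hm
  · refine Monotone.directed_le fun n k hnk => ?_
    have : (n : ℝ) ≤ k := by exact_mod_cast hnk
    exact Icc_subset_Icc (by linarith) this

/-- Strichartz estimate `L² → L⁴(ℝ; C(ℝ))`, uniformly in the regularization. -/
theorem lintegral_iSup_regInv_phase_le (h : L2R) :
    ∫⁻ t, (⨆ n, ‖regInv n (phase t h)‖ₑ) ^ (4 : ℝ) ≤ 144 * ‖h‖ₑ ^ (4 : ℝ) := by
  -- By continuity in space, the double supremum over regularizations and positions is a countable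
  -- one. It is the increasing limit of finite maxima, each attained along a measurable selection.
  obtain ⟨e, he⟩ := exists_surjective_nat (ℕ × ℚ)
  set φ : ℕ → ℝ → ℝ := fun j t => ‖regInv (e j).1 (phase t h) (e j).2‖ with hφ
  have hφm : ∀ j, Measurable (φ j) := fun j => by
    have : Continuous (φ j) :=
      ((continuous_eval_const (F := ℝ →ᵇ ℂ) ((e j).2 : ℝ)).comp
        (continuous_regInv_phase (e j).1 h)).norm
    exact this.measurable
  choose s hs hsm hs' using exists_measurable_argmax hφm
  have hJ : ∀ J, ∫⁻ t, ENNReal.ofReal (φ (s J t) t) ^ (4 : ℝ) ≤ 144 * ‖h‖ₑ ^ (4 : ℝ) := by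
    intro J
    -- The sum dominates every regularization index that can be selected, which gives a positive
    -- lower bound for the damping rates. The estimate itself does not depend on that bound.
    set M := ∑ j ∈ Finset.range (J + 1), (e j).1
    have := lintegral_enorm_wave_pow_four_le h (a := fun t => dampRate (e (s J t)).1)
      (x := fun t => ((e (s J t)).2 : ℝ)) ((measurable_of_countable fun j => dampRate (e j).1).comp (hs J))
      ((measurable_of_countable fun j => ((e j).2 : ℝ)).comp (hs J)) (dampRate_pos M) (fun t => by
        have h1 : (e (s J t)).1 ≤ M := Finset.single_le_sum (f := fun j => (e j).1)
          (fun _ _ => Nat.zero_le _) (Finset.mem_range.2 (Nat.lt_succ_of_le (hs' J t).1))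
        have h2 : ((e (s J t)).1 : ℝ) ≤ M := by exact_mod_cast h1
        unfold dampRate
        gcongr)
    refine le_trans (le_of_eq (lintegral_congr fun t => ?_)) this
    simp only [hφ]
    rw [ofReal_norm, regInv_phase_apply]
  have hmono : Monotone fun (J : ℕ) (t : ℝ) => ENNReal.ofReal (φ (s J t) t) ^ (4 : ℝ) := by
    intro J K hJK t
    simp only
    gcongr
    exact (hs' K t).2 _ ((hs' J t).1.trans hJK)
  have hle : ∀ t, (⨆ n, ‖regInv n (phase t h)‖ₑ) ^ (4 : ℝ)
      ≤ ⨆ J, ENNReal.ofReal (φ (s J t) t) ^ (4 : ℝ) := by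
    intro t
    rw [← ENNReal.rpow_le_rpow_iff (show (0 : ℝ) < 1 / 4 by norm_num), ← ENNReal.rpow_mul,
      show (4 : ℝ) * (1 / 4) = 1 by norm_num, ENNReal.rpow_one]
    refine iSup_le fun n => enorm_le_of_forall_rat fun q => ?_
    obtain ⟨j, hj⟩ := he (n, q)
    have h1 : ‖regInv n (phase t h) q‖ₑ ≤ ENNReal.ofReal (φ (s j t) t) := by
      rw [← ofReal_norm]
      refine ENNReal.ofReal_le_ofReal ?_
      have := (hs' j t).2 j le_rfl
      simpa only [hφ, hj] using this
    have h2 : ‖regInv n (phase t h) q‖ₑ ^ (4 : ℝ)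
        ≤ ⨆ J, ENNReal.ofReal (φ (s J t) t) ^ (4 : ℝ) :=
      le_iSup_of_le j (ENNReal.rpow_le_rpow h1 (by norm_num))
    have h3 := ENNReal.rpow_le_rpow h2 (show (0 : ℝ) ≤ 1 / 4 by norm_num)
    rwa [← ENNReal.rpow_mul, show (4 : ℝ) * (1 / 4) = 1 by norm_num, ENNReal.rpow_one] at h3
  refine (lintegral_mono hle).trans ?_
  rw [lintegral_iSup (fun J => ?_) hmono]
  · exact iSup_le hJ
  · exact ((hsm J).ennreal_ofReal).pow_const _

/-- A Banach principle: since the fourth-power integrals of the maximal errors tend to zero, their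
infimum over k vanishes almost everywhere. At such a time a good approximation can be chosen, and a
three-term splitting gives the Cauchy property. -/
theorem ae_cauchySeq_of_approx {E : Type*} [SeminormedAddCommGroup E] {U : ℕ → ℝ → E}
    {V : ℕ → ℕ → ℝ → E} {B : ℕ → ℝ → ℝ≥0∞} (hBm : ∀ k, Measurable (B k))
    (hV : ∀ k, ∀ᵐ t, CauchySeq fun n => V k n t)
    (hUV : ∀ k t n, ‖U n t - V k n t‖ₑ ≤ B k t)
    (hB : Tendsto (fun k => ∫⁻ t, B k t ^ (4 : ℝ)) atTop (𝓝 0)) :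
    ∀ᵐ t, CauchySeq fun n => U n t := by
  have h0 : ∫⁻ t, (⨅ k, B k t) ^ (4 : ℝ) = 0 := by
    refine le_antisymm (ge_of_tendsto' hB fun k => lintegral_mono fun t => ?_) bot_le
    gcongr
    exact iInf_le _ k
  have h1 : ∀ᵐ t, ⨅ k, B k t = 0 := by
    have := (lintegral_eq_zero_iff ((Measurable.iInf hBm).pow_const _)).1 h0
    filter_upwards [this] with t ht
    exact (ENNReal.rpow_eq_zero_iff_of_pos (by norm_num)).1 ht
  filter_upwards [h1, ae_all_iff.2 hV] with t ht hVt
  refine EMetric.cauchySeq_iff.2 fun δ hδ => ?_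
  have hδ3 : 0 < δ / 3 := ENNReal.div_pos hδ.ne' (by norm_num)
  obtain ⟨k, hk⟩ := iInf_lt_iff.1 (ht.trans_lt hδ3)
  obtain ⟨N, hN⟩ := EMetric.cauchySeq_iff.1 (hVt k) (δ / 3) hδ3
  refine ⟨N, fun m hm n hn => ?_⟩
  calc edist (U m t) (U n t) ≤ edist (U m t) (V k m t) + edist (V k m t) (V k n t)
        + edist (V k n t) (U n t) := edist_triangle4 _ _ _ _
    _ < δ / 3 + δ / 3 + δ / 3 := by
        refine ENNReal.add_lt_add (ENNReal.add_lt_add ?_ (hN m hm n hn)) ?_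
        · rw [edist_eq_enorm_sub]; exact (hUV k t m).trans_lt hk
        · rw [edist_comm, edist_eq_enorm_sub]; exact (hUV k t n).trans_lt hk
    _ = δ := ENNReal.add_thirds δ

/-- The continuous representative of the inverse Fourier transform of `h ∈ L²`, if it exists. -/
def rep (h : L2R) : ℝ →ᵇ ℂ := limUnder atTop fun n => regInv n h

theorem HasRep.rep_eq {h : L2R} {u : ℝ →ᵇ ℂ} (hu : HasRep h u) : rep h = u := hu.limUnder_eq

theorem hasRep_rep_of_cauchySeq {h : L2R} (hc : CauchySeq fun n => regInv n h) :
    HasRep h (rep h) := hc.tendsto_limUnder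

theorem aestronglyMeasurable_rep {f : ℝ → L2R} {μ : Measure ℝ} (hf : AEStronglyMeasurable f μ)
    (hrep : ∀ᵐ t ∂μ, HasRep (f t) (rep (f t))) : AEStronglyMeasurable (fun t => rep (f t)) μ :=
  aestronglyMeasurable_of_tendsto_ae atTop
    (fun n => (regInv n).continuous.comp_aestronglyMeasurable hf) hrep

theorem integrable_phase {h : L2R} (hh : Integrable h) (t : ℝ) : Integrable (phase t h) := by
  refine Integrable.congr ?_ (phase_ae t h).symm
  exact hh.bdd_mul (c := 1) (continuous_freeSymbol t).aestronglyMeasurable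
    (ae_of_all _ fun ξ => (norm_freeSymbol t ξ).le)

/-- Free solutions have a continuous representative at almost every time. -/
theorem ae_hasRep_phase (h : L2R) : ∀ᵐ t, HasRep (phase t h) (rep (phase t h)) := by
  -- Damped data are integrable, hence representable at all times. The maximal error of the
  -- approximation is controlled by the Strichartz estimate.
  have hk := tendsto_damp h
  have := ae_cauchySeq_of_approx (U := fun n t => regInv n (phase t h))
    (V := fun j n t => regInv n (phase t (damp j h)))
    (B := fun j t => ⨆ n, ‖regInv n (phase t (h - damp j h))‖ₑ)
    (fun j => Measurable.iSup fun n => (continuous_regInv_phase n _).enorm.measurable)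
    (fun j => ae_of_all _ fun t =>
      (hasRep_of_integrable (integrable_phase (integrable_damp j h) t)).cauchySeq)
    (fun j t n => by
      rw [← map_sub, ← phase_sub]
      exact le_iSup (fun n => ‖regInv n (phase t (h - damp j h))‖ₑ) n) ?_
  · filter_upwards [this] with t ht
    exact hasRep_rep_of_cauchySeq ht
  · have h1 : Tendsto (fun j => 144 * ‖h - damp j h‖ₑ ^ (4 : ℝ)) atTop (𝓝 0) := by
      have h2 : Tendsto (fun j => ‖h - damp j h‖ₑ) atTop (𝓝 0) := by
        have := (tendsto_const_nhds (x := h)).sub hk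
        simpa using this.enorm
      have h3 := ENNReal.Tendsto.const_mul (a := 144)
        ((ENNReal.continuous_rpow_const (y := 4)).tendsto _ |>.comp h2) (Or.inr (by norm_num))
      simpa [Function.comp_def] using h3
    exact tendsto_of_tendsto_of_tendsto_of_le_of_le tendsto_const_nhds h1 (fun _ => bot_le)
      fun j => lintegral_iSup_regInv_phase_le _

/-- The continuous representative of the free solution with Fourier-side data `h`. -/
def freeRep (h : L2R) (t : ℝ) : ℝ →ᵇ ℂ := rep (phase t h)

theorem aestronglyMeasurable_freeRep (h : L2R) : AEStronglyMeasurable (freeRep h) volume :=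
  aestronglyMeasurable_rep (continuous_phase h).aestronglyMeasurable (ae_hasRep_phase h)

theorem lintegral_freeRep_le (h : L2R) :
    ∫⁻ t, ‖freeRep h t‖ₑ ^ (4 : ℝ) ≤ 144 * ‖h‖ₑ ^ (4 : ℝ) := by
  refine le_trans (lintegral_mono_ae ?_) (lintegral_iSup_regInv_phase_le h)
  filter_upwards [ae_hasRep_phase h] with t ht
  gcongr
  exact ht.norm_le fun n => le_iSup (fun n => ‖regInv n (phase t h)‖ₑ) n

/-! ### Duhamel integrals with a measure-valued forcing -/

instance fact_one_le_four_thirds : Fact ((1 : ℝ≥0∞) ≤ 4 / 3) :=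
  ⟨by rw [ENNReal.le_div_iff_mul_le (by simp) (by simp)]; norm_num⟩

theorem lintegral_enorm_rpow_four_thirds {E : Type*} [NormedAddCommGroup E] {μ : Measure ℝ}
    (F : ℝ → E) : ∫⁻ s, ‖F s‖ₑ ^ (4 / 3 : ℝ) ∂μ = eLpNorm F (4 / 3) μ ^ (4 / 3 : ℝ) := by
  rw [eLpNorm_eq_lintegral_rpow_enorm_toReal (by norm_num) (by finiteness), ← ENNReal.rpow_mul]
  norm_num

/-- The total mass of the coupling. -/
def mass (g : ℝ → ℝ) : ℝ≥0∞ := ∫⁻ y, ‖g y‖ₑ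

theorem mass_ne_top {g : ℝ → ℝ} (hg : Integrable g) : mass g ≠ ∞ := hg.2.ne

/-- The Fourier transform of the measure `φ(εy) g(y) dy`, transported to the positions `εy`. -/
def cplFourier (g : ℝ → ℝ) (ε : ℝ) (φ : ℝ →ᵇ ℂ) (ξ : ℝ) : ℂ :=
  ∫ y, φ (ε * y) * g y * wave 0 0 (-(ε * y)) ξ

/-- The space-time density of the forcing `F(s) g_ε`. -/
def cplDensity (g : ℝ → ℝ) (ε : ℝ) (F : ℝ → ℝ →ᵇ ℂ) (p : ℝ × ℝ) : ℂ := F p.1 (ε * p.2) * g p.2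

/-- The total variation of the measure `φ(εy) g(y) dy`. -/
def cplSize (g : ℝ → ℝ) (ε : ℝ) (φ : ℝ →ᵇ ℂ) : ℝ≥0∞ := ∫⁻ y, ‖φ (ε * y)‖ₑ * ‖g y‖ₑ

/-- The Fourier-side Duhamel integral in the interaction picture. -/
def duhProfile (g : ℝ → ℝ) (ε : ℝ) (F : ℝ → ℝ →ᵇ ℂ) (a b ξ : ℝ) : ℂ :=
  ∫ s in a..b, freeSymbol (-s) ξ * cplFourier g ε (F s) ξ

section Duhamel

variable {g : ℝ → ℝ} {ε : ℝ} {F : ℝ → ℝ →ᵇ ℂ}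

theorem aestronglyMeasurable_cplDensity (hg : AEStronglyMeasurable g volume) {μ : Measure ℝ}
    [SFinite μ] (hF : AEStronglyMeasurable F μ) :
    AEStronglyMeasurable (cplDensity g ε F) (μ.prod volume) := by
  refine AEStronglyMeasurable.mul ?_ (Complex.continuous_ofReal.comp_aestronglyMeasurable hg.comp_snd)
  have h1 : Continuous fun q : (ℝ →ᵇ ℂ) × ℝ => q.1 q.2 := by fun_prop
  have h2 : AEStronglyMeasurable (fun p : ℝ × ℝ => ε * p.2) (μ.prod volume) :=
    (by fun_prop : Continuous fun p : ℝ × ℝ => ε * p.2).aestronglyMeasurable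
  exact h1.comp_aestronglyMeasurable (hF.comp_fst.prodMk h2)

theorem norm_cplDensity_le (p : ℝ × ℝ) : ‖cplDensity g ε F p‖ ≤ ‖F p.1‖ * ‖g p.2‖ := by
  rw [cplDensity, norm_mul, Complex.norm_real]
  gcongr
  exact (F p.1).norm_coe_le_norm _

theorem lintegral_enorm_cplDensity (s : ℝ) :
    ∫⁻ y, ‖cplDensity g ε F (s, y)‖ₑ = cplSize g ε (F s) := by
  refine lintegral_congr fun y => ?_
  rw [cplDensity, enorm_mul, ← ofReal_norm (g y : ℂ), Complex.norm_real, ofReal_norm]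

theorem cplSize_le (φ : ℝ →ᵇ ℂ) : cplSize g ε φ ≤ mass g * ‖φ‖ₑ := by
  rw [mul_comm, mass, ← lintegral_const_mul' _ _ (by finiteness)]
  refine lintegral_mono fun y => ?_
  gcongr
  rw [← ofReal_norm, ← ofReal_norm]
  exact ENNReal.ofReal_le_ofReal (φ.norm_coe_le_norm _)

theorem aemeasurable_cplSize (hg : AEStronglyMeasurable g volume) {μ : Measure ℝ}
    [SFinite μ] (hF : AEStronglyMeasurable F μ) : AEMeasurable (fun s => cplSize g ε (F s)) μ := by
  simp_rw [← lintegral_enorm_cplDensity]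
  exact (aestronglyMeasurable_cplDensity hg hF).enorm.lintegral_prod_right'

theorem MeasureTheory.MemLp.integrableOn_uIoc {E : Type*} [NormedAddCommGroup E] {F : ℝ → E}
    (hF : MemLp F (4 / 3) volume) (a b : ℝ) : IntegrableOn F (uIoc a b) := by
  have : IsFiniteMeasure (volume.restrict (uIoc a b)) := ⟨by simp [uIoc]⟩
  exact (hF.restrict _).integrable Fact.out

theorem integrable_cplDensity (hg : Integrable g) {μ : Measure ℝ} [SFinite μ]
    (hF : Integrable F μ) : Integrable (cplDensity g ε F) (μ.prod volume) :=
  (hF.norm.mul_prod hg.norm).mono' (aestronglyMeasurable_cplDensity hg.1 hF.1)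
    (ae_of_all _ norm_cplDensity_le)

theorem integrable_cplFourier_integrand (hg : Integrable g) (φ : ℝ →ᵇ ℂ) (ξ : ℝ) :
    Integrable fun y => φ (ε * y) * g y * wave 0 0 (-(ε * y)) ξ := by
  have h1 : Integrable fun y => φ (ε * y) * (g y : ℂ) :=
    hg.ofReal.bdd_mul (c := ‖φ‖)
      (φ.continuous.comp (by fun_prop : Continuous fun y => ε * y)).aestronglyMeasurable
      (ae_of_all _ fun y => φ.norm_coe_le_norm _)
  exact h1.mul_bdd (c := 1) (Continuous.wave continuous_const continuous_const
    (by fun_prop) continuous_const).aestronglyMeasurable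
    (ae_of_all _ fun y => norm_wave_le_one le_rfl _ _ _)

theorem cplFourier_sub (hg : Integrable g) (φ χ : ℝ →ᵇ ℂ) (ξ : ℝ) :
    cplFourier g ε (φ - χ) ξ = cplFourier g ε φ ξ - cplFourier g ε χ ξ := by
  rw [cplFourier, cplFourier, cplFourier, ← integral_sub (integrable_cplFourier_integrand hg φ ξ)
    (integrable_cplFourier_integrand hg χ ξ)]
  refine integral_congr_ae (ae_of_all _ fun y => ?_)
  simp only [BoundedContinuousFunction.sub_apply]
  ring

theorem norm_cplFourier_le (hg : Integrable g) (φ : ℝ →ᵇ ℂ) (ξ : ℝ) :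
    ‖cplFourier g ε φ ξ‖ ≤ ‖φ‖ * ∫ y, ‖g y‖ := by
  rw [← integral_const_mul]
  refine norm_integral_le_of_norm_le (hg.norm.const_mul _) (ae_of_all _ fun y => ?_)
  rw [norm_mul, norm_mul, Complex.norm_real]
  calc _ ≤ ‖φ‖ * ‖g y‖ * 1 := by
        gcongr
        · exact φ.norm_coe_le_norm _
        · exact norm_wave_le_one le_rfl _ _ _
    _ = _ := mul_one _

theorem cplFourier_mul_freeSymbol (s ξ : ℝ) : freeSymbol (-s) ξ * cplFourier g ε (F s) ξ
    = ∫ y, cplDensity g ε F (s, y) * wave 0 (-s) (-(ε * y)) ξ := by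
  rw [cplFourier, ← integral_const_mul]
  refine integral_congr_ae (ae_of_all _ fun y => ?_)
  simp only [cplDensity]
  have := wave_mul_wave 0 (-s) 0 0 0 (-(ε * y)) ξ
  simp only [add_zero, zero_add] at this
  rw [← this, freeSymbol_eq_wave]
  ring

theorem integrable_cplDensity_mul_wave (hg : Integrable g) {μ : Measure ℝ} [SFinite μ]
    (hF : Integrable F μ) (ξ : ℝ) :
    Integrable (fun p : ℝ × ℝ => cplDensity g ε F p * wave 0 (-p.1) (-(ε * p.2)) ξ)
      (μ.prod volume) :=
  integrable_mul_wave (integrable_cplDensity hg hF) measurable_const (by fun_prop) (by fun_prop)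
    (fun _ => le_rfl) ξ

theorem integrable_freeSymbol_mul_cplFourier (hg : Integrable g) {μ : Measure ℝ} [SFinite μ]
    (hF : Integrable F μ) (ξ : ℝ) :
    Integrable (fun s => freeSymbol (-s) ξ * cplFourier g ε (F s) ξ) μ := by
  simp_rw [cplFourier_mul_freeSymbol]
  exact (integrable_cplDensity_mul_wave hg hF ξ).integral_prod_left

theorem intervalIntegrable_duhProfile (hg : Integrable g) (hF : MemLp F (4 / 3) volume)
    (a b ξ : ℝ) :
    IntervalIntegrable (fun s => freeSymbol (-s) ξ * cplFourier g ε (F s) ξ) volume a b :=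
  intervalIntegrable_iff.2
    (integrable_freeSymbol_mul_cplFourier hg (hF.integrableOn_uIoc a b) ξ)

theorem duhProfile_eq (hg : Integrable g) (hF : MemLp F (4 / 3) volume) (a b ξ : ℝ) :
    duhProfile g ε F a b ξ = (if a ≤ b then 1 else -1 : ℝ) •
      ∫ p, cplDensity g ε F p * wave 0 (-p.1) (-(ε * p.2)) ξ
        ∂((volume.restrict (uIoc a b)).prod volume) := by
  rw [duhProfile, intervalIntegral.intervalIntegral_eq_integral_uIoc,
    integral_prod _ (integrable_cplDensity_mul_wave hg (hF.integrableOn_uIoc a b) ξ)]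
  simp_rw [cplFourier_mul_freeSymbol]

theorem enorm_sign_smul {E : Type*} [NormedAddCommGroup E] [NormedSpace ℝ E] (a b : ℝ) (z : E) :
    ‖(if a ≤ b then 1 else -1 : ℝ) • z‖ₑ = ‖z‖ₑ := by
  split_ifs <;> simp

theorem continuous_duhProfile (hg : Integrable g) (hF : MemLp F (4 / 3) volume) (a b : ℝ) :
    Continuous (duhProfile g ε F a b) := by
  have : duhProfile g ε F a b = fun ξ => _ := funext fun ξ => duhProfile_eq hg hF a b ξ
  rw [this]
  have hc := (continuous_integral_mul_wave (r := fun _ => 0) (τ := fun p : ℝ × ℝ => -p.1)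
    (x := fun p : ℝ × ℝ => -(ε * p.2)) (integrable_cplDensity (ε := ε) hg
      (hF.integrableOn_uIoc a b)) measurable_const (by fun_prop) (by fun_prop) (fun _ => le_rfl))
  exact hc.const_smul (if a ≤ b then 1 else -1 : ℝ)

theorem lintegral_kernel_mul_cplDensity (hg : Integrable g) {μ : Measure ℝ} [SFinite μ]
    (hF : AEStronglyMeasurable F μ) {κ : ℝ → ℝ≥0∞} (hκ : AEMeasurable κ μ) :
    ∫⁻ p : ℝ × ℝ, κ p.1 * ‖cplDensity g ε F p‖ₑ ∂(μ.prod volume) =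
      ∫⁻ s, κ s * cplSize g ε (F s) ∂μ := by
  have hm := (aestronglyMeasurable_cplDensity (ε := ε) hg.1 hF).enorm
  have hm' : AEMeasurable (fun p : ℝ × ℝ => κ p.1 * ‖cplDensity g ε F p‖ₑ) (μ.prod volume) :=
    hκ.comp_fst.mul hm
  rw [lintegral_prod _ hm']
  refine lintegral_congr_ae ?_
  filter_upwards [(aestronglyMeasurable_cplDensity (ε := ε) hg.1 hF).prodMk_left] with s hs
  rw [lintegral_const_mul'' _ hs.enorm, lintegral_enorm_cplDensity]

/-- TT* over space-time points (s, y), each emitting a wave at time -s. The dispersive kernel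
depends on times only, so the spatial integrals collapse to total variations, and the diagonal
Hardy–Littlewood–Sobolev bound applies to their product. -/
theorem lintegral_duhProfile_sq_le_cplSize (hg : Integrable g) (hF : MemLp F (4 / 3) volume)
    (a b : ℝ) : ∫⁻ ξ, ‖duhProfile g ε F a b ξ‖ₑ ^ (2 : ℝ) ≤
      12 * (∫⁻ s in uIoc a b, cplSize g ε (F s) ^ (4 / 3 : ℝ)) ^ (3 / 2 : ℝ) := by
  set S := uIoc a b with hS
  have hSm : MeasurableSet S := measurableSet_uIoc
  set f : ℝ → ℝ≥0∞ := indicator S fun s => cplSize g ε (F s) with hf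
  have hfm : AEMeasurable f volume := (aemeasurable_cplSize hg.1 hF.1).indicator hSm
  have hKm := measurable_dispKernel
  have h1 : ∀ ξ, ‖duhProfile g ε F a b ξ‖ₑ = ‖∫ p, cplDensity g ε F p
      * wave 0 (-p.1) (-(ε * p.2)) ξ ∂((volume.restrict S).prod volume)‖ₑ := fun ξ => by
    rw [duhProfile_eq hg hF, enorm_sign_smul]
  simp_rw [h1]
  refine (lintegral_enorm_integral_wave_sq_le (r := fun _ => 0) (τ := fun p : ℝ × ℝ => -p.1)
    (x := fun p : ℝ × ℝ => -(ε * p.2)) (integrable_cplDensity hg (hF.integrableOn_uIoc a b))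
    measurable_const (by fun_prop) (by fun_prop) (fun _ => le_rfl)).trans ?_
  have hinner : ∀ p : ℝ × ℝ, ∫⁻ p', ‖cplDensity g ε F p‖ₑ * ‖cplDensity g ε F p'‖ₑ
      * dispKernel (-p.1 - -p'.1) ∂((volume.restrict S).prod volume)
      = fracInt f p.1 * ‖cplDensity g ε F p‖ₑ := by
    intro p
    calc _ = ∫⁻ p', ‖cplDensity g ε F p‖ₑ * (dispKernel (p.1 - p'.1) * ‖cplDensity g ε F p'‖ₑ)
          ∂((volume.restrict S).prod volume) := by
          refine lintegral_congr fun p' => ?_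
          have e : -p.1 - -p'.1 = p'.1 - p.1 := by ring
          rw [e, dispKernel_sub_comm]
          ring
      _ = ‖cplDensity g ε F p‖ₑ * ∫⁻ s in S, dispKernel (p.1 - s) * cplSize g ε (F s) := by
          rw [lintegral_const_mul' _ _ (by finiteness), lintegral_kernel_mul_cplDensity hg
            hF.1.restrict (κ := fun s => dispKernel (p.1 - s))
            (hKm.comp (by fun_prop)).aemeasurable]
      _ = _ := by
          rw [fracInt, hf, ← lintegral_indicator hSm, mul_comm]
          congr 1
          refine lintegral_congr fun s => ?_
          by_cases hs : s ∈ S <;> simp [hs]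
  refine (lintegral_congr hinner).le.trans ?_
  rw [lintegral_kernel_mul_cplDensity hg hF.1.restrict
    (measurable_fracInt_of_aemeasurable hfm).aemeasurable]
  have e1 : ∫⁻ s in S, fracInt f s * cplSize g ε (F s) = ∫⁻ s, f s * fracInt f s := by
    rw [← lintegral_indicator hSm]
    refine lintegral_congr fun s => ?_
    by_cases hs : s ∈ S <;> simp [hf, hs, mul_comm]
  have e2 : ∫⁻ s in S, cplSize g ε (F s) ^ (4 / 3 : ℝ) = ∫⁻ s, f s ^ (4 / 3 : ℝ) := by
    rw [← lintegral_indicator hSm]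
    refine lintegral_congr fun s => ?_
    by_cases hs : s ∈ S <;> simp [hf, hs]
  rw [e1, e2]
  exact lintegral_mul_fracInt_self_le_of_aemeasurable hfm

theorem lintegral_cplSize_rpow_le (hg : Integrable g) (μ : Measure ℝ) :
    ∫⁻ s, cplSize g ε (F s) ^ (4 / 3 : ℝ) ∂μ ≤
      mass g ^ (4 / 3 : ℝ) * ∫⁻ s, ‖F s‖ₑ ^ (4 / 3 : ℝ) ∂μ := by
  have := mass_ne_top hg
  rw [← lintegral_const_mul' _ _ (by finiteness)]
  refine lintegral_mono fun s => ?_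
  rw [← ENNReal.mul_rpow_of_nonneg _ _ (by norm_num)]
  gcongr
  exact cplSize_le _

theorem lintegral_duhProfile_sq_le (hg : Integrable g) (hF : MemLp F (4 / 3) volume) (a b : ℝ) :
    ∫⁻ ξ, ‖duhProfile g ε F a b ξ‖ₑ ^ (2 : ℝ) ≤
      12 * (mass g ^ (4 / 3 : ℝ) * ∫⁻ s in uIoc a b, ‖F s‖ₑ ^ (4 / 3 : ℝ)) ^ (3 / 2 : ℝ) := by
  refine (lintegral_duhProfile_sq_le_cplSize hg hF a b).trans ?_
  gcongr
  exact lintegral_cplSize_rpow_le hg _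

theorem memLp_duhProfile (hg : Integrable g) (hF : MemLp F (4 / 3) volume) (a b : ℝ) :
    MemLp (duhProfile g ε F a b) 2 volume := by
  refine ⟨(continuous_duhProfile hg hF a b).aestronglyMeasurable, ?_⟩
  rw [eLpNorm_lt_top_iff_lintegral_rpow_enorm_lt_top (by norm_num) (by norm_num)]
  refine lt_of_le_of_lt (by simpa using lintegral_duhProfile_sq_le (ε := ε) hg hF a b) ?_
  have h1 : ∫⁻ s in uIoc a b, ‖F s‖ₑ ^ (4 / 3 : ℝ) < ∞ := by
    rw [lintegral_enorm_rpow_four_thirds]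
    exact ENNReal.rpow_lt_top_of_nonneg (by norm_num) (hF.restrict _).2.ne
  have h2 := mass_ne_top hg
  exact ENNReal.mul_lt_top (by finiteness) (ENNReal.rpow_lt_top_of_nonneg (by norm_num)
    (ENNReal.mul_lt_top (by finiteness) h1).ne)

open Classical in
/-- `duhProfile` as an element of `L²`. -/
def duhL2 (g : ℝ → ℝ) (ε : ℝ) (F : ℝ → ℝ →ᵇ ℂ) (a b : ℝ) : L2R :=
  if h : MemLp (duhProfile g ε F a b) 2 volume then h.toLp _ else 0

theorem duhL2_ae (hg : Integrable g) (hF : MemLp F (4 / 3) volume) (a b : ℝ) :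
    duhL2 g ε F a b =ᵐ[volume] duhProfile g ε F a b := by
  rw [duhL2, dif_pos (memLp_duhProfile hg hF a b)]
  exact MemLp.coeFn_toLp _

/-- The total variation is kept, instead of mass times sup norm, because it tends to zero with ε for
forcings that vanish at the origin. The constant 4 rounds up the square root of 12. -/
theorem enorm_duhL2_le_cplSize (hg : Integrable g) (hF : MemLp F (4 / 3) volume) (a b : ℝ) :
    ‖duhL2 g ε F a b‖ₑ ≤
      4 * (∫⁻ s in uIoc a b, cplSize g ε (F s) ^ (4 / 3 : ℝ)) ^ (3 / 4 : ℝ) := by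
  rw [← ENNReal.rpow_le_rpow_iff (show (0 : ℝ) < 2 by norm_num), ← lintegral_enorm_sq_eq]
  have : ∫⁻ ξ, ‖duhL2 g ε F a b ξ‖ₑ ^ (2 : ℝ) = ∫⁻ ξ, ‖duhProfile g ε F a b ξ‖ₑ ^ (2 : ℝ) := by
    refine lintegral_congr_ae ?_
    filter_upwards [duhL2_ae (ε := ε) hg hF a b] with ξ hξ
    rw [hξ]
  rw [this]
  refine (lintegral_duhProfile_sq_le_cplSize hg hF a b).trans ?_
  rw [ENNReal.mul_rpow_of_nonneg _ _ (by norm_num), ← ENNReal.rpow_mul]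
  norm_num
  gcongr
  norm_num

theorem enorm_duhL2_le (hg : Integrable g) (hF : MemLp F (4 / 3) volume) (a b : ℝ) :
    ‖duhL2 g ε F a b‖ₑ ≤
      4 * mass g * (∫⁻ s in uIoc a b, ‖F s‖ₑ ^ (4 / 3 : ℝ)) ^ (3 / 4 : ℝ) := by
  refine (enorm_duhL2_le_cplSize hg hF a b).trans ?_
  calc _ ≤ 4 * (mass g ^ (4 / 3 : ℝ) * ∫⁻ s in uIoc a b, ‖F s‖ₑ ^ (4 / 3 : ℝ)) ^ (3 / 4 : ℝ) := by
        gcongr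
        exact lintegral_cplSize_rpow_le hg _
    _ = _ := by
        rw [ENNReal.mul_rpow_of_nonneg _ _ (by norm_num), ← ENNReal.rpow_mul]
        norm_num [mul_assoc]

/-- In the interaction picture the integrand does not involve the final time, so Duhamel integrals
are additive over intervals. Time continuity, change of base time and scattering all rest on this.
-/
theorem duhL2_add_adjacent (hg : Integrable g) (hF : MemLp F (4 / 3) volume) (a b c : ℝ) :
    duhL2 g ε F a b + duhL2 g ε F b c = duhL2 g ε F a c := by
  refine Lp.ext ?_
  filter_upwards [Lp.coeFn_add (duhL2 g ε F a b) (duhL2 g ε F b c), duhL2_ae (ε := ε) hg hF a b,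
    duhL2_ae (ε := ε) hg hF b c, duhL2_ae (ε := ε) hg hF a c] with ξ h1 h2 h3 h4
  rw [h1, Pi.add_apply, h2, h3, h4]
  exact intervalIntegral.integral_add_adjacent_intervals (intervalIntegrable_duhProfile hg hF _ _ _)
    (intervalIntegrable_duhProfile hg hF _ _ _)

theorem duhL2_sub (hg : Integrable g) {F' : ℝ → ℝ →ᵇ ℂ} (hF : MemLp F (4 / 3) volume)
    (hF' : MemLp F' (4 / 3) volume) (a b : ℝ) :
    duhL2 g ε (F - F') a b = duhL2 g ε F a b - duhL2 g ε F' a b := by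
  refine Lp.ext ?_
  filter_upwards [Lp.coeFn_sub (duhL2 g ε F a b) (duhL2 g ε F' a b), duhL2_ae (ε := ε) hg hF a b,
    duhL2_ae (ε := ε) hg hF' a b, duhL2_ae (ε := ε) hg (hF.sub hF') a b] with ξ h1 h2 h3 h4
  rw [h4, h1, Pi.sub_apply, h2, h3, duhProfile, duhProfile, duhProfile,
    ← intervalIntegral.integral_sub (intervalIntegrable_duhProfile hg hF _ _ _)
    (intervalIntegrable_duhProfile hg hF' _ _ _)]
  simp only [Pi.sub_apply, cplFourier_sub hg, mul_sub]

theorem duhProfile_congr {F' : ℝ → ℝ →ᵇ ℂ} {a b : ℝ}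
    (h : ∀ᵐ s ∂(volume.restrict (uIoc a b)), F s = F' s) :
    duhProfile g ε F a b = duhProfile g ε F' a b := by
  funext ξ
  rw [duhProfile, duhProfile]
  refine intervalIntegral.integral_congr_ae_restrict ?_
  filter_upwards [h] with s hs
  rw [hs]

open Classical in
theorem duhL2_eq_of_duhProfile_eq {g' : ℝ → ℝ} {ε' : ℝ} {F' : ℝ → ℝ →ᵇ ℂ} {a b a' b' : ℝ}
    (h : duhProfile g ε F a b = duhProfile g' ε' F' a' b') :
    duhL2 g ε F a b = duhL2 g' ε' F' a' b' := by
  have key : ∀ u v : ℝ → ℂ, u = v → (if h : MemLp u 2 volume then h.toLp u else 0 : L2R)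
      = if h : MemLp v 2 volume then h.toLp v else 0 := by
    rintro u _ rfl
    rfl
  exact key _ _ h

theorem duhL2_congr {F' : ℝ → ℝ →ᵇ ℂ} {a b : ℝ}
    (h : ∀ᵐ s ∂(volume.restrict (uIoc a b)), F s = F' s) :
    duhL2 g ε F a b = duhL2 g ε F' a b :=
  duhL2_eq_of_duhProfile_eq (duhProfile_congr h)

theorem duhL2_self (a : ℝ) : duhL2 g ε F a a = 0 := by
  have h0 : duhProfile g ε F a a = 0 := by
    funext ξ; simp [duhProfile]
  rw [duhL2]
  split_ifs with h
  · refine Lp.ext ?_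
    filter_upwards [h.coeFn_toLp, Lp.coeFn_zero ℂ 2 (volume : Measure ℝ)] with ξ h1 h2
    rw [h1, h2, h0]
  · rfl

/-- The increment is a Duhamel integral over the short interval between the two times, bounded by
the L^{4/3} norm of the forcing there. -/
theorem continuous_duhL2 (hg : Integrable g) (hF : MemLp F (4 / 3) volume) (a : ℝ) :
    Continuous fun t => duhL2 g ε F a t := by
  refine continuous_iff_continuousAt.2 fun t₀ => ?_
  rw [ContinuousAt, tendsto_iff_edist_tendsto_0]
  have hfin : ∫⁻ s, ‖F s‖ₑ ^ (4 / 3 : ℝ) ≠ ∞ := by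
    rw [lintegral_enorm_rpow_four_thirds]
    exact (ENNReal.rpow_lt_top_of_nonneg (by norm_num) hF.2.ne).ne
  have h1 : Tendsto (fun t => ∫⁻ s in uIoc t₀ t, ‖F s‖ₑ ^ (4 / 3 : ℝ)) (𝓝 t₀) (𝓝 0) := by
    refine tendsto_setLIntegral_zero hfin ?_
    have : Tendsto (fun t => ENNReal.ofReal |t₀ - t|) (𝓝 t₀) (𝓝 (ENNReal.ofReal |t₀ - t₀|)) :=
      (ENNReal.continuous_ofReal.comp
        (by fun_prop : Continuous fun t => |t₀ - t|)).tendsto t₀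
    simpa [Function.comp_def, uIoc, max_sub_min_eq_abs'] using this
  have h2 := ENNReal.Tendsto.const_mul (a := 4 * mass g)
    ((ENNReal.continuous_rpow_const (y := 3 / 4)).tendsto _ |>.comp h1)
    (Or.inr (by have := mass_ne_top hg; finiteness))
  simp only [Function.comp_def] at h2
  rw [ENNReal.zero_rpow_of_pos (by norm_num), mul_zero] at h2
  refine tendsto_of_tendsto_of_tendsto_of_le_of_le tendsto_const_nhds h2 (fun _ => bot_le) fun t => ?_
  rw [edist_eq_enorm_sub, ← duhL2_add_adjacent hg hF a t₀ t, add_sub_cancel_left]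
  exact enorm_duhL2_le hg hF t₀ t

/-- The regularized Duhamel integral, evaluated at time `t` and position `x`. -/
theorem regInv_phase_duhL2_apply (hg : Integrable g) (hF : MemLp F (4 / 3) volume) (a b t : ℝ)
    (n : ℕ) (x : ℝ) : regInv n (phase t (duhL2 g ε F a b)) x = (if a ≤ b then 1 else -1 : ℝ) •
      ∫ p, cplDensity g ε F p * (∫ ξ, wave (dampRate n) (t - p.1) (x - ε * p.2) ξ)
        ∂((volume.restrict (uIoc a b)).prod volume) := by
  set r := dampRate n
  have hr : 0 < r := dampRate_pos n
  have hint := integrable_cplDensity (ε := ε) hg (hF.integrableOn_uIoc a b)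
  set σ := ((volume : Measure ℝ).restrict (uIoc a b)).prod (volume : Measure ℝ)
  rw [regInv_phase_apply]
  have hfub : Integrable (fun q : ℝ × (ℝ × ℝ) => wave r t x q.1 *
      (cplDensity g ε F q.2 * wave 0 (-q.2.1) (-(ε * q.2.2)) q.1)) (volume.prod σ) := by
    have h1 := (integrable_wave hr t x).mul_prod hint
    refine (h1.mul_bdd (c := 1) (g := fun q : ℝ × (ℝ × ℝ) => wave 0 (-q.2.1) (-(ε * q.2.2)) q.1)
      ?_ (ae_of_all _ fun q => norm_wave_le_one le_rfl _ _ _)).congr (ae_of_all _ fun q => ?_)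
    · exact (Continuous.wave (by fun_prop) (by fun_prop) (by fun_prop)
        (by fun_prop)).aestronglyMeasurable
    · simp only; ring
  calc ∫ ξ, wave r t x ξ * duhL2 g ε F a b ξ
      = ∫ ξ, (if a ≤ b then 1 else -1 : ℝ) • ∫ p, wave r t x ξ * (cplDensity g ε F p
          * wave 0 (-p.1) (-(ε * p.2)) ξ) ∂σ := by
        refine integral_congr_ae ?_
        filter_upwards [duhL2_ae (ε := ε) hg hF a b] with ξ hξ
        rw [hξ, duhProfile_eq hg hF, mul_smul_comm, integral_const_mul]
    _ = _ := by
        rw [integral_smul, integral_integral_swap hfub]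
        congr 1
        refine integral_congr_ae (ae_of_all _ fun p => ?_)
        simp only
        rw [← integral_const_mul]
        refine integral_congr_ae (ae_of_all _ fun ξ => ?_)
        simp only
        rw [mul_left_comm, wave_mul_wave]
        ring_nf

/-- Pointwise-in-time dispersive bound for the Duhamel integral. -/
theorem enorm_regInv_phase_duhL2_le_cplSize (hg : Integrable g) (hF : MemLp F (4 / 3) volume)
    (a b t : ℝ) (n : ℕ) : ‖regInv n (phase t (duhL2 g ε F a b))‖ₑ ≤
      ∫⁻ s in uIoc a b, dispKernel (t - s) * cplSize g ε (F s) := by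
  refine enorm_le_of_forall_rat fun q => ?_
  generalize (q : ℝ) = x
  rw [regInv_phase_duhL2_apply hg hF, enorm_sign_smul,
    ← lintegral_kernel_mul_cplDensity hg hF.1.restrict (κ := fun s => dispKernel (t - s))
      (measurable_dispKernel.comp (by fun_prop)).aemeasurable]
  refine (enorm_integral_le_lintegral_enorm _).trans (lintegral_mono fun p => ?_)
  rw [enorm_mul, mul_comm]
  gcongr
  exact enorm_integral_wave_le (dampRate_pos n) _ _

theorem enorm_regInv_phase_duhL2_le (hg : Integrable g) (hF : MemLp F (4 / 3) volume) (a b t : ℝ)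
    (n : ℕ) : ‖regInv n (phase t (duhL2 g ε F a b))‖ₑ ≤
      mass g * ∫⁻ s in uIoc a b, dispKernel (t - s) * ‖F s‖ₑ := by
  refine (enorm_regInv_phase_duhL2_le_cplSize hg hF a b t n).trans ?_
  rw [← lintegral_const_mul' _ _ (mass_ne_top hg)]
  refine lintegral_mono fun s => ?_
  rw [mul_left_comm]
  gcongr
  exact cplSize_le _

theorem setLIntegral_le_fracInt (S : Set ℝ) (f : ℝ → ℝ≥0∞) (t : ℝ) :
    ∫⁻ s in S, dispKernel (t - s) * f s ≤ fracInt f t :=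
  setLIntegral_le_lintegral _ _

end Duhamel

/-! ### Representability of Duhamel integrals and the inhomogeneous Strichartz estimate -/

/-- Integrating the oscillation exactly in time gains ξ^{-2} at high frequency. A forcing that is
constant on a time interval therefore has an integrable profile, although the Fourier transform of
the coupling need not decay. -/
theorem norm_integral_freeSymbol_le (p q ξ : ℝ) :
    ‖∫ s in p..q, freeSymbol (-s) ξ‖ ≤ (|q - p| + 1) * (1 + ξ ^ 2)⁻¹ := by
  have h1 : ‖∫ s in p..q, freeSymbol (-s) ξ‖ ≤ |q - p| := by
    have := intervalIntegral.norm_integral_le_of_norm_le_const (C := 1)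
      (f := fun s => freeSymbol (-s) ξ) (a := p) (b := q) fun s _ => (norm_freeSymbol (-s) ξ).le
    simpa using this
  have h2 : ‖∫ s in p..q, freeSymbol (-s) ξ‖ * ξ ^ 2 ≤ 1 := by
    rcases eq_or_ne ξ 0 with rfl | hξ
    · simp
    have hξ2 : 0 < ξ ^ 2 := by positivity
    set c : ℂ := ((4 * Real.pi ^ 2 * ξ ^ 2 : ℝ) : ℂ) * Complex.I with hc
    have hcn : ‖c‖ = 4 * Real.pi ^ 2 * ξ ^ 2 := by
      rw [hc, norm_mul, Complex.norm_real, Complex.norm_I, mul_one,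
        Real.norm_of_nonneg (by positivity)]
    have hc0 : c ≠ 0 := by
      rw [← norm_pos_iff, hcn]; positivity
    have e1 : ∫ s in p..q, freeSymbol (-s) ξ = (Complex.exp (c * q) - Complex.exp (c * p)) / c := by
      rw [← integral_exp_mul_complex hc0]
      refine intervalIntegral.integral_congr fun s _ => ?_
      simp only [freeSymbol, hc]
      congr 1
      push_cast
      ring
    have e2 : ∀ x : ℝ, ‖Complex.exp (c * x)‖ = 1 := fun x => by
      rw [hc, mul_right_comm, ← Complex.ofReal_mul]
      exact Complex.norm_exp_ofReal_mul_I _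
    rw [e1, norm_div, hcn, div_mul_eq_mul_div, div_le_one (by positivity)]
    have h3 := norm_sub_le (Complex.exp (c * q)) (Complex.exp (c * p))
    rw [e2, e2] at h3
    have h4 := Real.pi_gt_three
    have h5 : 2 ≤ 4 * Real.pi ^ 2 := by nlinarith
    calc _ ≤ (1 + 1) * ξ ^ 2 := by gcongr
      _ ≤ _ := by nlinarith
  rw [← div_eq_mul_inv, le_div_iff₀ (by positivity)]
  nlinarith

section Density

variable {g : ℝ → ℝ} {ε : ℝ} {F F' : ℝ → ℝ →ᵇ ℂ}

/-- At almost every time, the Duhamel integral has a continuous representative. -/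
def DuhRepresentable (g : ℝ → ℝ) (ε : ℝ) (F : ℝ → ℝ →ᵇ ℂ) : Prop :=
  ∀ᵐ t, CauchySeq fun n => regInv n (phase t (duhL2 g ε F 0 t))

theorem DuhRepresentable.congr (h : F =ᵐ[volume] F') (hF : DuhRepresentable g ε F) :
    DuhRepresentable g ε F' := by
  filter_upwards [hF] with t ht
  rwa [← duhL2_congr (ae_restrict_of_ae h)]

theorem DuhRepresentable.sub (hg : Integrable g) (hFm : MemLp F (4 / 3) volume)
    (hFm' : MemLp F' (4 / 3) volume) (hF : DuhRepresentable g ε F)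
    (hF' : DuhRepresentable g ε F') : DuhRepresentable g ε (F - F') := by
  filter_upwards [hF, hF'] with t h1 h2
  simp_rw [duhL2_sub hg hFm hFm', phase_sub, map_sub]
  have h3 := h1.add h2.neg
  simp only [← sub_eq_add_neg] at h3
  convert! h3 using 2

theorem duhRepresentable_zero (hg : Integrable g) : DuhRepresentable g ε 0 := by
  have h0 : MemLp (0 : ℝ → ℝ →ᵇ ℂ) (4 / 3) volume := MemLp.zero
  have : ∀ t, duhL2 g ε 0 0 t = 0 := fun t => by
    have := duhL2_sub (ε := ε) hg h0 h0 0 t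
    rwa [sub_self, sub_self] at this
  refine ae_of_all _ fun t => ?_
  have h1 : phase t 0 = 0 := by
    have := phase_sub t 0 0
    rwa [sub_self, sub_self] at this
  simp_rw [this, h1, map_zero]
  exact cauchySeq_const _

theorem DuhRepresentable.add (hg : Integrable g) (hFm : MemLp F (4 / 3) volume)
    (hFm' : MemLp F' (4 / 3) volume) (hF : DuhRepresentable g ε F)
    (hF' : DuhRepresentable g ε F') : DuhRepresentable g ε (F + F') := by
  have h0 : MemLp (0 : ℝ → ℝ →ᵇ ℂ) (4 / 3) volume := MemLp.zero
  have := hF.sub hg hFm (h0.sub hFm') ((duhRepresentable_zero hg).sub hg h0 hFm' hF')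
  simpa using this

/-- Representable forcings are closed in L^{4/3}: the maximal error over all regularizations is at
most the mass times the fractional integral of the forcing error, and its L⁴ norm is controlled by
Hardy–Littlewood–Sobolev. -/
theorem DuhRepresentable.of_tendsto (hg : Integrable g) {f : ℕ → ℝ → ℝ →ᵇ ℂ}
    (hFm : MemLp F (4 / 3) volume) (hfm : ∀ k, MemLp (f k) (4 / 3) volume)
    (hf : ∀ k, DuhRepresentable g ε (f k))
    (hlim : Tendsto (fun k => ∫⁻ s, ‖F s - f k s‖ₑ ^ (4 / 3 : ℝ)) atTop (𝓝 0)) :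
    DuhRepresentable g ε F := by
  refine ae_cauchySeq_of_approx (V := fun k n t => regInv n (phase t (duhL2 g ε (f k) 0 t)))
    (B := fun k t => mass g * fracInt (fun s => ‖F s - f k s‖ₑ) t)
    (fun k => (measurable_fracInt_of_aemeasurable (hFm.sub (hfm k)).1.enorm).const_mul _) hf
    (fun k t n => ?_) ?_
  · rw [← map_sub, ← phase_sub, ← duhL2_sub hg hFm (hfm k)]
    refine (enorm_regInv_phase_duhL2_le hg (hFm.sub (hfm k)) 0 t t n).trans ?_
    gcongr
    exact setLIntegral_le_fracInt _ _ _
  · have hmt := mass_ne_top hg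
    have h1 : Tendsto (fun k => mass g ^ (4 : ℝ) * (144 ^ 2
        * (∫⁻ s, ‖F s - f k s‖ₑ ^ (4 / 3 : ℝ)) ^ (3 : ℝ))) atTop (𝓝 0) := by
      have h2 := (ENNReal.continuous_rpow_const (y := 3)).tendsto _ |>.comp hlim
      have h3 := ENNReal.Tendsto.const_mul (a := mass g ^ (4 : ℝ))
        (ENNReal.Tendsto.const_mul (a := 144 ^ 2) h2 (Or.inr (by norm_num)))
        (Or.inr (by finiteness))
      simpa [Function.comp_def] using h3
    refine tendsto_of_tendsto_of_tendsto_of_le_of_le tendsto_const_nhds h1 (fun _ => bot_le)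
      fun k => ?_
    simp_rw [ENNReal.mul_rpow_of_nonneg _ _ (show (0 : ℝ) ≤ 4 by norm_num)]
    rw [lintegral_const_mul' _ _ (by finiteness)]
    gcongr
    exact lintegral_fracInt_pow_four_le_of_aemeasurable (hFm.sub (hfm k)).1.enorm

theorem memLp_indicator_const_of_finite {S : Set ℝ} (hS : MeasurableSet S) (hSf : volume S ≠ ∞)
    (c : ℝ →ᵇ ℂ) : MemLp (S.indicator fun _ => c) (4 / 3) (volume : Measure ℝ) :=
  memLp_indicator_const _ hS c (Or.inr hSf)

/-- The time integral effectively runs over the intersection with (α, β], so its oscillation bound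
is uniform in t. The profile is dominated by a multiple of 1/(1 + ξ²), hence integrable. -/
theorem duhRepresentable_indicator_Ioc (hg : Integrable g) (c : ℝ →ᵇ ℂ) (α β : ℝ) :
    DuhRepresentable g ε ((Ioc α β).indicator fun _ => c) := by
  have hm := memLp_indicator_const_of_finite (measurableSet_Ioc (a := α) (b := β)) (by simp) c
  refine ae_of_all _ fun t => ?_
  have hbd : ∀ ξ, ‖duhProfile g ε ((Ioc α β).indicator fun _ => c) 0 t ξ‖ ≤
      (‖c‖ * ∫ y, ‖g y‖) * ((|β - α| + 1) * (1 + ξ ^ 2)⁻¹) := by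
    intro ξ
    have e1 : ∀ s, freeSymbol (-s) ξ * cplFourier g ε ((Ioc α β).indicator (fun _ => c) s) ξ
        = (Ioc α β).indicator (fun s => freeSymbol (-s) ξ * cplFourier g ε c ξ) s := fun s => by
      by_cases hs : s ∈ Ioc α β
      · simp [hs]
      · simp [hs, cplFourier]
    rw [duhProfile, intervalIntegral.intervalIntegral_eq_integral_uIoc]
    simp_rw [e1]
    rw [norm_smul, setIntegral_indicator measurableSet_Ioc, uIoc, Ioc_inter_Ioc,
      integral_mul_const, norm_mul]
    have h1 : ‖(if (0 : ℝ) ≤ t then 1 else -1 : ℝ)‖ = 1 := by split_ifs <;> simp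
    rw [h1, one_mul, mul_comm]
    gcongr
    · exact norm_cplFourier_le hg c ξ
    · rcases le_or_gt (max (min 0 t) α) (min (max 0 t) β) with h | h
      · rw [← intervalIntegral.integral_of_le h]
        have h2 : |min (max 0 t) β - max (min 0 t) α| ≤ |β - α| := by
          rw [abs_of_nonneg (by linarith)]
          refine le_trans ?_ (le_abs_self _)
          have := le_max_right (min 0 t) α
          have := min_le_right (max 0 t) β
          linarith
        exact (norm_integral_freeSymbol_le _ _ _).trans
          (mul_le_mul_of_nonneg_right (by linarith) (by positivity))
      · rw [Ioc_eq_empty (not_lt.2 h.le)]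
        simp only [setIntegral_empty, norm_zero]
        positivity
  have hint : Integrable (duhL2 g ε ((Ioc α β).indicator fun _ => c) 0 t) := by
    refine Integrable.congr ?_ (duhL2_ae hg hm 0 t).symm
    exact ((integrable_inv_one_add_sq.const_mul _).const_mul _).mono'
      (continuous_duhProfile hg hm 0 t).aestronglyMeasurable (ae_of_all _ hbd)
  exact (hasRep_of_integrable (integrable_phase hint t)).cauchySeq

theorem tendsto_lintegral_indicator_const {S : ℕ → Set ℝ} {T : Set ℝ}
    (hS : ∀ k, MeasurableSet (S k)) (hT : MeasurableSet T) (hTf : volume T ≠ ∞)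
    (hST : ∀ k, S k ⊆ T) (hlim : ∀ s ∈ T, ∀ᶠ k in atTop, s ∈ S k) (c : ℝ →ᵇ ℂ) :
    Tendsto (fun k => ∫⁻ s, ‖T.indicator (fun _ => c) s - (S k).indicator (fun _ => c) s‖ₑ
      ^ (4 / 3 : ℝ)) atTop (𝓝 0) := by
  have key : Tendsto (fun k => ∫⁻ s, (T \ S k).indicator (fun _ => ‖c‖ₑ ^ (4 / 3 : ℝ)) s) atTop
      (𝓝 (∫⁻ _ : ℝ, (0 : ℝ≥0∞))) := by
    refine tendsto_lintegral_of_dominated_convergence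
      (T.indicator fun _ => ‖c‖ₑ ^ (4 / 3 : ℝ))
      (fun k => measurable_const.indicator (hT.diff (hS k)))
      (fun k => ae_of_all _ fun s => indicator_le_indicator_of_subset sdiff_subset
        (fun _ => bot_le) s) ?_ (ae_of_all _ fun s => ?_)
    · rw [lintegral_indicator hT, setLIntegral_const]
      finiteness
    · refine tendsto_const_nhds.congr' ?_
      by_cases hs : s ∈ T
      · filter_upwards [hlim s hs] with k hk
        simp [hk]
      · exact Eventually.of_forall fun k => by simp [hs]
  rw [lintegral_zero] at key
  refine key.congr fun k => lintegral_congr fun s => ?_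
  by_cases hs : s ∈ T
  · by_cases hk : s ∈ S k <;> simp [hs, hk]
  · have : s ∉ S k := fun h => hs (hST k h)
    simp [hs, this]

theorem duhRepresentable_indicator_bounded (hg : Integrable g) (c : ℝ →ᵇ ℂ) (N : ℝ) {S : Set ℝ}
    (hS : MeasurableSet S) :
    DuhRepresentable g ε ((S ∩ Ioc (-N) N).indicator fun _ => c) := by
  have hfin : ∀ S : Set ℝ, volume (S ∩ Ioc (-N) N) ≠ ∞ := fun S =>
    ((measure_mono inter_subset_right).trans_lt (by simp)).ne
  -- Half-lines generate the Borel sets and meet the window in an interval. The window keeps all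
  -- measures finite and turns a complement into a difference of indicators.
  induction S, hS using MeasurableSpace.induction_on_inter (borel_eq_generateFrom_Iic ℝ ▸ rfl :
    (inferInstance : MeasurableSpace ℝ) = MeasurableSpace.generateFrom (range Iic))
    isPiSystem_Iic with
  | empty =>
    rw [empty_inter, indicator_empty]
    exact duhRepresentable_zero hg
  | basic t ht =>
    obtain ⟨β, rfl⟩ := ht
    rw [inter_comm, Ioc_inter_Iic]
    exact duhRepresentable_indicator_Ioc hg c _ _
  | compl t htm ih =>
    have e : ((tᶜ ∩ Ioc (-N) N).indicator fun _ : ℝ => c)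
        = ((Ioc (-N) N).indicator fun _ => c) - ((t ∩ Ioc (-N) N).indicator fun _ => c) := by
      funext s
      by_cases hs : s ∈ Ioc (-N) N
      · by_cases ht : s ∈ t <;> simp [hs, ht]
      · simp [hs]
    rw [e]
    exact (duhRepresentable_indicator_Ioc hg c _ _).sub hg
      (memLp_indicator_const_of_finite measurableSet_Ioc (by simp) c)
      (memLp_indicator_const_of_finite (htm.inter measurableSet_Ioc) (hfin _) c) ih
  | iUnion f hd hfm ih =>
    set S : ℕ → Set ℝ := fun k => (⋃ i ∈ Finset.range k, f i) ∩ Ioc (-N) N with hSdef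
    have hSm : ∀ k, MeasurableSet (S k) := fun k =>
      (Finset.measurableSet_biUnion _ fun i _ => hfm i).inter measurableSet_Ioc
    have hUm : MeasurableSet ((⋃ i, f i) ∩ Ioc (-N) N) :=
      (MeasurableSet.iUnion hfm).inter measurableSet_Ioc
    refine DuhRepresentable.of_tendsto hg (f := fun k => (S k).indicator fun _ => c)
      (memLp_indicator_const_of_finite hUm (hfin _) c)
      (fun k => memLp_indicator_const_of_finite (hSm k) (hfin _) c) (fun k => ?_)
      (tendsto_lintegral_indicator_const hSm hUm (hfin _) (fun k => ?_) (fun s hs => ?_) c)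
    · induction k with
      | zero =>
        have : S 0 = ∅ := by simp [hSdef]
        rw [this, indicator_empty]
        exact duhRepresentable_zero hg
      | succ k ihk =>
        have e : ((S (k + 1)).indicator fun _ : ℝ => c)
            = ((S k).indicator fun _ => c) + ((f k ∩ Ioc (-N) N).indicator fun _ => c) := by
          have hdisj : Disjoint (S k) (f k ∩ Ioc (-N) N) := by
            refine Disjoint.mono inter_subset_left inter_subset_left ?_
            simp only [disjoint_iUnion_left, Finset.mem_range]
            exact fun i hi => hd (Nat.ne_of_lt hi)
          refine Eq.trans ?_ (indicator_union_of_disjoint hdisj fun _ : ℝ => c)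
          congr 1
          simp only [hSdef, Finset.range_add_one, Finset.set_biUnion_insert, union_inter_distrib_right]
          rw [union_comm]
        rw [e]
        exact ihk.add hg (memLp_indicator_const_of_finite (hSm k) (hfin _) c)
          (memLp_indicator_const_of_finite ((hfm k).inter measurableSet_Ioc) (hfin _) c) (ih k)
    · exact inter_subset_inter_left _ (iUnion₂_subset fun i _ => subset_iUnion f i)
    · obtain ⟨⟨_, ⟨i, rfl⟩, hi⟩, hs2⟩ := hs
      filter_upwards [eventually_gt_atTop i] with k hk
      exact ⟨mem_biUnion (Finset.mem_coe.2 (Finset.mem_range.2 hk)) hi, hs2⟩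

/-- Inhomogeneous Strichartz estimates: Duhamel integrals of `L^{4/3}` forcings have a continuous
representative at almost every time. -/
theorem duhRepresentable (hg : Integrable g) (hF : MemLp F (4 / 3) volume) :
    DuhRepresentable g ε F := by
  refine MemLp.induction (by finiteness) (fun F => DuhRepresentable g ε F) ?_ ?_ ?_ ?_ hF
  · intro c S hS hSf
    -- A set of finite measure may be unbounded in time; it is exhausted by bounded windows.
    refine DuhRepresentable.of_tendsto hg
      (f := fun k : ℕ => (S ∩ Ioc (-(k : ℝ)) k).indicator fun _ => c)
      (memLp_indicator_const_of_finite hS hSf.ne c)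
      (fun k => memLp_indicator_const_of_finite (hS.inter measurableSet_Ioc)
        ((measure_mono inter_subset_left).trans_lt hSf).ne c)
      (fun k => duhRepresentable_indicator_bounded hg c k hS)
      (tendsto_lintegral_indicator_const (fun k => hS.inter measurableSet_Ioc) hS hSf.ne
        (fun k => inter_subset_left) (fun s hs => ?_) c)
    obtain ⟨N, hN⟩ := exists_nat_gt |s|
    filter_upwards [eventually_ge_atTop N] with k hk
    have : (N : ℝ) ≤ k := by exact_mod_cast hk
    have := abs_lt.1 hN
    exact ⟨hs, by linarith, by linarith⟩
  · exact fun F F' _ hFm hFm' hF hF' => hF.add hg hFm hFm' hF'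
  · refine IsSeqClosed.isClosed fun f F hf hlim => ?_
    refine DuhRepresentable.of_tendsto hg (Lp.memLp F) (fun k => Lp.memLp (f k)) hf ?_
    have h1 := (ENNReal.continuous_rpow_const (y := 4 / 3)).tendsto _ |>.comp
      ((Lp.tendsto_Lp_iff_tendsto_eLpNorm' f F).1 hlim)
    simp only [Function.comp_def] at h1
    rw [ENNReal.zero_rpow_of_pos (by norm_num)] at h1
    refine h1.congr fun k => ?_
    rw [← lintegral_enorm_rpow_four_thirds]
    refine lintegral_congr fun s => ?_
    rw [Pi.sub_apply, ← enorm_neg, neg_sub]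
  · exact fun F F' h _ hF => hF.congr h

/-- The continuous representative of the Duhamel integral started at time `0`. -/
def duhRep (g : ℝ → ℝ) (ε : ℝ) (F : ℝ → ℝ →ᵇ ℂ) (t : ℝ) : ℝ →ᵇ ℂ :=
  rep (phase t (duhL2 g ε F 0 t))

theorem ae_hasRep_duhL2 (hg : Integrable g) (hF : MemLp F (4 / 3) volume) :
    ∀ᵐ t, HasRep (phase t (duhL2 g ε F 0 t)) (duhRep g ε F t) := by
  filter_upwards [duhRepresentable (ε := ε) hg hF] with t ht
  exact hasRep_rep_of_cauchySeq ht

theorem aestronglyMeasurable_duhRep (hg : Integrable g) (hF : MemLp F (4 / 3) volume) :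
    AEStronglyMeasurable (duhRep g ε F) volume :=
  aestronglyMeasurable_rep (continuousOn_univ.1
    (continuousOn_phase_comp (continuous_duhL2 hg hF 0).continuousOn)).aestronglyMeasurable
    (ae_hasRep_duhL2 hg hF)

theorem ae_enorm_duhRep_le (hg : Integrable g) (hF : MemLp F (4 / 3) volume) :
    ∀ᵐ t, ‖duhRep g ε F t‖ₑ ≤ mass g * ∫⁻ s in uIoc 0 t, dispKernel (t - s) * ‖F s‖ₑ := by
  filter_upwards [ae_hasRep_duhL2 (ε := ε) hg hF] with t ht
  exact ht.norm_le fun n => enorm_regInv_phase_duhL2_le hg hF 0 t t n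

theorem ae_duhRep_sub (hg : Integrable g) (hF : MemLp F (4 / 3) volume)
    (hF' : MemLp F' (4 / 3) volume) :
    ∀ᵐ t, duhRep g ε (F - F') t = duhRep g ε F t - duhRep g ε F' t := by
  filter_upwards [ae_hasRep_duhL2 (ε := ε) hg hF, ae_hasRep_duhL2 (ε := ε) hg hF'] with t h1 h2
  rw [duhRep, duhL2_sub hg hF hF', phase_sub]
  exact (h1.sub h2).rep_eq

theorem duhRep_congr {t : ℝ} (h : ∀ᵐ s ∂(volume.restrict (uIoc 0 t)), F s = F' s) :
    duhRep g ε F t = duhRep g ε F' t := by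
  rw [duhRep, duhL2_congr h, ← duhRep]

/-- The pointwise dispersive bound loses nothing when the causal integral is enlarged to the full
fractional integral, to which Hardy–Littlewood–Sobolev applies. -/
theorem lintegral_duhRep_le (hg : Integrable g) (hF : MemLp F (4 / 3) volume) :
    ∫⁻ t, ‖duhRep g ε F t‖ₑ ^ (4 : ℝ) ≤
      mass g ^ (4 : ℝ) * (144 ^ 2 * (∫⁻ s, ‖F s‖ₑ ^ (4 / 3 : ℝ)) ^ (3 : ℝ)) := by
  have hmt := mass_ne_top hg
  calc ∫⁻ t, ‖duhRep g ε F t‖ₑ ^ (4 : ℝ)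
      ≤ ∫⁻ t, (mass g * fracInt (fun s => ‖F s‖ₑ) t) ^ (4 : ℝ) := by
        refine lintegral_mono_ae ?_
        filter_upwards [ae_enorm_duhRep_le (ε := ε) hg hF] with t ht
        gcongr
        refine ht.trans ?_
        gcongr
        exact setLIntegral_le_fracInt _ _ _
    _ ≤ _ := by
        simp_rw [ENNReal.mul_rpow_of_nonneg _ _ (show (0 : ℝ) ≤ 4 by norm_num)]
        rw [lintegral_const_mul' _ _ (by finiteness)]
        gcongr
        exact lintegral_fracInt_pow_four_le_of_aemeasurable hF.1.enorm

end Density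

/-! ### Volterra operators with an L⁴ coefficient -/

/-- Hölder with exponents 3/2 and 3 places a product of three L⁴ functions in L^{4/3}. -/
theorem lintegral_sq_mul_rpow_le {μ : Measure ℝ} {a b : ℝ → ℝ≥0∞} (ha : AEMeasurable a μ)
    (hb : AEMeasurable b μ) : ∫⁻ s, (a s ^ (2 : ℝ) * b s) ^ (4 / 3 : ℝ) ∂μ ≤
      (∫⁻ s, a s ^ (4 : ℝ) ∂μ) ^ (2 / 3 : ℝ) * (∫⁻ s, b s ^ (4 : ℝ) ∂μ) ^ (1 / 3 : ℝ) := by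
  have h := ENNReal.lintegral_mul_le_Lp_mul_Lq μ (p := 3 / 2) (q := 3)
    (Real.holderConjugate_iff.2 ⟨by norm_num, by norm_num⟩)
    (ha.pow_const (8 / 3 : ℝ)) (hb.pow_const (4 / 3 : ℝ))
  simp_rw [← ENNReal.rpow_mul] at h
  rw [show (8 / 3 * (3 / 2) : ℝ) = 4 by norm_num, show (4 / 3 * 3 : ℝ) = 4 by norm_num,
    show (1 / (3 / 2) : ℝ) = 2 / 3 by norm_num] at h
  refine le_trans (le_of_eq ?_) h
  refine lintegral_congr fun s => ?_
  rw [ENNReal.mul_rpow_of_nonneg _ _ (by norm_num), ← ENNReal.rpow_mul, Pi.mul_apply]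
  norm_num

/-- The localization to S matters: only the mass of the coefficient on S enters, and this is the
source of smallness on a single shell. -/
theorem lintegral_fracInt_sq_mul_le {a b : ℝ → ℝ≥0∞} (ha : AEMeasurable a)
    (hb : AEMeasurable b) {S : Set ℝ} (hS : MeasurableSet S) :
    ∫⁻ t, (∫⁻ s in S, dispKernel (t - s) * (a s ^ (2 : ℝ) * b s)) ^ (4 : ℝ) ≤
      144 ^ 2 * ((∫⁻ s in S, a s ^ (4 : ℝ)) ^ (2 : ℝ) * ∫⁻ s in S, b s ^ (4 : ℝ)) := by
  set f : ℝ → ℝ≥0∞ := S.indicator fun s => a s ^ (2 : ℝ) * b s with hf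
  have e1 : ∀ t, ∫⁻ s in S, dispKernel (t - s) * (a s ^ (2 : ℝ) * b s) = fracInt f t := fun t => by
    rw [fracInt, ← lintegral_indicator hS]
    refine lintegral_congr fun s => ?_
    by_cases hs : s ∈ S <;> simp [hf, hs]
  have e2 : ∫⁻ s, f s ^ (4 / 3 : ℝ) = ∫⁻ s in S, (a s ^ (2 : ℝ) * b s) ^ (4 / 3 : ℝ) := by
    rw [← lintegral_indicator hS]
    refine lintegral_congr fun s => ?_
    by_cases hs : s ∈ S <;> simp [hf, hs]
  simp_rw [e1]
  have hfm : AEMeasurable f := ((ha.pow_const _).mul hb).indicator hS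
  refine (lintegral_fracInt_pow_four_le_of_aemeasurable hfm).trans ?_
  rw [e2]
  gcongr
  calc _ ≤ ((∫⁻ s in S, a s ^ (4 : ℝ)) ^ (2 / 3 : ℝ) * (∫⁻ s in S, b s ^ (4 : ℝ)) ^ (1 / 3 : ℝ))
        ^ (3 : ℝ) := by
        gcongr
        exact lintegral_sq_mul_rpow_le ha.restrict hb.restrict
    _ = _ := by
        rw [ENNReal.mul_rpow_of_nonneg _ _ (by norm_num), ← ENNReal.rpow_mul, ← ENNReal.rpow_mul]
        norm_num

theorem add_rpow_four_le (x y : ℝ≥0∞) :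
    (x + y) ^ (4 : ℝ) ≤ 8 * (x ^ (4 : ℝ) + y ^ (4 : ℝ)) := by
  have := ENNReal.rpow_add_le_mul_rpow_add_rpow x y (p := 4) (by norm_num)
  rwa [show (2 : ℝ≥0∞) ^ (4 - 1 : ℝ) = 8 by
    rw [show (4 - 1 : ℝ) = ((3 : ℕ) : ℝ) by norm_num, ENNReal.rpow_natCast]; norm_num] at this

section Shells

variable (m : Measure ℝ) [IsFiniteMeasure m]

/-- The index of the shell of mass `η` that contains the sphere of radius `|t|`. -/
def shellIndex (η t : ℝ) : ℕ := ⌊m.real {s | |s| ≤ |t|} / η⌋₊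

variable {m}

theorem shellIndex_mono {η : ℝ} (hη : 0 < η) {s t : ℝ} (h : |s| ≤ |t|) :
    shellIndex m η s ≤ shellIndex m η t := by
  refine Nat.floor_mono ?_
  gcongr
  · finiteness

theorem measurable_shellIndex {η : ℝ} (hη : 0 < η) : Measurable (shellIndex m η) := by
  have h : Monotone fun r : ℝ => ⌊m.real {s | |s| ≤ r} / η⌋₊ := fun r r' hr => by
    refine Nat.floor_mono ?_
    gcongr
    · finiteness
  exact h.measurable.comp (by fun_prop : Measurable fun t : ℝ => |t|)

/-- Within a shell the mass of the centered intervals varies by less than η, because its quotient by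
η keeps the same integer part. -/
theorem measure_shell_le [NullSingletonClass m] {η : ℝ} (hη : 0 < η) (k : ℕ) :
    m {t | shellIndex m η t = k} ≤ ENNReal.ofReal η := by
  have hS : MeasurableSet {t | shellIndex m η t = k} :=
    measurable_shellIndex hη (measurableSet_singleton k)
  -- Inner regularity reduces to compact sets, on which |t| attains its extremes. The innermost
  -- sphere has to be added by hand; it has at most two points, hence measure zero.
  rw [hS.measure_eq_iSup_isCompact_of_ne_top (by finiteness)]
  refine iSup₂_le fun K hKS => iSup_le fun hK => ?_
  rcases K.eq_empty_or_nonempty with rfl | hne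
  · simp
  obtain ⟨p, hp, hpmin⟩ := hK.exists_isMinOn hne (continuous_abs.continuousOn)
  obtain ⟨q, hq, hqmax⟩ := hK.exists_isMaxOn hne (continuous_abs.continuousOn)
  have hle : |p| ≤ |q| := hpmin hq
  have hpk : (k : ℝ) ≤ m.real {s | |s| ≤ |p|} / η := by
    have := hKS hp
    simp only [mem_ofPred_eq, shellIndex] at this
    rw [← this]
    exact Nat.floor_le (by positivity)
  have hqk : m.real {s | |s| ≤ |q|} / η < k + 1 := by
    have := hKS hq
    simp only [mem_ofPred_eq, shellIndex] at this
    rw [← this]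
    exact Nat.lt_floor_add_one _
  rw [le_div_iff₀ hη] at hpk
  rw [div_lt_iff₀ hη] at hqk
  have hzero : m {s | |s| = |p|} = 0 := by
    refine Set.Finite.measure_zero (Set.Finite.subset (toFinite {p, -p}) fun s hs => ?_) m
    simpa using abs_eq_abs.1 hs
  have hsub : K ⊆ ({s | |s| ≤ |q|} \ {s | |s| ≤ |p|}) ∪ {s | |s| = |p|} := fun s hs => by
    have hps : |p| ≤ |s| := hpmin hs
    rcases hps.eq_or_lt with h | h
    · exact Or.inr h.symm
    · exact Or.inl ⟨hqmax hs, not_le.2 h⟩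
  have hsub2 : {s : ℝ | |s| ≤ |p|} ⊆ {s | |s| ≤ |q|} := fun s hs => le_trans hs hle
  have hm1 : MeasurableSet {s : ℝ | |s| ≤ |p|} := measurableSet_le (by fun_prop) (by fun_prop)
  calc m K ≤ m ({s | |s| ≤ |q|} \ {s | |s| ≤ |p|}) + m {s | |s| = |p|} :=
        (measure_mono hsub).trans (measure_union_le _ _)
    _ = ENNReal.ofReal (m.real ({s | |s| ≤ |q|} \ {s | |s| ≤ |p|})) := by
        rw [hzero, add_zero, ofReal_measureReal (by finiteness)]
    _ ≤ ENNReal.ofReal η := by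
        refine ENNReal.ofReal_le_ofReal ?_
        rw [measureReal_sdiff hsub2 hm1]
        linarith

end Shells

/-- A weight that makes the Volterra operator with kernel `dispKernel (t - s) * a s ^ 2` small,
with a lower bound depending only on the `L⁴` norm of `a`. -/
theorem exists_volterra_weight (A : NNReal) {κ : NNReal} (hκ : 0 < κ) : ∃ c : NNReal, 0 < c ∧
    ∀ a : ℝ → ℝ≥0∞, AEMeasurable a → ∫⁻ s, a s ^ (4 : ℝ) ≤ A →
      ∃ w : ℝ → ℝ≥0∞, Measurable w ∧ (∀ t, c ≤ w t) ∧ (∀ t, w t ≤ 1) ∧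
        ∀ b : ℝ → ℝ≥0∞, AEMeasurable b →
          ∫⁻ t, (w t * ∫⁻ s in uIoc 0 t, dispKernel (t - s) * (a s ^ (2 : ℝ) * b s)) ^ (4 : ℝ) ≤
            κ * ∫⁻ t, (w t * b t) ^ (4 : ℝ) := by
  -- The final constant is 8 · 144² (A² η⁴ + η²): earlier shells contribute the first summand and
  -- the current shell the second. As η ≤ 1, both powers may be replaced by η.
  obtain ⟨η, hη, hη1, hηκ⟩ : ∃ η : NNReal, 0 < η ∧ η ≤ 1 ∧
      8 * (144 ^ 2 * (A ^ 2 + 1)) * η ≤ κ := by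
    refine ⟨min 1 (κ / (8 * (144 ^ 2 * (A ^ 2 + 1)))), by positivity, min_le_left _ _, ?_⟩
    rw [mul_comm, ← le_div_iff₀ (by positivity)]
    exact min_le_right _ _
  -- The total mass is at most A, so no shell has an index above ⌊A/η⌋. The lower bound for the
  -- weight therefore does not depend on the coefficient.
  refine ⟨η ^ ⌊(A : ℝ) / η⌋₊, by positivity, fun a ha haA => ?_⟩
  set m : Measure ℝ := volume.withDensity fun s => a s ^ (4 : ℝ) with hm
  have hmfin : m univ ≤ A := by simpa [hm] using haA
  have : IsFiniteMeasure m := ⟨hmfin.trans_lt ENNReal.coe_lt_top⟩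
  have hη' : (0 : ℝ) < η := hη
  set k := shellIndex m (η : ℝ) with hk
  have hkm : Measurable k := measurable_shellIndex hη'
  set w : ℝ → ℝ≥0∞ := fun t => ((η ^ k t : NNReal) : ℝ≥0∞) with hw
  have hwm : Measurable w := by
    have : Measurable fun n : ℕ => ((η ^ n : NNReal) : ℝ≥0∞) := measurable_from_top
    exact this.comp hkm
  refine ⟨w, hwm, fun t => ?_, fun t => ?_, fun b hb => ?_⟩
  · simp only [hw]
    refine ENNReal.coe_le_coe.2 (pow_le_pow_of_le_one bot_le hη1 (Nat.floor_mono ?_))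
    gcongr
    refine ENNReal.toReal_le_of_le_ofReal A.coe_nonneg ?_
    simpa using (measure_mono (subset_univ _)).trans hmfin
  · simp only [hw]
    exact ENNReal.coe_le_one_iff.2 (pow_le_one₀ bot_le hη1)
  set B : ℝ → ℝ≥0∞ := fun t => w t * b t with hB
  have hBm : AEMeasurable B := hwm.aemeasurable.mul hb
  set S : ℕ → Set ℝ := fun n => {t | k t = n} with hS
  have hSm : ∀ n, MeasurableSet (S n) := fun n => hkm (measurableSet_singleton n)
  have hSmass : ∀ n, ∫⁻ s in S n, a s ^ (4 : ℝ) ≤ η := fun n => by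
    have := measure_shell_le (m := m) hη' n
    rw [ENNReal.ofReal_coe_nnreal] at this
    exact (withDensity_apply _ (hSm n)).ge.trans this
  set P : ℝ → ℝ≥0∞ := fun t => ∫⁻ s, dispKernel (t - s) * (a s ^ (2 : ℝ) * B s) with hP
  set Q : ℝ → ℝ≥0∞ := fun t => ∫⁻ s in S (k t), dispKernel (t - s) * (a s ^ (2 : ℝ) * B s) with hQ
  -- Causality means |s| ≤ |t|, so s never lies in a later shell than t. From an earlier shell the
  -- ratio of weights is at most η; within the same shell the weights agree, and smallness comes
  -- from the mass of the coefficient.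
  have hpt : ∀ t, w t * ∫⁻ s in uIoc 0 t, dispKernel (t - s) * (a s ^ (2 : ℝ) * b s) ≤
      η * P t + Q t := by
    intro t
    have hwt : w t ≠ ∞ := ENNReal.coe_ne_top
    rw [← lintegral_const_mul' _ _ hwt]
    have h1 : ∀ s ∈ uIoc 0 t, w t * (dispKernel (t - s) * (a s ^ (2 : ℝ) * b s)) ≤
        η * (dispKernel (t - s) * (a s ^ (2 : ℝ) * B s))
          + (S (k t)).indicator (fun s => dispKernel (t - s) * (a s ^ (2 : ℝ) * B s)) s := by
      intro s hs
      have hst : |s| ≤ |t| := by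
        rcases le_total 0 t with h | h
        · rw [uIoc_of_le h] at hs
          rw [abs_of_pos hs.1, abs_of_nonneg h]; exact hs.2
        · rw [uIoc_of_ge h] at hs
          rw [abs_of_nonpos hs.2, abs_of_nonpos h]; linarith [hs.1]
      have hks : k s ≤ k t := shellIndex_mono hη' hst
      by_cases hmem : s ∈ S (k t)
      · rw [indicator_of_mem hmem]
        refine le_add_left (le_of_eq ?_)
        have : k s = k t := hmem
        simp only [hB, hw, this]
        ring
      · rw [indicator_of_notMem hmem, add_zero]
        have hlt : k s < k t := lt_of_le_of_ne hks hmem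
        have : w t ≤ η * w s := by
          simp only [hw]
          rw [← ENNReal.coe_mul, ← pow_succ']
          exact ENNReal.coe_le_coe.2 (pow_le_pow_of_le_one bot_le hη1 hlt)
        calc _ ≤ (η * w s) * (dispKernel (t - s) * (a s ^ (2 : ℝ) * b s)) := by gcongr
          _ = _ := by simp only [hB]; ring
    calc _ ≤ ∫⁻ s in uIoc 0 t, (η * (dispKernel (t - s) * (a s ^ (2 : ℝ) * B s))
          + (S (k t)).indicator (fun s => dispKernel (t - s) * (a s ^ (2 : ℝ) * B s)) s) :=
          setLIntegral_mono' measurableSet_uIoc h1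
      _ ≤ ∫⁻ s, (η * (dispKernel (t - s) * (a s ^ (2 : ℝ) * B s))
          + (S (k t)).indicator (fun s => dispKernel (t - s) * (a s ^ (2 : ℝ) * B s)) s) :=
          setLIntegral_le_lintegral _ _
      _ = _ := by
          rw [lintegral_add_left', lintegral_const_mul' _ _ ENNReal.coe_ne_top,
            lintegral_indicator (hSm _)]
          exact (((measurable_dispKernel.comp (by fun_prop)).aemeasurable).mul
            ((ha.pow_const _).mul hBm)).const_mul _
  have hP4 : ∫⁻ t, P t ^ (4 : ℝ) ≤ 144 ^ 2 * (A ^ (2 : ℝ) * ∫⁻ s, B s ^ (4 : ℝ)) := by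
    have := lintegral_fracInt_sq_mul_le ha hBm MeasurableSet.univ
    simp only [Measure.restrict_univ] at this
    refine this.trans ?_
    gcongr
  -- The diagonal part decouples into the separate shells. The localized estimates are summed
  -- without loss because the fourth-power integrals of B over the shells add up.
  have hQ4 : ∫⁻ t, Q t ^ (4 : ℝ) ≤ 144 ^ 2 * (η ^ (2 : ℝ) * ∫⁻ s, B s ^ (4 : ℝ)) := by
    have hU : ⋃ n, S n = univ := by
      ext t; simp [hS]
    have hd : Pairwise (Function.onFun Disjoint S) := fun i j hij =>
      disjoint_left.2 fun t hi hj => hij (Eq.trans (Eq.symm hi) hj)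
    have hsum : ∀ f : ℝ → ℝ≥0∞, ∫⁻ t, f t = ∑' n, ∫⁻ t in S n, f t := fun f => by
      rw [← setLIntegral_univ, ← hU, lintegral_iUnion hSm hd]
    rw [hsum, hsum fun s => B s ^ (4 : ℝ), ← ENNReal.tsum_mul_left, ← ENNReal.tsum_mul_left]
    refine ENNReal.tsum_le_tsum fun n => ?_
    calc ∫⁻ t in S n, Q t ^ (4 : ℝ) = ∫⁻ t in S n,
          (∫⁻ s in S n, dispKernel (t - s) * (a s ^ (2 : ℝ) * B s)) ^ (4 : ℝ) := by
          refine setLIntegral_congr_fun (hSm n) fun t ht => ?_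
          have : k t = n := ht
          simp only [hQ, this]
      _ ≤ _ := setLIntegral_le_lintegral _ _
      _ ≤ _ := lintegral_fracInt_sq_mul_le ha hBm (hSm n)
      _ ≤ _ := by
          gcongr
          exact hSmass n
  have hPm : AEMeasurable P := (measurable_fracInt_of_aemeasurable
    ((ha.pow_const _).mul hBm)).aemeasurable
  calc _ ≤ ∫⁻ t, 8 * ((η * P t) ^ (4 : ℝ) + Q t ^ (4 : ℝ)) := by
        refine lintegral_mono fun t => ?_
        refine le_trans ?_ (add_rpow_four_le _ _)
        gcongr
        exact hpt t
    _ = 8 * (η ^ (4 : ℝ) * (∫⁻ t, P t ^ (4 : ℝ)) + ∫⁻ t, Q t ^ (4 : ℝ)) := by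
        rw [lintegral_const_mul' _ _ (by finiteness)]
        simp_rw [ENNReal.mul_rpow_of_nonneg _ _ (show (0 : ℝ) ≤ 4 by norm_num)]
        rw [lintegral_add_left' ((hPm.pow_const _).const_mul _), lintegral_const_mul' _ _
          (by finiteness)]
    _ ≤ 8 * (η ^ (4 : ℝ) * (144 ^ 2 * (A ^ (2 : ℝ) * ∫⁻ s, B s ^ (4 : ℝ)))
          + 144 ^ 2 * (η ^ (2 : ℝ) * ∫⁻ s, B s ^ (4 : ℝ))) := by gcongr
    _ = ((8 * (144 ^ 2 * (A ^ 2 * η ^ 4 + η ^ 2)) : NNReal) : ℝ≥0∞) * ∫⁻ s, B s ^ (4 : ℝ) := by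
        push_cast
        rw [show (4 : ℝ) = ((4 : ℕ) : ℝ) by norm_num, show (2 : ℝ) = ((2 : ℕ) : ℝ) by norm_num]
        simp_rw [ENNReal.rpow_natCast]
        ring
    _ ≤ _ := by
        gcongr
        refine le_trans ?_ hηκ
        have h4 : η ^ 4 ≤ η := pow_le_of_le_one bot_le hη1 (by norm_num)
        have h2 : η ^ 2 ≤ η := pow_le_of_le_one bot_le hη1 (by norm_num)
        calc 8 * (144 ^ 2 * (A ^ 2 * η ^ 4 + η ^ 2)) ≤ 8 * (144 ^ 2 * (A ^ 2 * η + η)) := by gcongr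
          _ = _ := by ring

/-- The causal fractional integral. -/
def volterra (f : ℝ → ℝ≥0∞) (t : ℝ) : ℝ≥0∞ := ∫⁻ s in uIoc 0 t, dispKernel (t - s) * f s

theorem volterra_congr {f f' : ℝ → ℝ≥0∞} (h : f =ᵐ[volume] f') : volterra f = volterra f' := by
  funext t
  refine lintegral_congr_ae (ae_restrict_of_ae ?_)
  filter_upwards [h] with s hs
  rw [hs]

theorem volterra_mono {f f' : ℝ → ℝ≥0∞} (h : ∀ s, f s ≤ f' s) (t : ℝ) :
    volterra f t ≤ volterra f' t :=
  lintegral_mono fun s => by gcongr; exact h s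

theorem volterra_add {f f' : ℝ → ℝ≥0∞} (hf : AEMeasurable f) (t : ℝ) :
    volterra (fun s => f s + f' s) t = volterra f t + volterra f' t := by
  simp only [volterra, mul_add]
  exact lintegral_add_left' (((measurable_dispKernel.comp (by fun_prop)).aemeasurable).mul
    hf.restrict) _

theorem volterra_const_mul {c : ℝ≥0∞} (hc : c ≠ ∞) (f : ℝ → ℝ≥0∞) (t : ℝ) :
    volterra (fun s => c * f s) t = c * volterra f t := by
  simp only [volterra, ← lintegral_const_mul' _ _ hc]
  refine lintegral_congr fun s => ?_
  ring

theorem measurable_volterra {f : ℝ → ℝ≥0∞} (hf : AEMeasurable f) : Measurable (volterra f) := by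
  rw [volterra_congr hf.ae_eq_mk]
  have hm := hf.measurable_mk
  have e : volterra (hf.mk f) = fun t => ∫⁻ s, {p : ℝ × ℝ | p.2 ∈ uIoc 0 p.1}.indicator
      (fun p => dispKernel (p.1 - p.2) * hf.mk f p.2) (t, s) := by
    funext t
    rw [volterra, ← lintegral_indicator measurableSet_uIoc]
    rfl
  rw [e]
  refine Measurable.lintegral_prod_right' (f := {p : ℝ × ℝ | p.2 ∈ uIoc 0 p.1}.indicator
      (fun p => dispKernel (p.1 - p.2) * hf.mk f p.2)) (Measurable.indicator ?_ ?_)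
  · exact (measurable_dispKernel.comp (by fun_prop)).mul (hm.comp measurable_snd)
  · have : {p : ℝ × ℝ | p.2 ∈ uIoc 0 p.1} = {p | min 0 p.1 < p.2} ∩ {p | p.2 ≤ max 0 p.1} := rfl
    rw [this]
    exact (measurableSet_lt (by fun_prop) (by fun_prop)).inter
      (measurableSet_le (by fun_prop) (by fun_prop))

theorem eLpNorm_four_rpow {E : Type*} [TopologicalSpace E] [ContinuousENorm E] {μ : Measure ℝ}
    (u : ℝ → E) : eLpNorm u 4 μ ^ (4 : ℝ) = ∫⁻ t, ‖u t‖ₑ ^ (4 : ℝ) ∂μ := by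
  rw [eLpNorm_eq_lintegral_rpow_enorm_toReal (by norm_num) (by finiteness), ← ENNReal.rpow_mul]
  norm_num

theorem eLpNorm_four_le_iff {E E' : Type*} [TopologicalSpace E] [ContinuousENorm E]
    [TopologicalSpace E'] [ContinuousENorm E'] {μ μ' : Measure ℝ} {u : ℝ → E} {v : ℝ → E'}
    {c : ℝ≥0∞} : eLpNorm u 4 μ ≤ c * eLpNorm v 4 μ' ↔
      ∫⁻ t, ‖u t‖ₑ ^ (4 : ℝ) ∂μ ≤ c ^ (4 : ℝ) * ∫⁻ t, ‖v t‖ₑ ^ (4 : ℝ) ∂μ' := by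
  rw [← eLpNorm_four_rpow, ← eLpNorm_four_rpow, ← ENNReal.mul_rpow_of_nonneg _ _ (by norm_num),
    ENNReal.rpow_le_rpow_iff (by norm_num)]

theorem eLpNorm_volterra_sq_mul_le {a b : ℝ → ℝ≥0∞} (ha : AEMeasurable a) (hb : AEMeasurable b) :
    eLpNorm (volterra fun s => a s ^ (2 : ℝ) * b s) 4 volume ≤
      12 * eLpNorm a 4 volume ^ (2 : ℝ) * eLpNorm b 4 volume := by
  rw [eLpNorm_four_le_iff]
  simp only [enorm_eq_self]
  have h := lintegral_fracInt_sq_mul_le ha hb MeasurableSet.univ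
  simp only [Measure.restrict_univ] at h
  calc _ ≤ ∫⁻ t, (∫⁻ s, dispKernel (t - s) * (a s ^ (2 : ℝ) * b s)) ^ (4 : ℝ) := by
        gcongr with t
        exact setLIntegral_le_lintegral _ _
    _ ≤ _ := h
    _ = _ := by
        have := eLpNorm_four_rpow (μ := volume) a
        simp only [enorm_eq_self] at this
        rw [← this, ENNReal.mul_rpow_of_nonneg _ _ (by norm_num), ← ENNReal.rpow_mul,
          ← ENNReal.rpow_mul, mul_comm (4 : ℝ) 2]
        rw [mul_assoc, show (12 : ℝ≥0∞) ^ (4 : ℝ) = 144 ^ 2 by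
          rw [show (4 : ℝ) = ((4 : ℕ) : ℝ) by norm_num, ENNReal.rpow_natCast]; norm_num]

/-- `exists_volterra_weight` in terms of a measure comparable to Lebesgue measure. -/
theorem exists_volterra_measure (A : NNReal) {κ : NNReal} (hκ : 0 < κ) : ∃ C : NNReal,
    ∀ a : ℝ → ℝ≥0∞, AEMeasurable a → eLpNorm a 4 volume ≤ A →
      ∃ ν : Measure ℝ, ν ≤ volume ∧ volume ≤ (C : ℝ≥0∞) • ν ∧
        ∀ b : ℝ → ℝ≥0∞, AEMeasurable b →
          eLpNorm (volterra fun s => a s ^ (2 : ℝ) * b s) 4 ν ≤ κ * eLpNorm b 4 ν := by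
  -- The measure has density w⁴, so that its L⁴ norm is the weighted one. The fourth powers of A and
  -- κ translate between norms and integrals of fourth powers.
  obtain ⟨c, hc, H⟩ := exists_volterra_weight (A ^ 4) (κ := κ ^ 4) (by positivity)
  refine ⟨(c ^ 4)⁻¹, fun a ha haA => ?_⟩
  have hr4 : ∀ x : ℝ≥0∞, x ^ (4 : ℝ) = x ^ 4 := fun x => by
    rw [show (4 : ℝ) = ((4 : ℕ) : ℝ) by norm_num, ENNReal.rpow_natCast]
  obtain ⟨w, hwm, hcw, hw1, hV⟩ := H a ha (by
    have := eLpNorm_four_rpow (μ := volume) a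
    simp only [enorm_eq_self] at this
    rw [← this, hr4]
    push_cast
    gcongr)
  have hw4 : Measurable fun t => w t ^ (4 : ℝ) := hwm.pow_const _
  have hwfin : ∀ t, w t ^ (4 : ℝ) < ∞ := fun t =>
    ENNReal.rpow_lt_top_of_nonneg (by norm_num) ((hw1 t).trans_lt ENNReal.one_lt_top).ne
  have key : ∀ f : ℝ → ℝ≥0∞, ∫⁻ t, f t ^ (4 : ℝ) ∂(volume.withDensity fun t => w t ^ (4 : ℝ))
      = ∫⁻ t, (w t * f t) ^ (4 : ℝ) := fun f => by
    rw [lintegral_withDensity_eq_lintegral_mul_non_measurable _ hw4 (ae_of_all _ hwfin)]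
    simp only [Pi.mul_apply, ENNReal.mul_rpow_of_nonneg _ _ (show (0 : ℝ) ≤ 4 by norm_num)]
  refine ⟨volume.withDensity fun t => w t ^ (4 : ℝ), ?_, ?_, fun b hb => ?_⟩
  · conv_rhs => rw [← withDensity_one (μ := (volume : Measure ℝ))]
    refine withDensity_mono (ae_of_all _ fun t => ?_)
    exact ENNReal.rpow_le_one (hw1 t) (by norm_num)
  · rw [← withDensity_smul _ hw4]
    conv_lhs => rw [← withDensity_one (μ := (volume : Measure ℝ))]
    refine withDensity_mono (ae_of_all _ fun t => ?_)
    simp only [Pi.one_apply, Pi.smul_apply, smul_eq_mul]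
    calc (1 : ℝ≥0∞) = (((c ^ 4)⁻¹ * c ^ 4 : NNReal) : ℝ≥0∞) := by
          rw [inv_mul_cancel₀ (by positivity)]; simp
      _ ≤ _ := by
          rw [hr4]
          push_cast
          gcongr
          exact hcw t
  · rw [eLpNorm_four_le_iff]
    simp only [enorm_eq_self]
    rw [key, key, hr4 κ]
    exact_mod_cast hV b hb

theorem eLpNorm_four_le_of_measure_le {E : Type*} [TopologicalSpace E] [ContinuousENorm E]
    {ν : Measure ℝ} {C : NNReal} (h : volume ≤ (C : ℝ≥0∞) • ν) (u : ℝ → E) :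
    eLpNorm u 4 volume ≤ (C ^ (1 / 4 : ℝ) : NNReal) * eLpNorm u 4 ν := by
  rw [eLpNorm_four_le_iff, ENNReal.coe_rpow_of_nonneg _ (by norm_num), ← ENNReal.rpow_mul]
  norm_num
  rw [← smul_eq_mul, ← lintegral_smul_measure]
  exact lintegral_mono' h le_rfl

/-- Uniqueness for linear Volterra inequalities with an `L⁴` coefficient. -/
theorem ae_eq_zero_of_le_volterra {a ρ : ℝ → ℝ≥0∞} (ha : AEMeasurable a)
    (haf : eLpNorm a 4 volume ≠ ∞) (hρ : AEMeasurable ρ) (hρf : eLpNorm ρ 4 volume ≠ ∞)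
    {C : NNReal} (h : ∀ᵐ t, ρ t ≤ C * volterra (fun s => a s ^ (2 : ℝ) * ρ s) t) :
    ρ =ᵐ[volume] 0 := by
  lift eLpNorm a 4 volume to NNReal using haf with A hA
  -- This κ compensates the constant C and leaves at most the factor 1/2. The finite weighted norm
  -- of ρ can then be absorbed and must vanish.
  obtain ⟨c, H⟩ := exists_volterra_measure A (κ := (2 * (C + 1))⁻¹) (by positivity)
  obtain ⟨ν, hν, hν', hV⟩ := H a ha hA.ge
  have hfin : eLpNorm ρ 4 ν ≠ ∞ := ((eLpNorm_mono_measure _ hν).trans_lt hρf.lt_top).ne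
  have h1 : eLpNorm ρ 4 ν ≤ (1 / 2 : NNReal) * eLpNorm ρ 4 ν := by
    calc eLpNorm ρ 4 ν ≤ C * eLpNorm (volterra fun s => a s ^ (2 : ℝ) * ρ s) 4 ν := by
          rw [eLpNorm_four_le_iff, ← lintegral_const_mul' _ _ (by finiteness)]
          refine lintegral_mono_ae ?_
          filter_upwards [ae_mono hν h] with t ht
          simp only [enorm_eq_self]
          rw [← ENNReal.mul_rpow_of_nonneg _ _ (by norm_num)]
          gcongr
      _ ≤ C * (((2 * (C + 1))⁻¹ : NNReal) * eLpNorm ρ 4 ν) := by gcongr; exact hV ρ hρ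
      _ ≤ _ := by
          rw [← mul_assoc, ← ENNReal.coe_mul]
          gcongr
          rw [← div_eq_mul_inv, div_le_div_iff₀ (by positivity) (by positivity)]
          nlinarith [C.2]
  have h2 : eLpNorm ρ 4 ν = 0 := by
    lift eLpNorm ρ 4 ν to NNReal using hfin with x
    have : x ≤ 1 / 2 * x := by exact_mod_cast h1
    have h3 : (x : ℝ) ≤ 1 / 2 * x := by exact_mod_cast this
    have h4 : (x : ℝ) = 0 := le_antisymm (by linarith) x.2
    exact_mod_cast h4
  have h3 : eLpNorm ρ 4 volume = 0 := le_antisymm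
    ((eLpNorm_four_le_of_measure_le hν' ρ).trans (by rw [h2, mul_zero])) bot_le
  exact (eLpNorm_eq_zero_iff hρ.aestronglyMeasurable (by norm_num)).1 h3

/-! ### The cubic nonlinearity, mild solutions and perturbation theory -/

instance fact_one_le_four : Fact ((1 : ℝ≥0∞) ≤ 4) := ⟨by norm_num⟩

/-- The cubic nonlinearity `|v|² v`. -/
def cubic (v : ℝ →ᵇ ℂ) : ℝ →ᵇ ℂ := v * star v * v

theorem cubic_apply (v : ℝ →ᵇ ℂ) (y : ℝ) : cubic v y = ((‖v y‖ ^ 2 : ℝ) : ℂ) * v y := by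
  simp only [cubic, BoundedContinuousFunction.mul_apply, BoundedContinuousFunction.star_apply]
  congr 1
  rw [Complex.star_def, Complex.mul_conj, Complex.normSq_eq_norm_sq]

theorem continuous_cubic : Continuous cubic := by
  unfold cubic
  fun_prop

theorem nnnorm_cubic_le (v : ℝ →ᵇ ℂ) : ‖cubic v‖₊ ≤ ‖v‖₊ ^ 3 := by
  calc ‖v * star v * v‖₊ ≤ ‖v‖₊ * ‖star v‖₊ * ‖v‖₊ :=
        (nnnorm_mul_le _ _).trans (by gcongr; exact nnnorm_mul_le _ _)
    _ = _ := by rw [nnnorm_star]; ring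

theorem nnnorm_cubic_sub_le (v v' : ℝ →ᵇ ℂ) :
    ‖cubic v - cubic v'‖₊ ≤ 2 * (‖v‖₊ ^ 2 + ‖v'‖₊ ^ 2) * ‖v - v'‖₊ := by
  have e : cubic v - cubic v' = (v - v') * star v * v + v' * star (v - v') * v
      + v' * star v' * (v - v') := by
    simp only [cubic, star_sub]
    ring
  have h3 : ∀ x y z : ℝ →ᵇ ℂ, ‖x * star y * z‖₊ ≤ ‖x‖₊ * ‖y‖₊ * ‖z‖₊ := fun x y z => by
    refine (nnnorm_mul_le _ _).trans ?_
    gcongr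
    refine (nnnorm_mul_le _ _).trans ?_
    rw [nnnorm_star]
  rw [e]
  refine ((nnnorm_add_le _ _).trans (add_le_add ((nnnorm_add_le _ _).trans
    (add_le_add (h3 _ _ _) (h3 _ _ _))) (h3 _ _ _))).trans ?_
  have : ‖v‖₊ * ‖v‖₊ + ‖v'‖₊ * ‖v‖₊ + ‖v'‖₊ * ‖v'‖₊ ≤ 2 * (‖v‖₊ ^ 2 + ‖v'‖₊ ^ 2) := by
    have h : (‖v‖ : ℝ) * ‖v‖ + ‖v'‖ * ‖v‖ + ‖v'‖ * ‖v'‖ ≤ 2 * (‖v‖ ^ 2 + ‖v'‖ ^ 2) := by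
      nlinarith [sq_nonneg (‖v‖ - ‖v'‖), sq_nonneg ‖v‖, sq_nonneg ‖v'‖]
    exact_mod_cast h
  calc _ = (‖v‖₊ * ‖v‖₊ + ‖v'‖₊ * ‖v‖₊ + ‖v'‖₊ * ‖v'‖₊) * ‖v - v'‖₊ := by ring
    _ ≤ _ := by gcongr

theorem enorm_cubic_sub_le (v v' : ℝ →ᵇ ℂ) :
    ‖cubic v - cubic v'‖ₑ ≤ 2 * (‖v‖ₑ ^ (2 : ℝ) + ‖v'‖ₑ ^ (2 : ℝ)) * ‖v - v'‖ₑ := by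
  rw [show (2 : ℝ) = ((2 : ℕ) : ℝ) by norm_num]
  simp_rw [ENNReal.rpow_natCast, enorm_eq_nnnorm]
  exact_mod_cast nnnorm_cubic_sub_le v v'

theorem MeasureTheory.MemLp.cubic {μ : Measure ℝ} {u : ℝ → ℝ →ᵇ ℂ} (hu : MemLp u 4 μ) :
    MemLp (fun t => cubic (u t)) (4 / 3) μ := by
  refine ⟨continuous_cubic.comp_aestronglyMeasurable hu.1, ?_⟩
  rw [eLpNorm_lt_top_iff_lintegral_rpow_enorm_lt_top (by norm_num) (by finiteness)]
  have h := lintegral_rpow_enorm_lt_top_of_eLpNorm_lt_top (by norm_num) (by finiteness) hu.2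
  refine lt_of_le_of_lt (lintegral_mono fun t => ?_) h
  have h1 : ‖_root_.cubic (u t)‖ₑ ≤ ‖u t‖ₑ ^ (3 : ℝ) := by
    rw [show (3 : ℝ) = ((3 : ℕ) : ℝ) by norm_num, ENNReal.rpow_natCast]
    simp_rw [enorm_eq_nnnorm]
    exact_mod_cast nnnorm_cubic_le (u t)
  calc _ ≤ (‖u t‖ₑ ^ (3 : ℝ)) ^ (ENNReal.toReal (4 / 3)) := by gcongr
    _ = _ := by
      rw [← ENNReal.rpow_mul]
      norm_num

section Mild

variable {g : ℝ → ℝ} {ε : ℝ}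

/-- The integral equation `u = f - i D(|u|² u)`, at almost all times. -/
def IsMild (g : ℝ → ℝ) (ε : ℝ) (f u : ℝ → ℝ →ᵇ ℂ) : Prop :=
  ∀ᵐ t, u t = f t - Complex.I • duhRep g ε (fun s => cubic (u s)) t

theorem ae_enorm_duhRep_cubic_sub_le (hg : Integrable g) {u v : ℝ → ℝ →ᵇ ℂ}
    (hu : MemLp u 4 volume) (hv : MemLp v 4 volume) :
    ∀ᵐ t, ‖duhRep g ε (fun s => cubic (u s)) t - duhRep g ε (fun s => cubic (v s)) t‖ₑ ≤
      mass g * volterra (fun s => 2 * (‖u s‖ₑ ^ (2 : ℝ) + ‖v s‖ₑ ^ (2 : ℝ)) * ‖u s - v s‖ₑ) t := by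
  filter_upwards [ae_duhRep_sub (ε := ε) hg hu.cubic hv.cubic,
    ae_enorm_duhRep_le (ε := ε) hg (hu.cubic.sub hv.cubic)] with t h1 h2
  rw [← h1]
  refine h2.trans ?_
  gcongr
  exact volterra_mono (fun s => enorm_cubic_sub_le _ _) t

theorem memLp_duhRep (hg : Integrable g) {F : ℝ → ℝ →ᵇ ℂ} (hF : MemLp F (4 / 3) volume) :
    MemLp (duhRep g ε F) 4 volume := by
  refine ⟨aestronglyMeasurable_duhRep hg hF, ?_⟩
  rw [eLpNorm_lt_top_iff_lintegral_rpow_enorm_lt_top (by norm_num) (by finiteness)]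
  refine lt_of_le_of_lt (by simpa using lintegral_duhRep_le (ε := ε) hg hF) ?_
  have h1 := mass_ne_top hg
  have h2 : ∫⁻ s, ‖F s‖ₑ ^ (4 / 3 : ℝ) ≠ ∞ := by
    rw [lintegral_enorm_rpow_four_thirds]
    exact (ENNReal.rpow_lt_top_of_nonneg (by norm_num) hF.2.ne).ne
  have h3 : (∫⁻ s, ‖F s‖ₑ ^ (4 / 3 : ℝ)) ^ (3 : ℝ) ≠ ∞ :=
    (ENNReal.rpow_lt_top_of_nonneg (by norm_num) h2).ne
  finiteness

/-- Two solutions of the integral equation that agree outside of a time set agree, if the forcings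
coincide there. -/
theorem IsMild.ae_eq_on (hg : Integrable g) {u v f : ℝ → ℝ →ᵇ ℂ} {J : Set ℝ}
    (hJ : MeasurableSet J) (hu : MemLp u 4 volume) (hv : MemLp v 4 volume)
    (hout : ∀ t ∉ J, u t = v t)
    (hu' : ∀ᵐ t ∂(volume.restrict J), u t = f t - Complex.I • duhRep g ε (fun s => cubic (u s)) t)
    (hv' : ∀ᵐ t ∂(volume.restrict J), v t = f t - Complex.I • duhRep g ε (fun s => cubic (v s)) t) :
    u =ᵐ[volume] v := by
  set G : NNReal := (mass g).toNNReal with hGdef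
  have hG : mass g = G := (ENNReal.coe_toNNReal (mass_ne_top hg)).symm
  have hnu : MemLp (fun t => ‖u t‖) 4 volume := hu.norm
  have hnv : MemLp (fun t => ‖v t‖) 4 volume := hv.norm
  have hsum := hnu.add hnv
  have ha : AEMeasurable fun t => ‖u t‖ₑ + ‖v t‖ₑ := hu.1.enorm.add hv.1.enorm
  have hae : ∀ t, ‖u t‖ₑ + ‖v t‖ₑ = ‖‖u t‖ + ‖v t‖‖ₑ := fun t => by
    rw [Real.enorm_of_nonneg (by positivity), ENNReal.ofReal_add (by positivity) (by positivity),
      ofReal_norm, ofReal_norm]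
  have hafin : eLpNorm (fun t => ‖u t‖ₑ + ‖v t‖ₑ) 4 volume ≠ ∞ := by
    simp_rw [hae]
    rw [eLpNorm_enorm]
    exact hsum.2.ne
  -- Outside J the difference vanishes by assumption, so the Volterra inequality for its norm holds
  -- at almost all times, not only in J.
  have key := ae_eq_zero_of_le_volterra (ρ := fun t => ‖u t - v t‖ₑ) ha hafin (hu.sub hv).1.enorm
    (by rw [eLpNorm_enorm]; exact (hu.sub hv).2.ne) (C := G * 2) ?_
  · filter_upwards [key] with t ht
    simpa [sub_eq_zero] using ht
  · rw [ae_restrict_iff' hJ] at hu' hv'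
    filter_upwards [hu', hv', ae_enorm_duhRep_cubic_sub_le (ε := ε) hg hu hv] with t h1 h2 h3
    by_cases ht : t ∈ J
    · rw [h1 ht, h2 ht, sub_sub_sub_cancel_left, ← smul_sub, enorm_smul, ← enorm_neg (_ - _), neg_sub]
      simp only [enorm_eq_nnnorm, Complex.nnnorm_I, ENNReal.coe_one, one_mul]
      simp only [← enorm_eq_nnnorm]
      refine h3.trans ?_
      rw [hG, ENNReal.coe_mul, mul_assoc]
      gcongr
      rw [← volterra_const_mul (by finiteness)]
      refine volterra_mono (fun s => ?_) t
      rw [← mul_assoc]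
      gcongr
      · norm_num
      · exact ENNReal.add_rpow_le_rpow_add _ _ (by norm_num)
    · simp [hout t ht]

theorem eLpNorm_four_le_of_ae_le {E : Type*} [TopologicalSpace E] [ContinuousENorm E]
    {μ : Measure ℝ} {c : ℝ≥0∞} (hc : c ≠ ∞) {f : ℝ → E} {h : ℝ → ℝ≥0∞}
    (hf : ∀ᵐ t ∂μ, ‖f t‖ₑ ≤ c * h t) : eLpNorm f 4 μ ≤ c * eLpNorm h 4 μ := by
  rw [eLpNorm_four_le_iff, ← lintegral_const_mul' _ _ (by finiteness)]
  refine lintegral_mono_ae ?_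
  filter_upwards [hf] with t ht
  rw [← ENNReal.mul_rpow_of_nonneg _ _ (by norm_num)]
  gcongr
  simpa using ht

theorem enorm_add_sq_le {E : Type*} [NormedAddCommGroup E] (x y : E) :
    ‖x + y‖ₑ ^ (2 : ℝ) ≤ 2 * (‖x‖ₑ ^ (2 : ℝ) + ‖y‖ₑ ^ (2 : ℝ)) := by
  have := ENNReal.rpow_add_le_mul_rpow_add_rpow ‖x‖ₑ ‖y‖ₑ (p := 2) (by norm_num)
  rw [show (2 - 1 : ℝ) = 1 by norm_num, ENNReal.rpow_one] at this
  refine le_trans ?_ this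
  gcongr
  exact enorm_add_le _ _

/-- The Lipschitz factor is split into |u|² and the squares of the corrections. The first is large
but gains κ in the weighted norm. The others are estimated in the unweighted norm, which costs the
comparison constant C but leaves them quadratically small. -/
theorem eLpNorm_duhRep_cubic_sub_le (hg : Integrable g) {ν : Measure ℝ} (hν : ν ≤ volume)
    {κ C : ℝ≥0∞} (hC : ∀ b : ℝ → ℝ≥0∞, eLpNorm b 4 volume ≤ C * eLpNorm b 4 ν)
    {u r r' : ℝ → ℝ →ᵇ ℂ} (hu : MemLp u 4 volume) (hr : MemLp r 4 volume) (hr' : MemLp r' 4 volume)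
    (hV : ∀ b : ℝ → ℝ≥0∞, AEMeasurable b →
      eLpNorm (volterra fun s => ‖u s‖ₑ ^ (2 : ℝ) * b s) 4 ν ≤ κ * eLpNorm b 4 ν) :
    eLpNorm (fun t => duhRep g ε (fun s => cubic (u s + r s)) t
        - duhRep g ε (fun s => cubic (u s + r' s)) t) 4 ν ≤
      mass g * (8 * κ + 48 * C * (eLpNorm r 4 volume ^ (2 : ℝ) + eLpNorm r' 4 volume ^ (2 : ℝ)))
        * eLpNorm (fun t => r t - r' t) 4 ν := by
  have hG := mass_ne_top hg
  set ρ : ℝ → ℝ≥0∞ := fun s => ‖r s - r' s‖ₑ with hρ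
  have hρm : AEMeasurable ρ := (hr.sub hr').1.enorm
  set V : (ℝ → ℝ →ᵇ ℂ) → ℝ → ℝ≥0∞ := fun p => volterra fun s => ‖p s‖ₑ ^ (2 : ℝ) * ρ s with hVdef
  have hVm : ∀ {p : ℝ → ℝ →ᵇ ℂ}, MemLp p 4 volume →
      AEMeasurable (fun s => ‖p s‖ₑ ^ (2 : ℝ) * ρ s) := fun hp => (hp.1.enorm.pow_const _).mul hρm
  have hVm' : ∀ {p : ℝ → ℝ →ᵇ ℂ}, MemLp p 4 volume → ∀ c : ℝ≥0∞,
      AEStronglyMeasurable (fun t => c * V p t) ν := fun hp c =>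
    ((measurable_volterra (hVm hp)).const_mul c).aestronglyMeasurable
  have hb : ∀ p : ℝ → ℝ →ᵇ ℂ, MemLp p 4 volume →
      eLpNorm (V p) 4 ν ≤ 12 * C * eLpNorm p 4 volume ^ (2 : ℝ) * eLpNorm ρ 4 ν := fun p hp => by
    have h1 := eLpNorm_volterra_sq_mul_le hp.1.enorm hρm
    rw [eLpNorm_enorm] at h1
    calc _ ≤ _ := eLpNorm_mono_measure _ hν
      _ ≤ _ := h1
      _ ≤ 12 * eLpNorm p 4 volume ^ (2 : ℝ) * (C * eLpNorm ρ 4 ν) := by gcongr; exact hC ρ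
      _ = _ := by ring
  have hρn : eLpNorm (fun t => r t - r' t) 4 ν = eLpNorm ρ 4 ν := (eLpNorm_enorm _).symm
  rw [hρn]
  calc _ ≤ mass g * eLpNorm (fun t => 8 * V u t + (4 * V r t + 4 * V r' t)) 4 ν := by
        refine eLpNorm_four_le_of_ae_le hG ?_
        filter_upwards [ae_mono hν (ae_enorm_duhRep_cubic_sub_le (ε := ε) hg (hu.add hr)
          (hu.add hr'))] with t ht
        refine ht.trans ?_
        gcongr
        simp only [hVdef]
        rw [← volterra_const_mul (by norm_num), ← volterra_const_mul (by norm_num),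
          ← volterra_const_mul (by norm_num), ← volterra_add ((hVm hr).const_mul _),
          ← volterra_add ((hVm hu).const_mul _)]
        refine volterra_mono (fun s => ?_) t
        simp only [Pi.add_apply, add_sub_add_left_eq_sub]
        calc _ ≤ 2 * (2 * (‖u s‖ₑ ^ (2 : ℝ) + ‖r s‖ₑ ^ (2 : ℝ))
              + 2 * (‖u s‖ₑ ^ (2 : ℝ) + ‖r' s‖ₑ ^ (2 : ℝ))) * ρ s := by
              gcongr
              · exact enorm_add_sq_le _ _
              · exact enorm_add_sq_le _ _
          _ = _ := by ring
    _ ≤ mass g * (8 * eLpNorm (V u) 4 ν + (4 * eLpNorm (V r) 4 ν + 4 * eLpNorm (V r') 4 ν)) := by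
        gcongr
        refine (eLpNorm_add_le (hVm' hu 8) ((hVm' hr 4).add (hVm' hr' 4)) (by norm_num)).trans
          (add_le_add ?_ ((eLpNorm_add_le (hVm' hr 4) (hVm' hr' 4) (by norm_num)).trans
            (add_le_add ?_ ?_))) <;>
        exact eLpNorm_four_le_of_ae_le (by norm_num) (ae_of_all _ fun t => le_rfl)
    _ ≤ mass g * (8 * (κ * eLpNorm ρ 4 ν)
          + (4 * (12 * C * eLpNorm r 4 volume ^ (2 : ℝ) * eLpNorm ρ 4 ν)
          + 4 * (12 * C * eLpNorm r' 4 volume ^ (2 : ℝ) * eLpNorm ρ 4 ν))) := by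
        gcongr
        · exact hV ρ hρm
        · exact hb r hr
        · exact hb r' hr'
    _ = _ := by ring

/-- The correction solves r = h - i(D(u + r) - D(u)), where D is the Duhamel integral of the cubic
term. This is a contraction on a small ball of the weighted L⁴ space. Neither the size of the ball
nor the constants depend on ε, nor on `u` beyond its norm bound. -/
theorem exists_perturbation (hg : Integrable g) (A : NNReal) : ∃ δ : NNReal, 0 < δ ∧
    ∃ C : NNReal, ∀ (ε : ℝ) (u f h : ℝ → ℝ →ᵇ ℂ), MemLp u 4 volume → eLpNorm u 4 volume ≤ A →
      MemLp h 4 volume → eLpNorm h 4 volume ≤ δ → IsMild g ε f u →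
        ∃ r, MemLp r 4 volume ∧ IsMild g ε (f + h) (u + r) ∧
          eLpNorm r 4 volume ≤ C * eLpNorm h 4 volume := by
  set G : NNReal := (mass g).toNNReal with hGdef
  have hG : mass g = G := (ENNReal.coe_toNNReal (mass_ne_top hg)).symm
  -- Chosen so that the linear part 8Gκ of the Lipschitz constant is at most 1/4.
  set κ : NNReal := (32 * (G + 1))⁻¹ with hκ
  obtain ⟨C₀, H⟩ := exists_volterra_measure A (κ := κ) (by positivity)
  set C : NNReal := C₀ ^ (1 / 4 : ℝ) with hCdef
  -- The quadratic part of the Lipschitz constant is 96 G C³ R², which this radius makes at most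
  -- 96/400 ≤ 1/4. Half of R remains available for the perturbation h.
  set R : NNReal := (400 * (G + 1) * (C + 1) ^ 3)⁻¹ with hR
  have hRpos : 0 < R := by positivity
  refine ⟨R / 2, by positivity, 2 * C, fun ε u f h hu huA hh hhδ hmild => ?_⟩
  obtain ⟨ν, hν, hν', hV⟩ := H (fun s => ‖u s‖ₑ) hu.1.enorm (by rwa [eLpNorm_enorm])
  have hvol : ∀ {r : ℝ → ℝ →ᵇ ℂ}, MemLp r 4 ν → MemLp r 4 volume := fun hr =>
    hr.of_measure_le_smul (by finiteness) hν'
  have hC : ∀ {E : Type} [TopologicalSpace E] [ContinuousENorm E] (b : ℝ → E),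
    eLpNorm b 4 volume ≤ C * eLpNorm b 4 ν := fun b => eLpNorm_four_le_of_measure_le hν' b
  have hac : volume ≪ ν := (Measure.absolutelyContinuous_of_le hν').trans
    Measure.smul_absolutelyContinuous
  set D : (ℝ → ℝ →ᵇ ℂ) → ℝ → ℝ →ᵇ ℂ := fun r => duhRep g ε (fun s => cubic (u s + r s)) with hD
  have hDm : ∀ {r : ℝ → ℝ →ᵇ ℂ}, MemLp r 4 ν → MemLp (D r) 4 volume := fun {r} hr =>
    memLp_duhRep hg (MemLp.cubic (u := u + r) (hu.add (hvol hr)))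
  have h0 : MemLp (0 : ℝ → ℝ →ᵇ ℂ) 4 ν := MemLp.zero
  have hΦm : ∀ r : Lp (ℝ →ᵇ ℂ) 4 ν, MemLp (h - Complex.I • (D r - D 0)) 4 ν := fun r =>
    (hh.sub (((hDm (Lp.memLp r)).sub (hDm h0)).const_smul _)).mono_measure hν
  set Φ : Lp (ℝ →ᵇ ℂ) 4 ν → Lp (ℝ →ᵇ ℂ) 4 ν := fun r => (hΦm r).toLp _ with hΦ
  have hnum : G * (8 * κ + 48 * C * ((C * R) ^ 2 + (C * R) ^ 2)) ≤ 1 / 2 := by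
    have h1 : G * (8 * κ) ≤ 1 / 4 := by
      rw [hκ, ← div_eq_mul_inv, ← mul_div_assoc, div_le_div_iff₀ (by positivity) (by positivity)]
      nlinarith [G.2]
    have h2 : G * (48 * C * ((C * R) ^ 2 + (C * R) ^ 2)) ≤ 1 / 4 := by
      have h3 : R * (400 * (G + 1) * (C + 1) ^ 3) = 1 := inv_mul_cancel₀ (by positivity)
      have h4 : R ≤ 1 := by
        refine inv_le_one_of_one_le₀ ?_
        have : 1 ≤ (C + 1) ^ 3 := one_le_pow₀ le_add_self
        calc (1 : NNReal) ≤ 400 * (0 + 1) * 1 := by norm_num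
          _ ≤ _ := by gcongr; exact bot_le
      calc G * (48 * C * ((C * R) ^ 2 + (C * R) ^ 2)) = 96 * (R * (G * C ^ 3)) * R := by ring
        _ ≤ 96 * (R * ((G + 1) * (C + 1) ^ 3)) * 1 := by
            gcongr
            · exact le_self_add
            · exact le_self_add
        _ = 96 / 400 * (R * (400 * (G + 1) * (C + 1) ^ 3)) := by ring
        _ ≤ _ := by rw [h3, mul_one, div_le_div_iff₀ (by norm_num) (by norm_num)]; norm_num
    calc _ = G * (8 * κ) + G * (48 * C * ((C * R) ^ 2 + (C * R) ^ 2)) := by ring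
      _ ≤ 1 / 4 + 1 / 4 := add_le_add h1 h2
      _ = _ := by norm_num
  have hlip : ∀ r r' : Lp (ℝ →ᵇ ℂ) 4 ν, ‖r‖ₑ ≤ R → ‖r'‖ₑ ≤ R →
      ‖Φ r - Φ r'‖ₑ ≤ (1 / 2 : NNReal) * ‖r - r'‖ₑ := by
    intro r r' hr hr'
    have hvr : ∀ {r : Lp (ℝ →ᵇ ℂ) 4 ν}, ‖r‖ₑ ≤ R → eLpNorm r 4 volume ≤ C * R := fun hr =>
      (hC _).trans (by gcongr; rwa [← Lp.enorm_def])
    have h1 := eLpNorm_duhRep_cubic_sub_le (ε := ε) hg hν (hC (E := ℝ≥0∞)) hu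
      (hvol (Lp.memLp r)) (hvol (Lp.memLp r')) hV
    rw [Lp.enorm_def, Lp.enorm_def]
    calc eLpNorm (Φ r - Φ r' : Lp (ℝ →ᵇ ℂ) 4 ν) 4 ν = eLpNorm (fun t => D r t - D r' t) 4 ν := by
          refine eLpNorm_congr_norm_ae ?_
          filter_upwards [Lp.coeFn_sub (Φ r) (Φ r'), (hΦm r).coeFn_toLp, (hΦm r').coeFn_toLp]
            with t e1 e2 e3
          rw [e1, Pi.sub_apply, hΦ, e2, e3]
          simp only [Pi.sub_apply, Pi.smul_apply]
          rw [sub_sub_sub_cancel_left, ← smul_sub, sub_sub_sub_cancel_right, norm_smul,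
            Complex.norm_I, one_mul, norm_sub_rev]
      _ ≤ _ := h1
      _ ≤ (G * (8 * κ + 48 * C * ((C * R) ^ (2 : ℝ) + (C * R) ^ (2 : ℝ))))
            * eLpNorm (fun t => r t - r' t) 4 ν := by
          rw [hG]
          gcongr
          · exact hvr hr
          · exact hvr hr'
      _ ≤ _ := by
          have e : eLpNorm (fun t => r t - r' t) 4 ν = eLpNorm (r - r' : Lp (ℝ →ᵇ ℂ) 4 ν) 4 ν :=
            eLpNorm_congr_ae (Lp.coeFn_sub r r').symm
          rw [e]
          gcongr
          rw [show (2 : ℝ) = ((2 : ℕ) : ℝ) by norm_num]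
          simp_rw [ENNReal.rpow_natCast]
          exact_mod_cast hnum
  have hΦ0 : ‖Φ 0‖ₑ ≤ eLpNorm h 4 volume := by
    rw [Lp.enorm_def]
    refine le_trans (le_of_eq (eLpNorm_congr_ae ?_)) (eLpNorm_mono_measure _ hν)
    have e0 : D (0 : Lp (ℝ →ᵇ ℂ) 4 ν) = D 0 := by
      funext t
      refine duhRep_congr (ae_restrict_of_ae (hac.ae_le ?_))
      filter_upwards [Lp.coeFn_zero (ℝ →ᵇ ℂ) 4 ν] with s hs
      rw [hs]
    filter_upwards [(hΦm 0).coeFn_toLp] with t ht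
    rw [hΦ, ht, e0]
    simp
  have hhalf : ((1 / 2 : NNReal) : ℝ≥0∞) * R + ((R / 2 : NNReal) : ℝ≥0∞) = R := by
    rw [← ENNReal.coe_mul, ← ENNReal.coe_add]
    congr 1
    rw [div_mul_eq_mul_div, one_mul]
    exact add_halves R
  set s : Set (Lp (ℝ →ᵇ ℂ) 4 ν) := {r | ‖r‖ₑ ≤ R} with hs
  have hmaps : MapsTo Φ s s := fun r hr => by
    have h1 := hlip r 0 hr (by simp)
    rw [sub_zero] at h1
    calc ‖Φ r‖ₑ = ‖(Φ r - Φ 0) + Φ 0‖ₑ := by rw [sub_add_cancel]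
      _ ≤ ‖Φ r - Φ 0‖ₑ + ‖Φ 0‖ₑ := enorm_add_le _ _
      _ ≤ (1 / 2 : NNReal) * R + ((R / 2 : NNReal) : ℝ≥0∞) := by
          gcongr
          · exact h1.trans (by gcongr; exact hr)
          · exact hΦ0.trans hhδ
      _ = R := hhalf
  have hclosed : IsClosed s := isClosed_le continuous_enorm continuous_const
  have hcontr : ContractingWith (1 / 2) (hmaps.restrict Φ s s) := by
    refine ⟨by norm_num, fun x y => ?_⟩
    rw [Subtype.edist_eq, Subtype.edist_eq, edist_eq_enorm_sub, edist_eq_enorm_sub]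
    exact hlip x y x.2 y.2
  obtain ⟨r, hrs, hfix, -⟩ := hcontr.exists_fixedPoint' hclosed.isComplete hmaps
    (x := 0) (by simp [hs]) (by rw [edist_eq_enorm_sub]; finiteness)
  have hfix : Φ r = r := hfix
  refine ⟨r, hvol (Lp.memLp r), ?_, ?_⟩
  · have hae : ∀ᵐ t, r t = (h - Complex.I • (D r - D 0)) t := by
      refine hac.ae_le ?_
      have := (hΦm r).coeFn_toLp
      filter_upwards [this] with t ht
      rw [← ht]
      exact congrArg (fun q : Lp (ℝ →ᵇ ℂ) 4 ν => q t) hfix.symm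
    filter_upwards [hae, hmild] with t h1 h2
    have e0 : D 0 t = duhRep g ε (fun s => cubic (u s)) t := by simp [hD]
    have e1 : D r t = duhRep g ε (fun s => cubic ((u + r) s)) t := rfl
    rw [Pi.add_apply, Pi.add_apply, h1, h2, ← e1, ← e0]
    simp only [Pi.sub_apply, Pi.smul_apply, smul_sub]
    abel
  -- Comparing the fixed point with the image of zero makes r bounded linearly by h, with the factor
  -- 2 from absorbing one half of the norm.
  · have h1 : ‖r‖ₑ ≤ (1 / 2 : NNReal) * ‖r‖ₑ + eLpNorm h 4 volume := by
      have h2 := hlip r 0 hrs (by simp)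
      rw [sub_zero, hfix] at h2
      calc ‖r‖ₑ = ‖(r - Φ 0) + Φ 0‖ₑ := by rw [sub_add_cancel]
        _ ≤ ‖r - Φ 0‖ₑ + ‖Φ 0‖ₑ := enorm_add_le _ _
        _ ≤ _ := add_le_add h2 hΦ0
    have h3 : ‖r‖ₑ ≤ 2 * eLpNorm h 4 volume := by
      lift eLpNorm h 4 volume to NNReal using hh.2.ne with x
      rw [enorm_eq_nnnorm] at h1 ⊢
      have h4 : ‖r‖₊ ≤ 1 / 2 * ‖r‖₊ + x := by exact_mod_cast h1
      have h5 : (‖r‖₊ : ℝ) ≤ 1 / 2 * ‖r‖₊ + x := by exact_mod_cast h4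
      have h6 : (‖r‖₊ : ℝ) ≤ 2 * x := by linarith
      exact_mod_cast h6
    calc _ ≤ C * eLpNorm r 4 ν := hC _
      _ ≤ C * (2 * eLpNorm h 4 volume) := by rw [← Lp.enorm_def]; gcongr
      _ = _ := by push_cast; ring

end Mild

/-! ### Positivity of the causal Schrödinger form -/

/-- The kernel of the free Schrödinger propagator on the diagonal; it vanishes at `0`. -/
def schrodKernel (τ : ℝ) : ℂ := (Real.pi / (4 * Real.pi ^ 2 * τ * Complex.I)) ^ (1 / 2 : ℂ)

theorem schrodKernel_zero : schrodKernel 0 = 0 := by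
  simp [schrodKernel]

theorem schrodKernel_of_pos {τ : ℝ} (hτ : 0 < τ) : schrodKernel τ =
    Complex.exp ((Real.log (4 * Real.pi * τ)⁻¹ / 2 : ℝ)) * Complex.exp (-(Real.pi / 4 : ℝ) * Complex.I) := by
  have ha : 0 < (4 * Real.pi * τ)⁻¹ := by positivity
  have e : (Real.pi / (4 * Real.pi ^ 2 * τ * Complex.I) : ℂ)
      = (((4 * Real.pi * τ)⁻¹ : ℝ) : ℂ) * -Complex.I := by
    have : (τ : ℂ) ≠ 0 := by exact_mod_cast hτ.ne'
    have hpi : (Real.pi : ℂ) ≠ 0 := by exact_mod_cast Real.pi_ne_zero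
    push_cast
    field_simp
    rw [Complex.I_sq, neg_neg]
  have hI : -Complex.I ≠ 0 := neg_ne_zero.2 Complex.I_ne_zero
  rw [schrodKernel, e, Complex.cpow_def_of_ne_zero (mul_ne_zero (by exact_mod_cast ha.ne') hI),
    Complex.log_ofReal_mul ha hI, Complex.log_neg_I, ← Complex.exp_add]
  congr 1
  push_cast
  ring

theorem schrodKernel_neg_of_pos {τ : ℝ} (hτ : 0 < τ) : schrodKernel (-τ) =
    Complex.exp ((Real.log (4 * Real.pi * τ)⁻¹ / 2 : ℝ)) * Complex.exp ((Real.pi / 4 : ℝ) * Complex.I) := by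
  have ha : 0 < (4 * Real.pi * τ)⁻¹ := by positivity
  have e : (Real.pi / (4 * Real.pi ^ 2 * ((-τ : ℝ) : ℂ) * Complex.I) : ℂ)
      = (((4 * Real.pi * τ)⁻¹ : ℝ) : ℂ) * Complex.I := by
    have : (τ : ℂ) ≠ 0 := by exact_mod_cast hτ.ne'
    have hpi : (Real.pi : ℂ) ≠ 0 := by exact_mod_cast Real.pi_ne_zero
    push_cast
    field_simp
    rw [Complex.I_sq]
  rw [schrodKernel, e,
    Complex.cpow_def_of_ne_zero (mul_ne_zero (by exact_mod_cast ha.ne') Complex.I_ne_zero),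
    Complex.log_ofReal_mul ha Complex.I_ne_zero, Complex.log_I, ← Complex.exp_add]
  congr 1
  push_cast
  ring

/-- Reversing time conjugates the phase e^{-iπ/4}. This Hermitian symmetry relates the causal half
of the quadratic form to the full one. -/
theorem schrodKernel_neg (τ : ℝ) : schrodKernel (-τ) = (starRingEnd ℂ) (schrodKernel τ) := by
  have key : ∀ τ : ℝ, 0 < τ → schrodKernel (-τ) = (starRingEnd ℂ) (schrodKernel τ) := fun τ hτ => by
    rw [schrodKernel_neg_of_pos hτ, schrodKernel_of_pos hτ, map_mul, ← Complex.exp_conj,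
      ← Complex.exp_conj, Complex.conj_ofReal, map_mul, map_neg, Complex.conj_ofReal,
      Complex.conj_I]
    ring_nf
  rcases lt_trichotomy τ 0 with h | rfl | h
  · have := key (-τ) (by linarith)
    rw [neg_neg] at this
    rw [this, Complex.conj_conj]
  · simp [schrodKernel_zero]
  · exact key τ h

/-- Multiplication by i turns the phase e^{-iπ/4} into e^{iπ/4}. The factor i of the equation thus
reverses the time argument of the Duhamel kernel, and real parts acquire a sign. -/
theorem I_mul_schrodKernel {τ : ℝ} (hτ : 0 ≤ τ) :
    Complex.I * schrodKernel τ = schrodKernel (-τ) := by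
  rcases hτ.eq_or_lt with rfl | hτ
  · simp [schrodKernel_zero]
  · have : Complex.I = Complex.exp ((Real.pi / 2 : ℝ) * Complex.I) := by
      push_cast; exact Complex.exp_pi_div_two_mul_I.symm
    rw [schrodKernel_neg_of_pos hτ, schrodKernel_of_pos hτ, mul_left_comm]
    nth_rewrite 1 [this]
    rw [← Complex.exp_add]
    congr 2
    push_cast
    ring

theorem tendsto_integral_wave {τ : ℝ} (hτ : τ ≠ 0) :
    Tendsto (fun n => ∫ ξ, wave (dampRate n) τ 0 ξ) atTop (𝓝 (schrodKernel τ)) := by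
  have e : ∀ n, ∫ ξ, wave (dampRate n) τ 0 ξ
      = (Real.pi / (dampRate n + 4 * Real.pi ^ 2 * τ * Complex.I)) ^ (1 / 2 : ℂ) := fun n => by
    rw [integral_wave (dampRate_pos n)]
    simp
  simp_rw [e]
  have h0 : (4 * Real.pi ^ 2 * τ * Complex.I : ℂ) ≠ 0 := by
    have : (τ : ℂ) ≠ 0 := by exact_mod_cast hτ
    have hpi : (Real.pi : ℂ) ≠ 0 := by exact_mod_cast Real.pi_ne_zero
    simp [this, hpi]
  have h1 : Tendsto (fun n => (dampRate n : ℂ) + 4 * Real.pi ^ 2 * τ * Complex.I) atTop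
      (𝓝 (4 * Real.pi ^ 2 * τ * Complex.I)) := by
    have := (Complex.continuous_ofReal.tendsto 0).comp tendsto_dampRate
    simpa using this.add_const (4 * Real.pi ^ 2 * τ * Complex.I)
  refine (continuousAt_cpow_const ?_).tendsto.comp (tendsto_const_nhds.div h1 h0)
  refine Complex.mem_slitPlane_iff.2 (Or.inr ?_)
  have e2 : (Real.pi / (4 * Real.pi ^ 2 * τ * Complex.I) : ℂ)
      = ((-(4 * Real.pi * τ)⁻¹ : ℝ) : ℂ) * Complex.I := by
    have : (τ : ℂ) ≠ 0 := by exact_mod_cast hτ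
    have hpi : (Real.pi : ℂ) ≠ 0 := by exact_mod_cast Real.pi_ne_zero
    push_cast
    field_simp
    rw [Complex.I_sq, neg_neg]
  rw [e2, Complex.im_ofReal_mul]
  simp [hτ, Real.pi_ne_zero]

theorem enorm_schrodKernel_le (τ : ℝ) : ‖schrodKernel τ‖ₑ ≤ dispKernel τ := by
  rcases eq_or_ne τ 0 with rfl | hτ
  · simp [schrodKernel_zero]
  · exact le_of_tendsto (tendsto_integral_wave hτ).enorm
      (Eventually.of_forall fun n => enorm_integral_wave_le (dampRate_pos n) _ _)

theorem measurable_schrodKernel : Measurable schrodKernel := by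
  unfold schrodKernel
  fun_prop

section Positivity

variable {φ : ℝ → ℂ}

/-- The integrand of the quadratic form associated with `schrodKernel`. -/
def kernelForm (φ : ℝ → ℂ) (p : ℝ × ℝ) : ℂ :=
  (starRingEnd ℂ) (φ p.1) * φ p.2 * schrodKernel (p.2 - p.1)

theorem aestronglyMeasurable_kernelForm (hφ : AEStronglyMeasurable φ volume) :
    AEStronglyMeasurable (kernelForm φ) (volume.prod volume) :=
  ((Complex.continuous_conj.comp_aestronglyMeasurable hφ.comp_fst).mul hφ.comp_snd).mul
    (measurable_schrodKernel.comp (by fun_prop)).aestronglyMeasurable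

theorem enorm_kernelForm_le (p : ℝ × ℝ) :
    ‖kernelForm φ p‖ₑ ≤ ‖φ p.1‖ₑ * (dispKernel (p.1 - p.2) * ‖φ p.2‖ₑ) := by
  rw [kernelForm, enorm_mul, enorm_mul, RCLike.enorm_conj, dispKernel_sub_comm, mul_assoc,
    mul_comm ‖φ p.2‖ₑ]
  gcongr
  exact enorm_schrodKernel_le _

theorem lintegral_prod_fracInt {f : ℝ → ℝ≥0∞} (hf : AEMeasurable f) :
    ∫⁻ p : ℝ × ℝ, f p.1 * (dispKernel (p.1 - p.2) * f p.2) ∂(volume.prod volume) =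
      ∫⁻ t, f t * fracInt f t := by
  have hm : AEMeasurable (fun p : ℝ × ℝ => f p.1 * (dispKernel (p.1 - p.2) * f p.2))
      (volume.prod volume) := hf.comp_fst.mul
    ((measurable_dispKernel.comp (by fun_prop)).aemeasurable.mul hf.comp_snd)
  rw [lintegral_prod _ hm]
  refine lintegral_congr_ae ?_
  filter_upwards with t
  rw [fracInt, lintegral_const_mul'']
  exact (measurable_dispKernel.comp (by fun_prop)).aemeasurable.mul hf

theorem lintegral_enorm_fracInt_lt_top (hφ : MemLp φ (4 / 3) volume) :
    ∫⁻ t, ‖φ t‖ₑ * fracInt (fun s => ‖φ s‖ₑ) t < ∞ := by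
  refine (lintegral_mul_fracInt_self_le_of_aemeasurable hφ.1.enorm).trans_lt ?_
  rw [lintegral_enorm_rpow_four_thirds, ← ENNReal.rpow_mul]
  exact ENNReal.mul_lt_top (by finiteness) (ENNReal.rpow_lt_top_of_nonneg (by norm_num) hφ.2.ne)

theorem integrable_kernelForm (hφ : MemLp φ (4 / 3) volume) :
    Integrable (kernelForm φ) (volume.prod volume) :=
  ⟨aestronglyMeasurable_kernelForm hφ.1, (lintegral_mono enorm_kernelForm_le).trans_lt (by
    rw [lintegral_prod_fracInt hφ.1.enorm]; exact lintegral_enorm_fracInt_lt_top hφ)⟩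

/-- With damping, Fubini turns the double time integral into a Gaussian-weighted frequency integral
of |∫ φ(s) e^{-4π²isξ²} ds|². -/
theorem integral_regularized_kernelForm_nonneg {r : ℝ} (hr : 0 < r) (hφ : Integrable φ) :
    0 ≤ (∫ p : ℝ × ℝ, (starRingEnd ℂ) (φ p.1) * φ p.2 * (∫ ξ, wave r (p.2 - p.1) 0 ξ)
      ∂(volume.prod volume)).re := by
  have hconj : Integrable fun t => (starRingEnd ℂ) (φ t) := Complex.conjCLE.integrable_comp_iff.2 hφ
  have hfub : Integrable (fun q : (ℝ × ℝ) × ℝ => ((starRingEnd ℂ) (φ q.1.1) * φ q.1.2)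
      * wave r (q.1.2 - q.1.1) 0 q.2) ((volume.prod volume).prod volume) := by
    have h1 := (hconj.mul_prod hφ).mul_prod (integrable_wave hr 0 0)
    refine (h1.mul_bdd (c := 1) (g := fun q : (ℝ × ℝ) × ℝ => wave 0 (q.1.2 - q.1.1) 0 q.2)
      ?_ (ae_of_all _ fun q => norm_wave_le_one le_rfl _ _ _)).congr (ae_of_all _ fun q => ?_)
    · exact (Continuous.wave (by fun_prop) (by fun_prop) (by fun_prop)
        (by fun_prop)).aestronglyMeasurable
    · simp only
      rw [mul_assoc, wave_mul_wave]
      simp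
  have e : ∫ p : ℝ × ℝ, (starRingEnd ℂ) (φ p.1) * φ p.2 * (∫ ξ, wave r (p.2 - p.1) 0 ξ)
      ∂(volume.prod volume) = ∫ ξ, ((Real.exp (-(r * ξ ^ 2))
        * ‖∫ s, φ s * wave 0 s 0 ξ‖ ^ 2 : ℝ) : ℂ) := by
    calc _ = ∫ p : ℝ × ℝ, ∫ ξ, ((starRingEnd ℂ) (φ p.1) * φ p.2) * wave r (p.2 - p.1) 0 ξ
          ∂volume ∂(volume.prod volume) := by
          simp_rw [integral_const_mul]
      _ = ∫ ξ, ∫ p : ℝ × ℝ, ((starRingEnd ℂ) (φ p.1) * φ p.2) * wave r (p.2 - p.1) 0 ξ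
          ∂(volume.prod volume) := integral_integral_swap hfub
      _ = _ := by
          refine integral_congr_ae (ae_of_all _ fun ξ => ?_)
          have e1 : ∀ p : ℝ × ℝ, (starRingEnd ℂ) (φ p.1) * φ p.2 * wave r (p.2 - p.1) 0 ξ
              = wave r 0 0 ξ * ((starRingEnd ℂ) (φ p.1 * wave 0 p.1 0 ξ)
                * (φ p.2 * wave 0 p.2 0 ξ)) := fun p => by
            have h2 : wave r (p.2 - p.1) 0 ξ
                = wave r 0 0 ξ * (wave 0 (-p.1) (-0) ξ * wave 0 p.2 0 ξ) := by
              rw [wave_mul_wave, wave_mul_wave]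
              simp [add_comm, sub_eq_add_neg]
            rw [h2, ← conj_wave, map_mul]
            ring
          simp only [e1]
          rw [integral_const_mul, integral_prod_mul (f := fun s => (starRingEnd ℂ)
            (φ s * wave 0 s 0 ξ)) (g := fun s => φ s * wave 0 s 0 ξ), integral_conj,
            ← Complex.normSq_eq_conj_mul_self, Complex.normSq_eq_norm_sq]
          have e3 : wave r 0 0 ξ = (Real.exp (-(r * ξ ^ 2)) : ℂ) := by
            simp [wave]
          rw [e3]
          push_cast
          rfl
  rw [e, integral_complex_ofReal, Complex.ofReal_re]
  exact integral_nonneg fun ξ => by positivity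

theorem integral_kernelForm_nonneg (hφ : MemLp φ (4 / 3) volume) :
    0 ≤ (∫ p, kernelForm φ p ∂(volume.prod volume)).re := by
  -- Time truncation makes φ integrable and is removed together with the damping, along the same
  -- index. The majorant with kernel |t-s|^{-1/2} is integrable by Hardy–Littlewood–Sobolev.
  set φn : ℕ → ℝ → ℂ := fun n => (Ioc (-(n : ℝ)) n).indicator φ with hφn
  have hφni : ∀ n, Integrable (φn n) := fun n => by
    have : IsFiniteMeasure (volume.restrict (Ioc (-(n : ℝ)) n)) := ⟨by simp⟩
    exact (integrable_indicator_iff measurableSet_Ioc).2 ((hφ.restrict _).integrable Fact.out)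
  have hle : ∀ n s, ‖φn n s‖ₑ ≤ ‖φ s‖ₑ := fun n s => by
    simp only [hφn]
    by_cases hs : s ∈ Ioc (-(n : ℝ)) n <;> simp [hs]
  have hwm : ∀ n, Measurable fun p : ℝ × ℝ => ∫ ξ, wave (dampRate n) (p.2 - p.1) 0 ξ := fun n => by
    have : StronglyMeasurable fun q : (ℝ × ℝ) × ℝ => wave (dampRate n) (q.1.2 - q.1.1) 0 q.2 :=
      (Continuous.wave (by fun_prop) (by fun_prop) (by fun_prop)
        (by fun_prop)).stronglyMeasurable
    exact this.integral_prod_right.measurable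
  set bd : ℝ × ℝ → ℝ≥0∞ := fun p => ‖φ p.1‖ₑ * (dispKernel (p.1 - p.2) * ‖φ p.2‖ₑ) with hbd
  have hbdm : AEMeasurable bd (volume.prod volume) := hφ.1.enorm.comp_fst.mul
    ((measurable_dispKernel.comp (by fun_prop)).aemeasurable.mul hφ.1.enorm.comp_snd)
  have hbdi : ∫⁻ p, bd p ∂(volume.prod volume) ≠ ∞ := by
    rw [hbd, lintegral_prod_fracInt hφ.1.enorm]
    exact (lintegral_enorm_fracInt_lt_top hφ).ne
  have hlim : Tendsto (fun n => ∫ p : ℝ × ℝ, (starRingEnd ℂ) (φn n p.1) * φn n p.2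
      * (∫ ξ, wave (dampRate n) (p.2 - p.1) 0 ξ) ∂(volume.prod volume)) atTop
      (𝓝 (∫ p, kernelForm φ p ∂(volume.prod volume))) := by
    refine tendsto_integral_of_dominated_convergence (fun p => (bd p).toReal) (fun n => ?_)
      (integrable_toReal_of_lintegral_ne_top hbdm hbdi) (fun n => ?_) ?_
    · exact ((Complex.continuous_conj.comp_aestronglyMeasurable (hφni n).1.comp_fst).mul
        (hφni n).1.comp_snd).mul (hwm n).aestronglyMeasurable
    · filter_upwards [ae_lt_top' hbdm hbdi] with p hp
      rw [← toReal_enorm]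
      refine ENNReal.toReal_mono hp.ne ?_
      rw [enorm_mul, enorm_mul, RCLike.enorm_conj, mul_assoc,
        mul_comm ‖φn n p.2‖ₑ]
      simp only [hbd]
      rw [dispKernel_sub_comm]
      gcongr
      · exact hle n _
      · exact enorm_integral_wave_le (dampRate_pos n) _ _
      · exact hle n _
    · have hne : ∀ᵐ p : ℝ × ℝ ∂(volume.prod volume), p.1 ≠ p.2 := by
        have hms : MeasurableSet {p : ℝ × ℝ | p.1 ≠ p.2} :=
          (measurableSet_eq_fun measurable_fst measurable_snd).compl
        refine (Measure.ae_prod_iff_ae_ae hms).2 (ae_of_all _ fun t => ?_)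
        have : ∀ᵐ s : ℝ, s ≠ t := by simp [ae_iff]
        filter_upwards [this] with s hs using hs.symm
      filter_upwards [hne] with p hp
      have hev : ∀ s : ℝ, ∀ᶠ n : ℕ in atTop, φn n s = φ s := fun s => by
        obtain ⟨N, hN⟩ := exists_nat_gt |s|
        filter_upwards [eventually_ge_atTop N] with k hk
        have : (N : ℝ) ≤ k := by exact_mod_cast hk
        have := abs_lt.1 hN
        exact indicator_of_mem (s := Ioc (-(k : ℝ)) k) ⟨by linarith, by linarith⟩ _
      refine Tendsto.congr' ?_ ((tendsto_integral_wave (sub_ne_zero.2 hp.symm)).const_mul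
        ((starRingEnd ℂ) (φ p.1) * φ p.2))
      filter_upwards [hev p.1, hev p.2] with n h1 h2
      rw [h1, h2]
  exact ge_of_tendsto ((Complex.continuous_re.tendsto _).comp hlim) (Eventually.of_forall fun n =>
    integral_regularized_kernelForm_nonneg (dampRate_pos n) (hφni n))

theorem conj_kernelForm_swap (p : ℝ × ℝ) :
    (starRingEnd ℂ) (kernelForm φ p.swap) = kernelForm φ p := by
  simp only [kernelForm, Prod.fst_swap, Prod.snd_swap, map_mul, Complex.conj_conj]
  rw [← schrodKernel_neg, neg_sub]
  ring

/-- Off the diagonal, D and its reflection partition the plane, and reflection conjugates the form.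
The full form is thus the integral over D plus its conjugate, which is twice the real part; the
diagonal contributes nothing since the kernel vanishes there by convention. -/
theorem integral_indicator_kernelForm_nonneg (hφ : MemLp φ (4 / 3) volume) {D : Set (ℝ × ℝ)}
    (hD : MeasurableSet D)
    (hsymm : ∀ p : ℝ × ℝ, p.1 ≠ p.2 → (p.swap ∈ D ↔ p ∉ D)) :
    0 ≤ (∫ p, D.indicator (kernelForm φ) p ∂(volume.prod volume)).re := by
  have hi := integrable_kernelForm hφ
  have hiD := hi.indicator hD
  have e1 : ∫ p, kernelForm φ p ∂(volume.prod volume)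
      = ∫ p, D.indicator (kernelForm φ) p ∂(volume.prod volume)
        + (starRingEnd ℂ) (∫ p, D.indicator (kernelForm φ) p ∂(volume.prod volume)) := by
    rw [← integral_conj]
    have e2 : ∫ p, (starRingEnd ℂ) (D.indicator (kernelForm φ) p) ∂(volume.prod volume)
        = ∫ p : ℝ × ℝ, (starRingEnd ℂ) (D.indicator (kernelForm φ) p.swap)
          ∂(volume.prod volume) :=
      (integral_prod_swap (μ := (volume : Measure ℝ)) (ν := (volume : Measure ℝ))
        fun p : ℝ × ℝ => (starRingEnd ℂ) (D.indicator (kernelForm φ) p)).symm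
    have hi2 : Integrable (fun p : ℝ × ℝ => (starRingEnd ℂ) (D.indicator (kernelForm φ) p.swap))
        (volume.prod volume) := Complex.conjCLE.integrable_comp_iff.2 hiD.swap
    rw [e2, ← integral_add hiD hi2]
    refine integral_congr_ae (ae_of_all _ fun p => ?_)
    simp only
    by_cases hne : p.1 = p.2
    · have h0 : ∀ q : ℝ × ℝ, q.1 = q.2 → kernelForm φ q = 0 := fun q hq => by
        simp [kernelForm, hq, schrodKernel_zero]
      have h1 : ∀ q : ℝ × ℝ, q.1 = q.2 → D.indicator (kernelForm φ) q = 0 := fun q hq => by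
        by_cases hqD : q ∈ D <;> simp [hqD, h0 q hq]
      rw [h0 p hne, h1 p hne, h1 p.swap hne.symm]
      simp
    · by_cases hp : p ∈ D
      · have : p.swap ∉ D := fun h => (hsymm p hne).1 h hp
        simp [hp, this]
      · have : p.swap ∈ D := (hsymm p hne).2 hp
        rw [indicator_of_notMem hp, indicator_of_mem this, conj_kernelForm_swap, zero_add]
  have h2 := integral_kernelForm_nonneg hφ
  rw [e1, Complex.add_re, Complex.conj_re] at h2
  linarith

/-- The causal quadratic form of `schrodKernel` has nonnegative real part. -/
theorem integral_causal_kernelForm_nonneg (hφ : MemLp φ (4 / 3) volume) :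
    0 ≤ (∫ p, {p : ℝ × ℝ | p.2 ∈ uIoc 0 p.1}.indicator (kernelForm φ) p
      ∂(volume.prod volume)).re := by
  -- The causal region starts from time 0 in both directions, so it never pairs a positive with a
  -- negative time. It splits into {s ≤ t} for positive times and {t < s} for nonpositive ones.
  set φp := (Ioi (0 : ℝ)).indicator φ
  set φm := (Iic (0 : ℝ)).indicator φ
  have hp : MemLp φp (4 / 3) volume := hφ.indicator measurableSet_Ioi
  have hm : MemLp φm (4 / 3) volume := hφ.indicator measurableSet_Iic
  have hD1 : MeasurableSet {p : ℝ × ℝ | p.2 ≤ p.1} := measurableSet_le measurable_snd measurable_fst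
  have hD2 : MeasurableSet {p : ℝ × ℝ | p.1 < p.2} := measurableSet_lt measurable_fst measurable_snd
  have e : ∀ p, {p : ℝ × ℝ | p.2 ∈ uIoc 0 p.1}.indicator (kernelForm φ) p
      = {p : ℝ × ℝ | p.2 ≤ p.1}.indicator (kernelForm φp) p
        + {p : ℝ × ℝ | p.1 < p.2}.indicator (kernelForm φm) p := by
    rintro ⟨t, s⟩
    simp only [indicator, mem_ofPred_eq, kernelForm, φp, φm, mem_Ioi, mem_Iic, uIoc, mem_Ioc]
    rcases lt_or_ge 0 t with ht | ht
    · rw [min_eq_left ht.le, max_eq_right ht.le]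
      rcases lt_or_ge 0 s with hs | hs
      · simp [ht, hs, not_le.2 ht, not_le.2 hs]
      · simp [ht, hs, not_le.2 ht, not_lt.2 hs]
    · rw [min_eq_right ht, max_eq_left ht]
      rcases lt_or_ge 0 s with hs | hs
      · simp [ht, hs, not_lt.2 ht, not_le.2 hs]
      · simp [ht, hs, not_lt.2 ht, not_lt.2 hs]
  simp_rw [e]
  rw [integral_add ((integrable_kernelForm hp).indicator hD1)
    ((integrable_kernelForm hm).indicator hD2), Complex.add_re]
  refine add_nonneg (integral_indicator_kernelForm_nonneg hp hD1 fun p hp => ?_)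
    (integral_indicator_kernelForm_nonneg hm hD2 fun p hp => ?_)
  · simp only [mem_ofPred_eq, Prod.fst_swap, Prod.snd_swap, not_le]
    exact ⟨fun h => lt_of_le_of_ne h hp, le_of_lt⟩
  · simp only [mem_ofPred_eq, Prod.fst_swap, Prod.snd_swap, not_lt]
    exact ⟨le_of_lt, fun h => lt_of_le_of_ne h hp.symm⟩

end Positivity

/-! ### The point interaction: trace bound and global solvability -/

theorem enorm_rpow_four {E : Type*} [NormedAddCommGroup E] (x : E) :
    ‖x‖ₑ ^ (4 : ℝ) = ENNReal.ofReal (‖x‖ ^ 4) := by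
  rw [← ofReal_norm, show (4 : ℝ) = ((4 : ℕ) : ℝ) by norm_num, ENNReal.rpow_natCast,
    ENNReal.ofReal_pow (norm_nonneg _)]

section Concentrated

variable {g : ℝ → ℝ} {F : ℝ → ℝ →ᵇ ℂ}

theorem memLp_eval_zero {p : ℝ≥0∞} (hF : MemLp F p volume) : MemLp (fun s => F s 0) p volume := by
  refine hF.of_le ?_ (ae_of_all _ fun s => (F s).norm_coe_le_norm 0)
  have : Continuous fun v : ℝ →ᵇ ℂ => v 0 := by fun_prop
  exact this.comp_aestronglyMeasurable hF.1

/-- The forcing frozen at its value at the origin. -/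
def frozen (F : ℝ → ℝ →ᵇ ℂ) (s : ℝ) : ℝ →ᵇ ℂ := BoundedContinuousFunction.const ℝ (F s 0)

theorem frozen_apply (s x : ℝ) : frozen F s x = F s 0 := rfl

theorem norm_frozen (s : ℝ) : ‖frozen F s‖ = ‖F s 0‖ := BoundedContinuousFunction.norm_const_eq _

theorem memLp_frozen {p : ℝ≥0∞} (hF : MemLp F p volume) : MemLp (frozen F) p volume := by
  refine (memLp_eval_zero hF).of_le ?_ (ae_of_all _ fun s => (norm_frozen s).le)
  have : Continuous fun z : ℂ => BoundedContinuousFunction.const ℝ z := by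
    refine LipschitzWith.continuous (K := 1) (LipschitzWith.of_dist_le_mul fun z w => ?_)
    rw [BoundedContinuousFunction.dist_le (by positivity)]
    simp
  exact this.comp_aestronglyMeasurable (memLp_eval_zero hF).1

theorem cplFourier_zero (φ : ℝ →ᵇ ℂ) (ξ : ℝ) :
    cplFourier g 0 φ ξ = φ 0 * ((∫ y, g y : ℝ) : ℂ) := by
  simp only [cplFourier, zero_mul, neg_zero, wave_zero_zero_zero, mul_one]
  rw [integral_const_mul, integral_complex_ofReal]

theorem duhL2_zero_eq_frozen (a b : ℝ) : duhL2 g 0 F a b = duhL2 g 0 (frozen F) a b := by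
  refine duhL2_eq_of_duhProfile_eq ?_
  funext ξ
  simp [duhProfile, cplFourier_zero, frozen_apply]

theorem duhRep_zero_eq_frozen : duhRep g 0 F = duhRep g 0 (frozen F) := by
  funext t
  rw [duhRep, duhL2_zero_eq_frozen, ← duhRep]

/-- At ε = 0 the forcing matters only through its value at the origin. A bound on the trace
therefore controls the Duhamel integral at all positions. -/
theorem lintegral_duhRep_zero_le (hg : Integrable g) (hF : MemLp F (4 / 3) volume) :
    ∫⁻ t, ‖duhRep g 0 F t‖ₑ ^ (4 : ℝ) ≤
      mass g ^ (4 : ℝ) * (144 ^ 2 * (∫⁻ s, ‖F s 0‖ₑ ^ (4 / 3 : ℝ)) ^ (3 : ℝ)) := by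
  have e2 : ∀ s, ‖frozen F s‖ₑ = ‖F s 0‖ₑ := fun s => by
    rw [← ofReal_norm, norm_frozen, ofReal_norm]
  rw [duhRep_zero_eq_frozen]
  simpa only [e2] using lintegral_duhRep_le (ε := 0) hg (memLp_frozen hF)

/-- The regularized formula is evaluated at the origin, where the spatial integral contributes ∫ g =
1, and the damping is then removed. Forward and backward times lead to the same formula: the
orientation sign of the integral compensates the opposite phase of the kernel. -/
theorem ae_duhRep_zero_apply (hg : Integrable g) (hg1 : ∫ y, g y = 1)
    (hF : MemLp F (4 / 3) volume) :
    ∀ᵐ t, Complex.I * duhRep g 0 F t 0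
      = ∫ s in uIoc 0 t, F s 0 * schrodKernel (s - t) := by
  -- Finiteness of the fractional integral at almost every time supplies the integrable majorant for
  -- this limit.
  have hfin : ∀ᵐ t, fracInt (fun s => ‖F s‖ₑ) t < ∞ := by
    have h1 : ∫⁻ t, fracInt (fun s => ‖F s‖ₑ) t ^ (4 : ℝ) ≠ ∞ := by
      refine ((lintegral_fracInt_pow_four_le_of_aemeasurable hF.1.enorm).trans_lt ?_).ne
      rw [lintegral_enorm_rpow_four_thirds, ← ENNReal.rpow_mul]
      exact ENNReal.mul_lt_top (by finiteness)
        (ENNReal.rpow_lt_top_of_nonneg (by norm_num) hF.2.ne)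
    filter_upwards [ae_lt_top ((measurable_fracInt_of_aemeasurable hF.1.enorm).pow_const _) h1]
      with t ht
    exact (ENNReal.rpow_lt_top_iff_of_pos (by norm_num)).1 ht
  filter_upwards [ae_hasRep_duhL2 (ε := 0) hg hF, hfin] with t hrep ht
  have hS : MeasurableSet (uIoc 0 t) := measurableSet_uIoc
  have hev : Tendsto (fun n => regInv n (phase t (duhL2 g 0 F 0 t)) 0) atTop
      (𝓝 (duhRep g 0 F t 0)) :=
    (((by fun_prop : Continuous fun v : ℝ →ᵇ ℂ => v 0)).tendsto _).comp hrep
  have e1 : ∀ n, regInv n (phase t (duhL2 g 0 F 0 t)) 0 = (if 0 ≤ t then 1 else -1 : ℝ) •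
      ∫ s in uIoc 0 t, F s 0 * ∫ ξ, wave (dampRate n) (t - s) 0 ξ := fun n => by
    rw [regInv_phase_duhL2_apply hg hF]
    congr 1
    have e2 : ∀ p : ℝ × ℝ, cplDensity g 0 F p * (∫ ξ, wave (dampRate n) (t - p.1) (0 - 0 * p.2) ξ)
        = (F p.1 0 * ∫ ξ, wave (dampRate n) (t - p.1) 0 ξ) * (g p.2 : ℂ) := fun p => by
      simp only [cplDensity, zero_mul, sub_zero]
      ring
    simp_rw [e2]
    rw [integral_prod_mul (f := fun s => F s 0 * ∫ ξ, wave (dampRate n) (t - s) 0 ξ)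
      (g := fun y => (g y : ℂ)), integral_complex_ofReal, hg1, Complex.ofReal_one, mul_one]
  have hFm : AEStronglyMeasurable (fun s => F s 0) volume := (memLp_eval_zero hF).1
  have hbm : AEMeasurable (fun s => dispKernel (t - s) * ‖F s‖ₑ) (volume.restrict (uIoc 0 t)) :=
    ((measurable_dispKernel.comp (by fun_prop)).aemeasurable.mul hF.1.enorm).restrict
  have hbi : ∫⁻ s in uIoc 0 t, dispKernel (t - s) * ‖F s‖ₑ ≠ ∞ :=
    ((setLIntegral_le_fracInt _ _ _).trans_lt ht).ne
  have hlim : Tendsto (fun n => ∫ s in uIoc 0 t, F s 0 * ∫ ξ, wave (dampRate n) (t - s) 0 ξ) atTop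
      (𝓝 (∫ s in uIoc 0 t, F s 0 * schrodKernel (t - s))) := by
    refine tendsto_integral_of_dominated_convergence
      (fun s => (dispKernel (t - s) * ‖F s‖ₑ).toReal) (fun n => ?_)
      (integrable_toReal_of_lintegral_ne_top hbm hbi) (fun n => ?_) ?_
    · have h3 : StronglyMeasurable fun q : ℝ × ℝ => wave (dampRate n) (t - q.1) 0 q.2 :=
        (Continuous.wave (by fun_prop) (by fun_prop) (by fun_prop)
          (by fun_prop)).stronglyMeasurable
      exact hFm.restrict.mul h3.integral_prod_right.aestronglyMeasurable
    · filter_upwards [ae_lt_top' hbm hbi] with s hs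
      rw [← toReal_enorm]
      refine ENNReal.toReal_mono hs.ne ?_
      rw [enorm_mul, mul_comm]
      gcongr
      · exact enorm_integral_wave_le (dampRate_pos n) _ _
      · rw [← ofReal_norm, ← ofReal_norm]
        exact ENNReal.ofReal_le_ofReal ((F s).norm_coe_le_norm 0)
    · have : ∀ᵐ s : ℝ, s ≠ t := by simp [ae_iff]
      filter_upwards [ae_restrict_of_ae this] with s hs
      exact (tendsto_integral_wave (sub_ne_zero.2 hs.symm)).const_mul _
  have hval : duhRep g 0 F t 0 = (if 0 ≤ t then 1 else -1 : ℝ) •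
      ∫ s in uIoc 0 t, F s 0 * schrodKernel (t - s) := by
    refine tendsto_nhds_unique hev ?_
    simp_rw [e1]
    exact hlim.const_smul (if 0 ≤ t then 1 else -1 : ℝ)
  rw [hval, ← integral_smul, ← integral_const_mul]
  refine setIntegral_congr_fun hS fun s hs => ?_
  rcases le_or_gt 0 t with h | h
  · rw [uIoc_of_le h] at hs
    rw [if_pos h, one_smul, mul_left_comm, I_mul_schrodKernel (by linarith [hs.2]), neg_sub]
  · rw [uIoc_of_ge h.le] at hs
    have h1 := I_mul_schrodKernel (τ := s - t) (by linarith [hs.1])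
    rw [neg_sub] at h1
    rw [if_neg (not_le.2 h), neg_one_smul, ← h1]
    linear_combination -(F s 0 * schrodKernel (s - t)) * Complex.I_mul_I

/-- The defocusing sign of the point interaction controls the trace at the origin. -/
theorem lintegral_trace_le (hg : Integrable g) (hg1 : ∫ y, g y = 1) {f u : ℝ → ℝ →ᵇ ℂ}
    (hf : MemLp f 4 volume) (hu : MemLp u 4 volume) (hmild : IsMild g 0 f u) :
    ∫⁻ t, ‖u t 0‖ₑ ^ (4 : ℝ) ≤ ∫⁻ t, ‖f t 0‖ₑ ^ (4 : ℝ) := by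
  set φ : ℝ → ℂ := fun s => cubic (u s) 0 with hφ
  have hφm : MemLp φ (4 / 3) volume := memLp_eval_zero hu.cubic
  have hqi : Integrable fun t => ‖u t 0‖ ^ 4 := (memLp_eval_zero hu).integrable_norm_pow (by norm_num)
  have hfi : Integrable fun t => ‖f t 0‖ ^ 4 := (memLp_eval_zero hf).integrable_norm_pow (by norm_num)
  have hφn : ∀ t, ‖φ t‖ = ‖u t 0‖ ^ 3 := fun t => by
    simp only [hφ, cubic_apply, norm_mul, Complex.norm_real]
    rw [Real.norm_of_nonneg (by positivity)]
    ring
  -- Young's inequality with exponents 4/3 and 4, from the factorization of the difference with (x -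
  -- y)² as a factor. The weight 3/4 on x⁴ is absorbed after integration, and the resulting constant
  -- is exactly 1.
  have hyoung : ∀ x y : ℝ, 0 ≤ x → 0 ≤ y → x ^ 3 * y ≤ 3 / 4 * x ^ 4 + 1 / 4 * y ^ 4 :=
    fun x y hx hy => by
      have : 0 ≤ (x - y) ^ 2 * (3 * x ^ 2 + 2 * x * y + y ^ 2) := by positivity
      nlinarith
  have hDm : MeasurableSet {p : ℝ × ℝ | p.2 ∈ uIoc 0 p.1} := by
    have : {p : ℝ × ℝ | p.2 ∈ uIoc 0 p.1} = {p | min 0 p.1 < p.2} ∩ {p | p.2 ≤ max 0 p.1} := rfl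
    rw [this]
    exact (measurableSet_lt (by fun_prop) (by fun_prop)).inter
      (measurableSet_le (by fun_prop) (by fun_prop))
  have hki := (integrable_kernelForm hφm).indicator hDm
  have hsec : ∀ t, ∫ s, {p : ℝ × ℝ | p.2 ∈ uIoc 0 p.1}.indicator (kernelForm φ) (t, s)
      = (starRingEnd ℂ) (φ t) * ∫ s in uIoc 0 t, φ s * schrodKernel (s - t) := fun t => by
    rw [← integral_const_mul, ← integral_indicator measurableSet_uIoc]
    refine integral_congr_ae (ae_of_all _ fun s => ?_)
    simp only [indicator, mem_ofPred_eq, kernelForm, mul_assoc]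
  have hpos := integral_causal_kernelForm_nonneg hφm
  have hpi := hki.integral_prod_left
  rw [integral_prod _ hki] at hpos
  simp_rw [hsec] at hpos hpi
  -- The trace equation is multiplied by the conjugate of |q|² q. The Duhamel term becomes the
  -- density of the causal form, with a favourable sign.
  have hpt : ∀ᵐ t, ‖u t 0‖ ^ 4 ≤ 3 / 4 * ‖u t 0‖ ^ 4 + 1 / 4 * ‖f t 0‖ ^ 4
      - ((starRingEnd ℂ) (φ t) * ∫ s in uIoc 0 t, φ s * schrodKernel (s - t)).re := by
    filter_upwards [hmild, ae_duhRep_zero_apply hg hg1 hu.cubic] with t h1 h2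
    rw [← h2]
    have h3 : u t 0 = f t 0 - Complex.I * duhRep g 0 (fun s => cubic (u s)) t 0 := by
      have := congrArg (fun v : ℝ →ᵇ ℂ => v 0) h1
      simpa using this
    have h4 : (starRingEnd ℂ) (φ t) * u t 0 = ((‖u t 0‖ ^ 4 : ℝ) : ℂ) := by
      simp only [hφ, cubic_apply, map_mul, Complex.conj_ofReal]
      rw [mul_assoc, ← Complex.normSq_eq_conj_mul_self, Complex.normSq_eq_norm_sq]
      push_cast
      ring
    have h5 : (starRingEnd ℂ) (φ t) * (Complex.I * duhRep g 0 (fun s => cubic (u s)) t 0)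
        = (starRingEnd ℂ) (φ t) * f t 0 - ((‖u t 0‖ ^ 4 : ℝ) : ℂ) := by
      rw [← h4]
      linear_combination (starRingEnd ℂ) (φ t) * h3
    rw [h5, Complex.sub_re, Complex.ofReal_re]
    have h6 : ((starRingEnd ℂ) (φ t) * f t 0).re ≤ ‖u t 0‖ ^ 3 * ‖f t 0‖ := by
      refine (Complex.re_le_norm _).trans ?_
      rw [norm_mul, RCLike.norm_conj, hφn]
    have := hyoung ‖u t 0‖ ‖f t 0‖ (norm_nonneg _) (norm_nonneg _)
    linarith
  have hre : Integrable fun t =>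
      ((starRingEnd ℂ) (φ t) * ∫ s in uIoc 0 t, φ s * schrodKernel (s - t)).re := hpi.re
  have hint := integral_mono_ae hqi (((hqi.const_mul (3 / 4)).add (hfi.const_mul (1 / 4))).sub hre)
    hpt
  have e1 : ∫ t, ((starRingEnd ℂ) (φ t) * ∫ s in uIoc 0 t, φ s * schrodKernel (s - t)).re
      = (∫ t, (starRingEnd ℂ) (φ t) * ∫ s in uIoc 0 t, φ s * schrodKernel (s - t)).re :=
    integral_re hpi
  rw [integral_sub' ((hqi.const_mul _).add (hfi.const_mul _)) hre, integral_add' (hqi.const_mul _)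
    (hfi.const_mul _), integral_const_mul, integral_const_mul, e1] at hint
  have hfinal : ∫ t, ‖u t 0‖ ^ 4 ≤ ∫ t, ‖f t 0‖ ^ 4 := by linarith
  simp_rw [enorm_rpow_four]
  rw [← ofReal_integral_eq_lintegral_ofReal hqi (ae_of_all _ fun t => by positivity),
    ← ofReal_integral_eq_lintegral_ofReal hfi (ae_of_all _ fun t => by positivity)]
  exact ENNReal.ofReal_le_ofReal hfinal

/-- A priori bound for the point interaction. -/
theorem eLpNorm_le_of_isMild_zero (hg : Integrable g) (hg1 : ∫ y, g y = 1) {f u : ℝ → ℝ →ᵇ ℂ}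
    (hf : MemLp f 4 volume) (hu : MemLp u 4 volume) (hmild : IsMild g 0 f u) :
    eLpNorm u 4 volume ≤
      eLpNorm f 4 volume + 12 * mass g * eLpNorm f 4 volume ^ (3 : ℝ) := by
  have hD := memLp_duhRep (ε := 0) hg hu.cubic
  have h1 : ∫⁻ s, ‖cubic (u s) 0‖ₑ ^ (4 / 3 : ℝ) ≤ eLpNorm f 4 volume ^ (4 : ℝ) := by
    calc _ = ∫⁻ t, ‖u t 0‖ₑ ^ (4 : ℝ) := by
          refine lintegral_congr fun t => ?_
          have : ‖cubic (u t) 0‖ₑ = ‖u t 0‖ₑ ^ (3 : ℝ) := by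
            rw [cubic_apply, enorm_mul, show (3 : ℝ) = ((3 : ℕ) : ℝ) by norm_num,
              ENNReal.rpow_natCast, ← ofReal_norm, ← ofReal_norm, Complex.norm_real,
              Real.norm_of_nonneg (by positivity), ENNReal.ofReal_pow (norm_nonneg _)]
            ring
          rw [this, ← ENNReal.rpow_mul]
          norm_num
      _ ≤ ∫⁻ t, ‖f t 0‖ₑ ^ (4 : ℝ) := lintegral_trace_le hg hg1 hf hu hmild
      _ ≤ _ := by
          rw [eLpNorm_four_rpow]
          gcongr with t
          rw [← ofReal_norm, ← ofReal_norm]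
          exact ENNReal.ofReal_le_ofReal ((f t).norm_coe_le_norm 0)
  have h2 : eLpNorm (duhRep g 0 fun s => cubic (u s)) 4 volume ≤
      12 * mass g * eLpNorm f 4 volume ^ (3 : ℝ) := by
    rw [← ENNReal.rpow_le_rpow_iff (show (0 : ℝ) < 4 by norm_num), eLpNorm_four_rpow]
    refine (lintegral_duhRep_zero_le hg hu.cubic).trans ?_
    calc _ ≤ mass g ^ (4 : ℝ) * (144 ^ 2 * (eLpNorm f 4 volume ^ (4 : ℝ)) ^ (3 : ℝ)) := by gcongr
      _ = _ := by
          rw [ENNReal.mul_rpow_of_nonneg _ _ (by norm_num),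
            ENNReal.mul_rpow_of_nonneg _ _ (by norm_num), ← ENNReal.rpow_mul, ← ENNReal.rpow_mul,
            mul_comm (4 : ℝ) 3, show (12 : ℝ≥0∞) ^ (4 : ℝ) = 144 ^ 2 by
            rw [show (4 : ℝ) = ((4 : ℕ) : ℝ) by norm_num, ENNReal.rpow_natCast]; norm_num]
          ring
  calc eLpNorm u 4 volume = eLpNorm (f - Complex.I • duhRep g 0 fun s => cubic (u s)) 4 volume := by
        refine eLpNorm_congr_ae ?_
        filter_upwards [hmild] with t ht
        exact ht
    _ ≤ eLpNorm f 4 volume + eLpNorm (Complex.I • duhRep g 0 fun s => cubic (u s)) 4 volume :=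
        eLpNorm_sub_le hf.1 (hD.1.const_smul _) (by norm_num)
    _ ≤ _ := by
        gcongr
        rw [eLpNorm_const_smul, ← ofReal_norm, Complex.norm_I, ENNReal.ofReal_one, one_mul]
        exact h2

theorem isMild_zero (hg : Integrable g) (ε : ℝ) : IsMild g ε 0 0 := by
  have h0 : MemLp (0 : ℝ → ℝ →ᵇ ℂ) (4 / 3) volume := MemLp.zero
  filter_upwards [ae_duhRep_sub (ε := ε) hg h0 h0] with t ht
  have e : (fun s => cubic ((0 : ℝ → ℝ →ᵇ ℂ) s)) = 0 := by
    funext s; simp [cubic]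
  rw [sub_self, sub_self] at ht
  rw [e, ht]
  simp

/-- Global solvability for the point interaction. -/
theorem exists_isMild_zero (hg : Integrable g) (hg1 : ∫ y, g y = 1) {f : ℝ → ℝ →ᵇ ℂ}
    (hf : MemLp f 4 volume) : ∃ u, MemLp u 4 volume ∧ IsMild g 0 f u := by
  set N := eLpNorm f 4 volume with hN
  have hNfin : N ≠ ∞ := hf.2.ne
  have hAfin : N + 12 * mass g * N ^ (3 : ℝ) ≠ ∞ := by
    have h1 := mass_ne_top hg
    have h2 : N ^ (3 : ℝ) ≠ ∞ := (ENNReal.rpow_lt_top_of_nonneg (by norm_num) hNfin).ne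
    finiteness
  obtain ⟨A, hA⟩ : ∃ A : NNReal, (A : ℝ≥0∞) = N + 12 * mass g * N ^ (3 : ℝ) :=
    ⟨_, ENNReal.coe_toNNReal hAfin⟩
  -- The a priori bound A holds for every amplitude up to 1, so the admissible step δ is the same
  -- throughout and n steps of size N/n ≤ δ suffice.
  obtain ⟨δ, hδ, _, H⟩ := exists_perturbation hg A
  obtain ⟨n, hn⟩ := exists_nat_gt (N.toNNReal / δ)
  have hn0 : 0 < (n : ℝ) := by
    have : (0 : NNReal) < n := lt_of_le_of_lt bot_le hn
    exact_mod_cast this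
  -- Continuation takes place in the amplitude of the forcing, not in time: each step is already
  -- global in time. It starts from the zero solution.
  have key : ∀ k : ℕ, k ≤ n → ∃ u, MemLp u 4 volume ∧ IsMild g 0 ((k / n : ℝ) • f) u := by
    intro k
    induction k with
    | zero =>
      intro _
      refine ⟨0, MemLp.zero, ?_⟩
      simpa using isMild_zero hg 0
    | succ k ih =>
      intro hk
      obtain ⟨u, hu, hmild⟩ := ih (by omega)
      have hkf : MemLp ((k / n : ℝ) • f) 4 volume := hf.const_smul _
      have hle : eLpNorm ((k / n : ℝ) • f) 4 volume ≤ N := by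
        rw [eLpNorm_const_smul]
        refine mul_le_of_le_one_left bot_le ?_
        rw [Real.enorm_of_nonneg (by positivity), ENNReal.ofReal_le_one, div_le_one hn0]
        exact_mod_cast (by omega : k ≤ n)
      obtain ⟨r, hr, hr', -⟩ := H 0 u _ ((1 / n : ℝ) • f) hu (by
          rw [hA]
          refine (eLpNorm_le_of_isMild_zero hg hg1 hkf hu hmild).trans ?_
          gcongr) (hf.const_smul _) (by
          rw [eLpNorm_const_smul, Real.enorm_of_nonneg (by positivity), ← hN]
          have h1 : N = N.toNNReal := (ENNReal.coe_toNNReal hNfin).symm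
          rw [h1, ENNReal.ofReal, ← ENNReal.coe_mul]
          refine ENNReal.coe_le_coe.2 ?_
          rw [div_lt_iff₀ hδ] at hn
          rw [← NNReal.coe_le_coe, NNReal.coe_mul, Real.coe_toNNReal _ (by positivity),
            one_div, inv_mul_le_iff₀ hn0]
          exact_mod_cast hn.le) hmild
      refine ⟨u + r, hu.add hr, ?_⟩
      rw [← add_smul] at hr'
      convert hr' using 2
      push_cast
      ring
  obtain ⟨u, hu, hmild⟩ := key n le_rfl
  refine ⟨u, hu, ?_⟩
  rwa [div_self hn0.ne', one_smul] at hmild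

end Concentrated

/-! ### The modulus of continuity -/

section Modulus

/-- The modulus of continuity of a bounded function. -/
def modulus (u : ℝ →ᵇ ℂ) (r : ℝ) : ℝ≥0∞ := ⨆ (x : ℝ) (h : ℝ) (_ : |h| ≤ r), ‖u (x - h) - u x‖ₑ

theorem enorm_sub_le_modulus (u : ℝ →ᵇ ℂ) (x h : ℝ) : ‖u (x - h) - u x‖ₑ ≤ modulus u |h| :=
  le_iSup_of_le x (le_iSup₂_of_le h le_rfl le_rfl)

theorem measurable_modulus (u : ℝ →ᵇ ℂ) : Measurable (modulus u) := by
  refine Monotone.measurable fun r r' hr => ?_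
  exact iSup_mono fun x => iSup_mono fun h => iSup_mono' fun hh => ⟨hh.trans hr, le_rfl⟩

theorem enorm_apply_le (u : ℝ →ᵇ ℂ) (x : ℝ) : ‖u x‖ₑ ≤ ‖u‖ₑ := by
  rw [← ofReal_norm, ← ofReal_norm]
  exact ENNReal.ofReal_le_ofReal (u.norm_coe_le_norm x)

theorem modulus_le (u : ℝ →ᵇ ℂ) (r : ℝ) : modulus u r ≤ 2 * ‖u‖ₑ := by
  refine iSup_le fun x => iSup₂_le fun h _ => enorm_sub_le.trans ?_
  rw [two_mul]
  exact add_le_add (enorm_apply_le u _) (enorm_apply_le u _)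

theorem tendsto_modulus {u : ℝ →ᵇ ℂ} (hu : UniformContinuous u) {ι : Type*} {l : Filter ι}
    {r : ι → ℝ} (hr : Tendsto r l (𝓝 0)) : Tendsto (fun i => modulus u (r i)) l (𝓝 0) := by
  refine ENNReal.tendsto_nhds_zero.2 fun η hη => ?_
  rcases eq_or_ne η ∞ with rfl | hη'
  · exact Eventually.of_forall fun _ => le_top
  obtain ⟨δ, hδ, H⟩ := Metric.uniformContinuous_iff.1 hu η.toReal (ENNReal.toReal_pos hη.ne' hη')
  filter_upwards [hr.eventually_lt_const hδ] with i hi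
  refine iSup_le fun x => iSup₂_le fun h hh => ?_
  have h1 := H (a := x - h) (b := x) (by
    rw [Real.dist_eq, sub_sub_cancel_left, abs_neg]; exact hh.trans_lt hi)
  rw [dist_eq_norm] at h1
  rw [← ofReal_norm, ← ENNReal.ofReal_toReal hη']
  exact ENNReal.ofReal_le_ofReal h1.le

end Modulus

/-! ### Convergence of Duhamel integrals for concentrating couplings -/

section Convergence

variable {g : ℝ → ℝ} {F : ℝ → ℝ →ᵇ ℂ} {e : ℕ → ℝ}

theorem lintegral_rpow_four_thirds_ne_top (hF : MemLp F (4 / 3) volume) :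
    ∫⁻ s, ‖F s‖ₑ ^ (4 / 3 : ℝ) ≠ ∞ := by
  rw [lintegral_enorm_rpow_four_thirds]
  exact (ENNReal.rpow_lt_top_of_nonneg (by norm_num) hF.2.ne).ne

/-- The L^{4/3} mass of a time interval becomes an increment of one bounded monotone function.
Relative compactness of its range gives uniformity in time, and its limits at ±∞ give scattering. -/
theorem exists_primitive_rpow_four_thirds (hF : MemLp F (4 / 3) volume) :
    ∃ f : ℝ → ℝ, Integrable f ∧ (∀ s, 0 ≤ f s) ∧ ∀ a b, ∫⁻ s in uIoc a b, ‖F s‖ₑ ^ (4 / 3 : ℝ)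
      = ENNReal.ofReal |(∫ s in (0 : ℝ)..b, f s) - ∫ s in (0 : ℝ)..a, f s| := by
  set f : ℝ → ℝ := fun s => ‖F s‖ ^ (4 / 3 : ℝ) with hf
  have hfe : ∀ s, ‖F s‖ₑ ^ (4 / 3 : ℝ) = ENNReal.ofReal (f s) := fun s => by
    rw [← ofReal_norm, ENNReal.ofReal_rpow_of_nonneg (norm_nonneg _) (by norm_num)]
  have hf0 : ∀ s, 0 ≤ f s := fun s => by positivity
  have hfi : Integrable f := by
    refine ⟨(hF.1.norm.aemeasurable.pow_const _).aestronglyMeasurable, ?_⟩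
    rw [hasFiniteIntegral_iff_ofReal (ae_of_all _ hf0)]
    simp_rw [← hfe]
    exact (lintegral_rpow_four_thirds_ne_top hF).lt_top
  refine ⟨f, hfi, hf0, fun a b => ?_⟩
  simp_rw [hfe]
  rw [← ofReal_integral_eq_lintegral_ofReal hfi.integrableOn (ae_of_all _ hf0),
    intervalIntegral.integral_interval_sub_left hfi.intervalIntegrable hfi.intervalIntegrable,
    intervalIntegral.abs_integral_eq_abs_integral_uIoc,
    abs_of_nonneg (integral_nonneg fun s => hf0 s)]

/-- After subtracting the frozen forcing the function vanishes at the origin, so its values at εy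
tend to zero for each y. Boundedness and integrability of g supply the majorant. -/
theorem tendsto_cplSize_sub_frozen (hg : Integrable g) (he : Tendsto e atTop (𝓝 0)) (s : ℝ) :
    Tendsto (fun n => cplSize g (e n) ((F - frozen F) s)) atTop (𝓝 0) := by
  set v := (F - frozen F) s with hv
  have hv0 : v 0 = 0 := by simp [hv, frozen_apply]
  have h0 : Tendsto (fun n => ∫⁻ y, ‖v (e n * y)‖ₑ * ‖g y‖ₑ) atTop (𝓝 (∫⁻ _ : ℝ, 0)) := by
    refine tendsto_lintegral_of_dominated_convergence' (fun y => ‖v‖ₑ * ‖g y‖ₑ) (fun n => ?_)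
      (fun n => ae_of_all _ fun y => ?_) ?_ ?_
    · exact ((v.continuous.comp (by fun_prop : Continuous fun y => e n * y)).enorm.measurable
        |>.aemeasurable).mul hg.1.enorm
    · exact mul_le_mul_left (enorm_apply_le v _) _
    · rw [lintegral_const_mul' _ _ (by finiteness)]
      exact ENNReal.mul_ne_top (by finiteness) hg.2.ne
    · refine ae_of_all _ fun y => ?_
      have h1 : Tendsto (fun n => e n * y) atTop (𝓝 0) := by simpa using he.mul_const y
      have h2 := ((v.continuous.enorm.tendsto 0).comp h1)
      rw [hv0, enorm_zero] at h2
      have := ENNReal.Tendsto.mul_const (b := ‖g y‖ₑ) h2 (Or.inr (by finiteness))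
      simpa [Function.comp_def] using this
  simpa [cplSize] using h0

theorem tendsto_lintegral_cplSize_sub_frozen (hg : Integrable g) (hF : MemLp F (4 / 3) volume)
    (he : Tendsto e atTop (𝓝 0)) :
    Tendsto (fun n => ∫⁻ s, cplSize g (e n) ((F - frozen F) s) ^ (4 / 3 : ℝ)) atTop (𝓝 0) := by
  have hv := hF.sub (memLp_frozen hF)
  have hG := mass_ne_top hg
  have h0 : Tendsto (fun n => ∫⁻ s, cplSize g (e n) ((F - frozen F) s) ^ (4 / 3 : ℝ)) atTop
      (𝓝 (∫⁻ _ : ℝ, 0)) := by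
    refine tendsto_lintegral_of_dominated_convergence'
      (fun s => mass g ^ (4 / 3 : ℝ) * ‖(F - frozen F) s‖ₑ ^ (4 / 3 : ℝ))
      (fun n => (aemeasurable_cplSize hg.1 hv.1).pow_const _) (fun n => ae_of_all _ fun s => ?_) ?_
      (ae_of_all _ fun s => ?_)
    · simp only
      rw [← ENNReal.mul_rpow_of_nonneg _ _ (by norm_num)]
      gcongr
      exact cplSize_le _
    · rw [lintegral_const_mul' _ _ (by finiteness)]
      exact ENNReal.mul_ne_top (by finiteness) (lintegral_rpow_four_thirds_ne_top hv)
    · have := (ENNReal.continuous_rpow_const (y := 4 / 3)).tendsto _ |>.comp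
        (tendsto_cplSize_sub_frozen (F := F) hg he s)
      rw [ENNReal.zero_rpow_of_pos (by norm_num)] at this
      exact this
  simpa using h0

theorem ae_enorm_duhRep_le_cplSize (hg : Integrable g) {ε : ℝ} (hF : MemLp F (4 / 3) volume) :
    ∀ᵐ t, ‖duhRep g ε F t‖ₑ ≤ fracInt (fun s => cplSize g ε (F s)) t := by
  filter_upwards [ae_hasRep_duhL2 (ε := ε) hg hF] with t ht
  exact (ht.norm_le fun n => enorm_regInv_phase_duhL2_le_cplSize hg hF 0 t t n).trans
    (setLIntegral_le_fracInt _ _ _)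

theorem tendsto_lintegral_duhRep_sub_frozen (hg : Integrable g) (hF : MemLp F (4 / 3) volume)
    (he : Tendsto e atTop (𝓝 0)) :
    Tendsto (fun n => ∫⁻ t, ‖duhRep g (e n) (F - frozen F) t‖ₑ ^ (4 : ℝ)) atTop (𝓝 0) := by
  have hv := hF.sub (memLp_frozen hF)
  have h1 := ENNReal.Tendsto.const_mul (a := 144 ^ 2)
    ((ENNReal.continuous_rpow_const (y := 3)).tendsto _ |>.comp
      (tendsto_lintegral_cplSize_sub_frozen hg hF he)) (Or.inr (by norm_num))
  simp only [Function.comp_def] at h1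
  rw [ENNReal.zero_rpow_of_pos (by norm_num), mul_zero] at h1
  refine tendsto_of_tendsto_of_tendsto_of_le_of_le tendsto_const_nhds h1 (fun _ => bot_le) fun n => ?_
  refine (lintegral_mono_ae ?_).trans (lintegral_fracInt_pow_four_le_of_aemeasurable
    (aemeasurable_cplSize (ε := e n) hg.1 hv.1))
  filter_upwards [ae_enorm_duhRep_le_cplSize (ε := e n) hg hv] with t ht
  gcongr

/-- With a frozen forcing, the Duhamel integral for `g_ε` is an average of translates. -/
theorem regInv_phase_duhL2_frozen (hg : Integrable g) (hg1 : ∫ y, g y = 1)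
    (hF : MemLp F (4 / 3) volume) (ε t : ℝ) (n : ℕ) (x : ℝ) :
    regInv n (phase t (duhL2 g ε (frozen F) 0 t)) x =
      ∫ y, (g y : ℂ) * regInv n (phase t (duhL2 g 0 (frozen F) 0 t)) (x - ε * y) := by
  have hFf := memLp_frozen hF
  have hk : ∀ τ z, ‖∫ ξ, wave (dampRate n) τ z ξ‖ ≤ ∫ ξ, Real.exp (-(dampRate n * ξ ^ 2)) :=
    fun τ z => (norm_integral_le_integral_norm _).trans (by simp_rw [norm_wave]; exact le_rfl)
  have hint := integrable_cplDensity (ε := ε) hg (hFf.integrableOn_uIoc 0 t)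
  have hwm : StronglyMeasurable fun q : (ℝ × ℝ) × ℝ =>
      wave (dampRate n) (t - q.1.1) (x - ε * q.1.2) q.2 :=
    (Continuous.wave (by fun_prop) (by fun_prop) (by fun_prop) (by fun_prop)).stronglyMeasurable
  have hint2 : Integrable (fun p : ℝ × ℝ => cplDensity g ε (frozen F) p
      * ∫ ξ, wave (dampRate n) (t - p.1) (x - ε * p.2) ξ)
      ((volume.restrict (uIoc 0 t)).prod volume) :=
    hint.mul_bdd (c := ∫ ξ, Real.exp (-(dampRate n * ξ ^ 2)))
      hwm.integral_prod_right.aestronglyMeasurable (ae_of_all _ fun p => hk _ _)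
  have e0 : ∀ z, regInv n (phase t (duhL2 g 0 (frozen F) 0 t)) z = (if 0 ≤ t then 1 else -1 : ℝ) •
      ∫ s in uIoc 0 t, F s 0 * ∫ ξ, wave (dampRate n) (t - s) z ξ := fun z => by
    rw [regInv_phase_duhL2_apply hg hFf]
    congr 1
    have e2 : ∀ p : ℝ × ℝ, cplDensity g 0 (frozen F) p
        * (∫ ξ, wave (dampRate n) (t - p.1) (z - 0 * p.2) ξ)
        = (F p.1 0 * ∫ ξ, wave (dampRate n) (t - p.1) z ξ) * (g p.2 : ℂ) := fun p => by
      simp only [cplDensity, zero_mul, sub_zero, frozen_apply]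
      ring
    simp_rw [e2]
    rw [integral_prod_mul (f := fun s => F s 0 * ∫ ξ, wave (dampRate n) (t - s) z ξ)
      (g := fun y => (g y : ℂ)), integral_complex_ofReal, hg1, Complex.ofReal_one, mul_one]
  rw [regInv_phase_duhL2_apply hg hFf, integral_prod_symm _ hint2, ← integral_smul]
  refine integral_congr_ae (ae_of_all _ fun y => ?_)
  simp only
  rw [e0, mul_smul_comm, ← integral_const_mul]
  congr 1
  refine integral_congr_ae (ae_of_all _ fun s => ?_)
  simp only [cplDensity, frozen_apply]
  ring

/-- Since g has integral one, v - u is the g-average of the increments of u over the shifts εy. The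
averaging identity is known for the regularized integrals and survives their uniform convergence. -/
theorem enorm_duhRep_frozen_sub_le (hg : Integrable g) (hg1 : ∫ y, g y = 1)
    (hF : MemLp F (4 / 3) volume) {ε t : ℝ} {u v : ℝ →ᵇ ℂ}
    (hu : HasRep (phase t (duhL2 g 0 (frozen F) 0 t)) u)
    (hv : HasRep (phase t (duhL2 g ε (frozen F) 0 t)) v) :
    ‖v - u‖ₑ ≤ ∫⁻ y, ‖g y‖ₑ * modulus u |ε * y| := by
  refine enorm_le_of_forall_rat fun q => ?_
  generalize (q : ℝ) = x
  have hgc : Integrable fun y => (g y : ℂ) := hg.ofReal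
  have hw : ∀ w : ℝ →ᵇ ℂ, Integrable fun y => (g y : ℂ) * w (x - ε * y) := fun w =>
    hgc.mul_bdd (c := ‖w‖)
      (w.continuous.comp (by fun_prop : Continuous fun y => x - ε * y)).aestronglyMeasurable
      (ae_of_all _ fun y => w.norm_coe_le_norm _)
  have hevx : Tendsto (fun n => regInv n (phase t (duhL2 g ε (frozen F) 0 t)) x) atTop (𝓝 (v x)) :=
    (((by fun_prop : Continuous fun w : ℝ →ᵇ ℂ => w x)).tendsto _).comp hv
  have hlim : Tendsto (fun n => regInv n (phase t (duhL2 g ε (frozen F) 0 t)) x) atTop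
      (𝓝 (∫ y, (g y : ℂ) * u (x - ε * y))) := by
    simp_rw [regInv_phase_duhL2_frozen hg hg1 hF ε]
    rw [tendsto_iff_norm_sub_tendsto_zero]
    have h1 := (tendsto_iff_norm_sub_tendsto_zero.1 hu).mul_const (∫ y, ‖g y‖)
    rw [zero_mul] at h1
    refine squeeze_zero (fun _ => norm_nonneg _) (fun n => ?_) h1
    rw [← integral_sub (hw _) (hw _), ← integral_const_mul]
    refine norm_integral_le_of_norm_le (hg.norm.const_mul _) (ae_of_all _ fun y => ?_)
    rw [← mul_sub, norm_mul, Complex.norm_real, mul_comm]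
    gcongr
    exact (regInv n (phase t (duhL2 g 0 (frozen F) 0 t)) - u).norm_coe_le_norm _
  have hvx := tendsto_nhds_unique hevx hlim
  have hux : u x = ∫ y, (g y : ℂ) * u x := by
    rw [integral_mul_const, integral_complex_ofReal, hg1, Complex.ofReal_one, one_mul]
  rw [BoundedContinuousFunction.sub_apply, hvx, hux, ← integral_sub (hw _) (hgc.mul_const _)]
  refine (enorm_integral_le_lintegral_enorm _).trans (lintegral_mono fun y => ?_)
  rw [← mul_sub, enorm_mul, ← ofReal_norm (g y : ℂ), Complex.norm_real, ofReal_norm]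
  gcongr
  exact enorm_sub_le_modulus u x _

/-- At almost every time the limit representative is uniformly continuous, so its modulus at |εy|
tends to zero for each y, dominated by twice its sup norm. -/
theorem ae_tendsto_duhRep_frozen (hg : Integrable g) (hg1 : ∫ y, g y = 1)
    (hF : MemLp F (4 / 3) volume) (he : Tendsto e atTop (𝓝 0)) :
    ∀ᵐ t, Tendsto (fun n => ‖duhRep g (e n) (frozen F) t - duhRep g 0 (frozen F) t‖ₑ) atTop
      (𝓝 0) := by
  have hFf := memLp_frozen hF
  filter_upwards [ae_hasRep_duhL2 (ε := 0) hg hFf,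
    ae_all_iff.2 fun n => ae_hasRep_duhL2 (ε := e n) hg hFf] with t hu hv
  set u := duhRep g 0 (frozen F) t
  have h0 : Tendsto (fun n => ∫⁻ y, ‖g y‖ₑ * modulus u |e n * y|) atTop (𝓝 (∫⁻ _ : ℝ, 0)) := by
    refine tendsto_lintegral_of_dominated_convergence' (fun y => ‖g y‖ₑ * (2 * ‖u‖ₑ)) (fun n => ?_)
      (fun n => ae_of_all _ fun y => ?_) ?_ (ae_of_all _ fun y => ?_)
    · exact hg.1.enorm.mul ((measurable_modulus u).comp (by fun_prop)).aemeasurable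
    · exact mul_le_mul_right (modulus_le u _) _
    · rw [lintegral_mul_const' _ _ (by finiteness)]
      exact ENNReal.mul_ne_top hg.2.ne (by finiteness)
    · have h1 : Tendsto (fun n => |e n * y|) atTop (𝓝 0) := by
        simpa using (he.mul_const y).abs
      have := ENNReal.Tendsto.const_mul (a := ‖g y‖ₑ) (tendsto_modulus hu.uniformContinuous h1)
        (Or.inr (by finiteness))
      simpa using this
  rw [lintegral_zero] at h0
  exact tendsto_of_tendsto_of_tendsto_of_le_of_le tendsto_const_nhds h0 (fun _ => bot_le) fun n =>
    enorm_duhRep_frozen_sub_le hg hg1 hF hu (hv n)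

/-- Convergence at almost every time is upgraded by a majorant that is independent of ε: the
fractional integral of the frozen forcing, which Hardy–Littlewood–Sobolev places in L⁴. -/
theorem tendsto_lintegral_duhRep_frozen (hg : Integrable g) (hg1 : ∫ y, g y = 1)
    (hF : MemLp F (4 / 3) volume) (he : Tendsto e atTop (𝓝 0)) :
    Tendsto (fun n => ∫⁻ t, ‖duhRep g (e n) (frozen F) t - duhRep g 0 (frozen F) t‖ₑ ^ (4 : ℝ))
      atTop (𝓝 0) := by
  have hFf := memLp_frozen hF
  have hG := mass_ne_top hg
  set V : ℝ → ℝ≥0∞ := fun t => 2 * mass g * fracInt (fun s => ‖frozen F s‖ₑ) t with hV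
  have hdom : ∀ ε, ∀ᵐ t, ‖duhRep g ε (frozen F) t‖ₑ ≤
      mass g * fracInt (fun s => ‖frozen F s‖ₑ) t := fun ε => by
    filter_upwards [ae_enorm_duhRep_le (ε := ε) hg hFf] with t ht
    refine ht.trans ?_
    gcongr
    exact setLIntegral_le_fracInt _ _ _
  have h0 : Tendsto (fun n => ∫⁻ t, ‖duhRep g (e n) (frozen F) t
      - duhRep g 0 (frozen F) t‖ₑ ^ (4 : ℝ)) atTop (𝓝 (∫⁻ _ : ℝ, 0)) := by
    refine tendsto_lintegral_of_dominated_convergence' (fun t => V t ^ (4 : ℝ)) (fun n => ?_)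
      (fun n => ?_) ?_ ?_
    · exact ((aestronglyMeasurable_duhRep hg hFf).sub
        (aestronglyMeasurable_duhRep hg hFf)).enorm.pow_const _
    · filter_upwards [hdom (e n), hdom 0] with t h1 h2
      gcongr
      refine enorm_sub_le.trans ((add_le_add h1 h2).trans (le_of_eq ?_))
      simp only [hV]
      ring
    · simp only [hV, ENNReal.mul_rpow_of_nonneg _ _ (show (0 : ℝ) ≤ 4 by norm_num)]
      rw [lintegral_const_mul' _ _ (by finiteness)]
      refine ENNReal.mul_ne_top (by finiteness)
        ((lintegral_fracInt_pow_four_le_of_aemeasurable hFf.1.enorm).trans_lt ?_).ne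
      have := lintegral_rpow_four_thirds_ne_top hFf
      exact ENNReal.mul_lt_top (by finiteness) (ENNReal.rpow_lt_top_of_nonneg (by norm_num) this)
    · filter_upwards [ae_tendsto_duhRep_frozen hg hg1 hF he] with t ht
      have := (ENNReal.continuous_rpow_const (y := 4)).tendsto _ |>.comp ht
      rw [ENNReal.zero_rpow_of_pos (by norm_num)] at this
      exact this
  simpa using h0

theorem tendsto_eLpNorm_four_of_lintegral {f : ℕ → ℝ → ℝ →ᵇ ℂ}
    (h : Tendsto (fun n => ∫⁻ t, ‖f n t‖ₑ ^ (4 : ℝ)) atTop (𝓝 0)) :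
    Tendsto (fun n => eLpNorm (f n) 4 volume) atTop (𝓝 0) := by
  have h1 := (ENNReal.continuous_rpow_const (y := 1 / 4)).tendsto _ |>.comp h
  rw [ENNReal.zero_rpow_of_pos (by norm_num)] at h1
  refine h1.congr fun n => ?_
  simp only [Function.comp_def]
  rw [← eLpNorm_four_rpow, ← ENNReal.rpow_mul]
  norm_num

/-- Convergence of the Duhamel integrals in `L⁴(ℝ; C(ℝ))` as the coupling concentrates. -/
theorem tendsto_eLpNorm_duhRep_sub (hg : Integrable g) (hg1 : ∫ y, g y = 1)
    (hF : MemLp F (4 / 3) volume) (he : Tendsto e atTop (𝓝 0)) :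
    Tendsto (fun n => eLpNorm (duhRep g (e n) F - duhRep g 0 F) 4 volume) atTop (𝓝 0) := by
  have hFf := memLp_frozen hF
  have h1 := (tendsto_eLpNorm_four_of_lintegral (tendsto_lintegral_duhRep_sub_frozen hg hF he)).add
    (tendsto_eLpNorm_four_of_lintegral (tendsto_lintegral_duhRep_frozen hg hg1 hF he))
  rw [add_zero] at h1
  refine tendsto_of_tendsto_of_tendsto_of_le_of_le tendsto_const_nhds h1 (fun _ => bot_le) fun n => ?_
  refine le_trans (le_of_eq (eLpNorm_congr_ae ?_)) (eLpNorm_add_le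
    (aestronglyMeasurable_duhRep hg (hF.sub hFf))
    ((aestronglyMeasurable_duhRep hg hFf).sub (aestronglyMeasurable_duhRep hg hFf)) (by norm_num))
  filter_upwards [ae_duhRep_sub (ε := e n) hg hF hFf] with t ht
  rw [Pi.add_apply, Pi.sub_apply, ht, duhRep_zero_eq_frozen (F := F)]
  abel

theorem cplFourier_const (ε : ℝ) (z : ℂ) (ξ : ℝ) :
    cplFourier g ε (BoundedContinuousFunction.const ℝ z) ξ
      = cplFourier g ε (BoundedContinuousFunction.const ℝ 1) ξ * z := by
  simp only [cplFourier, BoundedContinuousFunction.const_apply, one_mul, mul_assoc]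
  rw [integral_const_mul, mul_comm]

theorem tendsto_cplFourier_one (hg : Integrable g) (hg1 : ∫ y, g y = 1)
    (he : Tendsto e atTop (𝓝 0)) (ξ : ℝ) :
    Tendsto (fun n => cplFourier g (e n) (BoundedContinuousFunction.const ℝ 1) ξ) atTop (𝓝 1) := by
  have e1 : (1 : ℂ) = ∫ y, BoundedContinuousFunction.const ℝ (1 : ℂ) 0 * (g y : ℂ)
      * wave 0 0 (-(0 * y)) ξ := by
    have := cplFourier_zero (g := g) (BoundedContinuousFunction.const ℝ 1) ξ
    rw [hg1] at this
    simpa [cplFourier] using this.symm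
  nth_rewrite 2 [e1]
  refine tendsto_integral_of_dominated_convergence (fun y => ‖g y‖)
    (fun n => (integrable_cplFourier_integrand hg _ ξ).1) hg.norm
    (fun n => ae_of_all _ fun y => ?_) (ae_of_all _ fun y => ?_)
  · simp [norm_wave]
  · have h1 : Tendsto (fun n => -(e n * y)) atTop (𝓝 (-(0 * y))) := (he.mul_const y).neg
    have h2 : Continuous fun z => wave 0 0 z ξ := Continuous.wave (by fun_prop) (by fun_prop)
      (by fun_prop) (by fun_prop)
    simpa using ((h2.tendsto _).comp h1).const_mul (g y : ℂ)

/-- The profile of a forcing constant in space factorizes as ĝ(εξ) times a time integral that does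
not contain ε. These multipliers are bounded by the L¹ norm of g and tend to 1 pointwise. -/
theorem tendsto_duhL2_frozen (hg : Integrable g) (hg1 : ∫ y, g y = 1) (hF : MemLp F (4 / 3) volume)
    (he : Tendsto e atTop (𝓝 0)) (a b : ℝ) :
    Tendsto (fun n => ‖duhL2 g (e n) (frozen F) a b - duhL2 g 0 (frozen F) a b‖ₑ) atTop (𝓝 0) := by
  have hFf := memLp_frozen hF
  have hprof : ∀ ε ξ, duhProfile g ε (frozen F) a b ξ =
      cplFourier g ε (BoundedContinuousFunction.const ℝ 1) ξ
        * ∫ s in a..b, freeSymbol (-s) ξ * F s 0 := fun ε ξ => by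
    rw [duhProfile, ← intervalIntegral.integral_const_mul]
    refine intervalIntegral.integral_congr fun s _ => ?_
    simp only [frozen]
    rw [cplFourier_const]
    ring
  have hprof0 : ∀ ξ, duhProfile g 0 (frozen F) a b ξ = ∫ s in a..b, freeSymbol (-s) ξ * F s 0 :=
    fun ξ => by
      rw [hprof, cplFourier_zero, hg1]
      simp
  have hmeas : ∀ ε, AEStronglyMeasurable
      (cplFourier g ε (BoundedContinuousFunction.const ℝ 1)) volume := fun ε => by
    refine Continuous.aestronglyMeasurable ?_
    have := continuous_integral_mul_wave (σ := volume) (A := fun y => (g y : ℂ)) (r := fun _ => 0)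
      (τ := fun _ => 0) (x := fun y => -(ε * y)) hg.ofReal measurable_const measurable_const
      (by fun_prop) (fun _ => le_rfl)
    have e1 : cplFourier g ε (BoundedContinuousFunction.const ℝ 1)
        = fun ξ => ∫ y, (g y : ℂ) * wave 0 0 (-(ε * y)) ξ := by
      funext ξ; simp [cplFourier]
    rwa [e1]
  have key := tendsto_eLpNorm_mul_sub (l := atTop)
    (m := fun n => cplFourier g (e n) (BoundedContinuousFunction.const ℝ 1)) (m₀ := fun _ => 1)
    (C := max 1 (∫ y, ‖g y‖)) (fun n => hmeas _)
    (fun n ξ => (norm_cplFourier_le hg _ ξ).trans (by simp))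
    (tendsto_cplFourier_one hg hg1 he) (fun ξ => by simp) aestronglyMeasurable_const
    (Lp.memLp (duhL2 g 0 (frozen F) a b))
  refine key.congr fun n => ?_
  rw [Lp.enorm_def]
  refine eLpNorm_congr_ae ?_
  filter_upwards [Lp.coeFn_sub (duhL2 g (e n) (frozen F) a b) (duhL2 g 0 (frozen F) a b),
    duhL2_ae (ε := e n) hg hFf a b, duhL2_ae (ε := 0) hg hFf a b] with ξ h1 h2 h3
  rw [h1, Pi.sub_apply, h2, h3, hprof (e n), hprof0, one_mul]

theorem tendsto_duhL2 (hg : Integrable g) (hg1 : ∫ y, g y = 1) (hF : MemLp F (4 / 3) volume)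
    (he : Tendsto e atTop (𝓝 0)) (a b : ℝ) :
    Tendsto (fun n => ‖duhL2 g (e n) F a b - duhL2 g 0 F a b‖ₑ) atTop (𝓝 0) := by
  have hFf := memLp_frozen hF
  have hv := hF.sub hFf
  have h1 : Tendsto (fun n => ‖duhL2 g (e n) (F - frozen F) a b‖ₑ) atTop (𝓝 0) := by
    have h2 := ENNReal.Tendsto.const_mul (a := 4)
      ((ENNReal.continuous_rpow_const (y := 3 / 4)).tendsto _ |>.comp
        (tendsto_lintegral_cplSize_sub_frozen hg hF he)) (Or.inr (by norm_num))
    simp only [Function.comp_def] at h2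
    rw [ENNReal.zero_rpow_of_pos (by norm_num), mul_zero] at h2
    refine tendsto_of_tendsto_of_tendsto_of_le_of_le tendsto_const_nhds h2 (fun _ => bot_le)
      fun n => (enorm_duhL2_le_cplSize hg hv a b).trans ?_
    gcongr
    exact Measure.restrict_le_self
  have h3 := h1.add (tendsto_duhL2_frozen hg hg1 hF he a b)
  rw [add_zero] at h3
  refine tendsto_of_tendsto_of_tendsto_of_le_of_le tendsto_const_nhds h3 (fun _ => bot_le) fun n => ?_
  refine le_trans (le_of_eq ?_) (enorm_add_le _ _)
  have e0 : duhL2 g 0 F a b = duhL2 g 0 (frozen F) a b := duhL2_zero_eq_frozen a b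
  rw [duhL2_sub hg hF hFf, e0, sub_add_sub_cancel]

/-- Convergence of the Duhamel integrals in `L²`, uniformly in time, as the coupling concentrates. -/
theorem eventually_enorm_duhL2_sub_le (hg : Integrable g) (hg1 : ∫ y, g y = 1)
    (hF : MemLp F (4 / 3) volume) (he : Tendsto e atTop (𝓝 0)) {η : ℝ≥0∞} (hη : 0 < η) :
    ∀ᶠ n in atTop, ∀ t, ‖duhL2 g (e n) F 0 t - duhL2 g 0 F 0 t‖ₑ ≤ η := by
  have hG := mass_ne_top hg
  have hη2 : 0 < η / 2 := ENNReal.half_pos hη.ne'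
  obtain ⟨f, hfi, hf0, hmass⟩ := exists_primitive_rpow_four_thirds hF
  set Ψ : ℝ → ℝ := fun t => ∫ s in (0 : ℝ)..t, f s with hΨ
  have hmassΨ : ∀ t' t, ∫⁻ s in uIoc t' t, ‖F s‖ₑ ^ (4 / 3 : ℝ) = ENNReal.ofReal |Ψ t - Ψ t'| := hmass
  have hbdd : Bornology.IsBounded (range Ψ) := by
    refine isBounded_iff_forall_norm_le.2 ⟨∫ s, f s, ?_⟩
    rintro _ ⟨t, rfl⟩
    rw [hΨ, Real.norm_eq_abs, intervalIntegral.abs_integral_eq_abs_integral_uIoc,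
      abs_of_nonneg (integral_nonneg fun s => hf0 s)]
    exact setIntegral_le_integral hfi (ae_of_all _ hf0)
  -- By the dual Strichartz estimate, a time interval of L^{4/3} mass below ρ changes both Duhamel
  -- integrals together by at most η/2, whatever ε is.
  obtain ⟨ρ, hρ, hρη⟩ : ∃ ρ : ℝ, 0 < ρ ∧
      2 * (4 * mass g * ENNReal.ofReal ρ ^ (3 / 4 : ℝ)) ≤ η / 2 := by
    have h1 : Tendsto (fun ρ : ℝ => 2 * (4 * mass g * ENNReal.ofReal ρ ^ (3 / 4 : ℝ))) (𝓝 0)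
        (𝓝 (2 * (4 * mass g * ENNReal.ofReal 0 ^ (3 / 4 : ℝ)))) :=
      ENNReal.Tendsto.const_mul (ENNReal.Tendsto.const_mul
        ((ENNReal.continuous_rpow_const.comp ENNReal.continuous_ofReal).tendsto 0)
        (Or.inr (by finiteness))) (Or.inr (by finiteness))
    rw [ENNReal.ofReal_zero, ENNReal.zero_rpow_of_pos (by norm_num), mul_zero, mul_zero] at h1
    have h2 := (h1.mono_left nhdsWithin_le_nhds : Tendsto _ (𝓝[>] (0 : ℝ)) _).eventually
      (ge_mem_nhds hη2)
    obtain ⟨ρ, h3, h4⟩ := (h2.and self_mem_nhdsWithin).exists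
    exact ⟨ρ, h4, h3⟩
  -- The time line is not compact, but the range of the primitive is totally bounded. Finitely many
  -- times come within mass ρ of every time, and at these the pointwise convergence is simultaneous.
  obtain ⟨T, hTsub, hTfin, hT⟩ := Metric.finite_approx_of_totallyBounded
    (hbdd.isCompact_closure.totallyBounded.subset subset_closure) ρ hρ
  have hTsub' : ∀ y ∈ T, ∃ t, Ψ t = y := hTsub
  choose! τ hτ using hTsub'
  have hev : ∀ᶠ n in atTop, ∀ y ∈ T,
      ‖duhL2 g (e n) F 0 (τ y) - duhL2 g 0 F 0 (τ y)‖ₑ ≤ η / 2 :=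
    (eventually_all_finite hTfin).2 fun y _ =>
      (tendsto_duhL2 hg hg1 hF he 0 (τ y)).eventually (ge_mem_nhds hη2)
  filter_upwards [hev] with n hn t
  obtain ⟨y, hyT, hy⟩ := mem_iUnion₂.1 (hT (mem_range_self t))
  rw [Metric.mem_ball, Real.dist_eq, ← hτ y hyT] at hy
  have hb : ∀ ε, ‖duhL2 g ε F (τ y) t‖ₑ ≤ 4 * mass g * ENNReal.ofReal ρ ^ (3 / 4 : ℝ) := fun ε => by
    refine (enorm_duhL2_le hg hF _ _).trans ?_
    rw [hmassΨ]
    gcongr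
  rw [← duhL2_add_adjacent (ε := e n) hg hF 0 (τ y) t, ← duhL2_add_adjacent (ε := 0) hg hF 0 (τ y) t,
    add_sub_add_comm]
  calc _ ≤ η / 2 + (4 * mass g * ENNReal.ofReal ρ ^ (3 / 4 : ℝ)
        + 4 * mass g * ENNReal.ofReal ρ ^ (3 / 4 : ℝ)) :=
        (enorm_add_le _ _).trans (add_le_add (hn y hyT)
          (enorm_sub_le.trans (add_le_add (hb _) (hb _))))
    _ ≤ η / 2 + η / 2 := by
        gcongr
        rwa [← two_mul]
    _ = η := ENNReal.add_halves η

end Convergence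

/-! ### Identification of the couplings as signed measures -/

/-- The vector-measure integral is reduced to ordinary integrals by splitting the density into
positive and negative parts. -/
theorem integral_withDensityᵥ {h : ℝ → ℝ} (hh : Integrable h) {f : ℝ → ℂ} (hf : Continuous f)
    {C : ℝ} (hC : ∀ x, ‖f x‖ ≤ C) :
    ∫ᵛ x, f x ∂<•(volume : Measure ℝ).withDensityᵥ h = ∫ x, (h x : ℂ) * f x := by
  rw [withDensityᵥ_eq_withDensity_pos_part_sub_withDensity_neg_part hh]
  have i1 := isFiniteMeasure_withDensity_ofReal hh.2
  have i2 := isFiniteMeasure_withDensity_ofReal hh.neg.2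
  have hb : ∀ (μ : Measure ℝ) [IsFiniteMeasure μ], Integrable f μ := fun μ _ =>
    (integrable_const C).mono' hf.aestronglyMeasurable (ae_of_all _ hC)
  have hv : ∀ (μ : Measure ℝ) [IsFiniteMeasure μ], μ.toSignedMeasure.Integrable f := fun μ _ => by
    have := hb μ
    rwa [← Measure.variation_toSignedMeasure (μ := μ)] at this
  have hcalc : ∀ k : ℝ → ℝ, Integrable k →
      ∫ x, f x ∂((volume : Measure ℝ).withDensity fun x => ENNReal.ofReal (k x))
        = ∫ x, ((max (k x) 0 : ℝ) : ℂ) * f x := fun k hk => by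
    rw [integral_withDensity_eq_integral_toReal_smul₀ hk.1.aemeasurable.ennreal_ofReal
      (ae_of_all _ fun x => ENNReal.ofReal_lt_top)]
    simp_rw [ENNReal.toReal_ofReal', Complex.real_smul]
  have hi : ∀ k : ℝ → ℝ, Integrable k → Integrable fun x => ((max (k x) 0 : ℝ) : ℂ) * f x :=
    fun k hk => (hk.pos_part.ofReal).mul_bdd (c := C) hf.aestronglyMeasurable (ae_of_all _ hC)
  rw [VectorMeasure.integral_sub_vectorMeasure (hv _) (hv _), VectorMeasure.integral_toSignedMeasure,
    VectorMeasure.integral_toSignedMeasure, hcalc h hh, hcalc (fun x => -h x) hh.neg,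
    ← integral_sub (hi h hh) (hi (fun x => -h x) hh.neg)]
  refine integral_congr_ae (ae_of_all _ fun x => ?_)
  simp only
  rw [← sub_mul, ← Complex.ofReal_sub]
  congr 2
  exact max_zero_sub_max_neg_zero_eq_self (h x)

theorem integrable_rescaledCoupling {g : ℝ → ℝ} (hg : Integrable g) {ε : ℝ} (hε : 0 < ε) :
    Integrable (rescaledCoupling g ε) :=
  (hg.comp_div hε.ne').const_mul _

/-- The change of variables y ↦ εy moves the parameter from the density into the position of
evaluation, where it may later be set to zero. -/
theorem cubicFourier_couplingMeasure {g : ℝ → ℝ} (hg : Integrable g) {ε : ℝ} (hε : 0 < ε)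
    (v : ℝ →ᵇ ℂ) (ξ : ℝ) :
    cubicFourier (couplingMeasure g ε) v ξ = cplFourier g ε (cubic v) ξ := by
  have e1 : ∀ y : ℝ, Complex.exp ((-(2 * Real.pi * y * ξ) : ℝ) * Complex.I)
      * ((‖v y‖ ^ 2 : ℝ) * v y) = wave 0 0 (-y) ξ * cubic v y := fun y => by
    rw [cubic_apply, wave]
    congr 2
    push_cast
    ring
  rw [cubicFourier, couplingMeasure]
  simp_rw [e1]
  rw [integral_withDensityᵥ (integrable_rescaledCoupling hg hε) (C := ‖cubic v‖)]
  · have h2 := Measure.integral_comp_mul_left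
      (fun y => cubic v (ε * y) * g y * wave 0 0 (-(ε * y)) ξ) ε⁻¹
    rw [inv_inv, abs_of_pos hε] at h2
    have h3 : cplFourier g ε (cubic v) ξ = (ε⁻¹ : ℝ) • (ε • cplFourier g ε (cubic v) ξ) := by
      rw [smul_smul, inv_mul_cancel₀ hε.ne', one_smul]
    rw [h3]
    nth_rewrite 1 [cplFourier]
    rw [← h2, ← integral_smul]
    refine integral_congr_ae (ae_of_all _ fun x => ?_)
    simp only [rescaledCoupling]
    rw [mul_inv_cancel_left₀ hε.ne', div_eq_inv_mul, Complex.real_smul]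
    push_cast
    ring
  · exact (Continuous.wave (by fun_prop) (by fun_prop) (by fun_prop) (by fun_prop)).mul
      (cubic v).continuous
  · intro x
    rw [norm_mul]
    calc _ ≤ 1 * ‖cubic v‖ := by
          gcongr
          · exact norm_wave_le_one le_rfl _ _ _
          · exact (cubic v).norm_coe_le_norm x
      _ = _ := one_mul _

theorem cubicFourier_deltaMeasure {g : ℝ → ℝ} (hg1 : ∫ y, g y = 1) (v : ℝ →ᵇ ℂ) (ξ : ℝ) :
    cubicFourier deltaMeasure v ξ = cplFourier g 0 (cubic v) ξ := by
  rw [cplFourier_zero, hg1, cubicFourier, deltaMeasure, VectorMeasure.integral_dirac, cubic_apply]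
  simp

/-! ### Mild solutions versus L² solutions, and uniqueness -/

section Flow

variable {g : ℝ → ℝ} {ε : ℝ} {u v : ℝ → ℝ →ᵇ ℂ} {h : L2R}

/-- The `L²` flow with initial data `𝓕⁻ h` that is driven by the nonlinearity `|u|² u`. -/
def mildFlow (g : ℝ → ℝ) (ε : ℝ) (h : L2R) (u : ℝ → ℝ →ᵇ ℂ) (t : ℝ) : L2R :=
  𝓕⁻ (phase t (h - Complex.I • duhL2 g ε (fun s => cubic (u s)) 0 t))

theorem fourier_mildFlow (t : ℝ) :
    𝓕 (mildFlow g ε h u t) = phase t (h - Complex.I • duhL2 g ε (fun s => cubic (u s)) 0 t) :=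
  FourierTransform.fourier_fourierInv_eq _

theorem mildFlow_zero : mildFlow g ε h u 0 = 𝓕⁻ h := by
  rw [mildFlow, phase_zero, duhL2_self, smul_zero, sub_zero]

theorem fourier_sub_smul (k k' : L2R) (c : ℂ) : 𝓕 (k - c • k') = (𝓕 k - c • 𝓕 k' : L2R) := by
  have := map_sub (Lp.fourierTransformₗᵢ ℝ ℂ) k (c • k')
  rwa [map_smul] at this

theorem fourierInv_sub_smul (k k' : L2R) (c : ℂ) :
    𝓕⁻ (k - c • k') = (𝓕⁻ k - c • 𝓕⁻ k' : L2R) := by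
  have := map_sub (Lp.fourierTransformₗᵢ ℝ ℂ).symm k (c • k')
  rwa [map_smul] at this

theorem enorm_I_smul {E : Type*} [NormedAddCommGroup E] [NormedSpace ℂ E] (x : E) :
    ‖Complex.I • x‖ₑ = ‖x‖ₑ := by
  rw [enorm_smul]
  simp [enorm_eq_nnnorm]

theorem enorm_fourierInv_sub (k k' : L2R) : ‖(𝓕⁻ k - 𝓕⁻ k' : L2R)‖ₑ = ‖k - k'‖ₑ := by
  have h1 : (𝓕⁻ k - 𝓕⁻ k' : L2R) = 𝓕⁻ (k - k') := by
    simpa using (fourierInv_sub_smul k k' 1).symm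
  rw [h1, ← ofReal_norm, ← ofReal_norm, ← Lp.norm_fourier_eq,
    FourierTransform.fourier_fourierInv_eq]

theorem enorm_phase (t : ℝ) (k : L2R) : ‖phase t k‖ₑ = ‖k‖ₑ := by
  rw [← ofReal_norm, norm_phase, ofReal_norm]

theorem enorm_mildFlow_sub_le {ε' : ℝ} {h' : L2R} (t : ℝ) :
    ‖mildFlow g ε h u t - mildFlow g ε' h' v t‖ₑ ≤ ‖h - h'‖ₑ
      + ‖duhL2 g ε (fun s => cubic (u s)) 0 t - duhL2 g ε' (fun s => cubic (v s)) 0 t‖ₑ := by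
  rw [mildFlow, mildFlow, enorm_fourierInv_sub, ← phase_sub, enorm_phase, sub_sub_sub_comm,
    ← smul_sub]
  refine enorm_sub_le.trans ?_
  rw [enorm_I_smul]

theorem continuous_mildFlow (hg : Integrable g) (hu : MemLp u 4 volume) :
    Continuous (mildFlow g ε h u) := by
  have h1 : Continuous fun t => phase t (h - Complex.I • duhL2 g ε (fun s => cubic (u s)) 0 t) :=
    continuousOn_univ.1 (continuousOn_phase_comp
      (continuous_const.sub ((continuous_duhL2 hg hu.cubic 0).const_smul Complex.I)).continuousOn)
  exact (Lp.fourierTransformₗᵢ ℝ ℂ).symm.continuous.comp h1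

theorem exists_enorm_duhL2_le (hg : Integrable g) {F : ℝ → ℝ →ᵇ ℂ} (hF : MemLp F (4 / 3) volume) :
    ∃ B : ℝ≥0∞, B ≠ ∞ ∧ ∀ a b, ‖duhL2 g ε F a b‖ₑ ≤ B := by
  have h1 := mass_ne_top hg
  have h2 := lintegral_rpow_four_thirds_ne_top hF
  refine ⟨4 * mass g * (∫⁻ s, ‖F s‖ₑ ^ (4 / 3 : ℝ)) ^ (3 / 4 : ℝ), ?_, fun a b => ?_⟩
  · have := (ENNReal.rpow_lt_top_of_nonneg (y := 3 / 4) (by norm_num) h2).ne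
    finiteness
  · refine (enorm_duhL2_le hg hF a b).trans ?_
    gcongr
    exact Measure.restrict_le_self

theorem exists_norm_mildFlow_le (hg : Integrable g) (hu : MemLp u 4 volume) :
    ∃ C : ℝ, ∀ t, ‖mildFlow g ε h u t‖ ≤ C := by
  obtain ⟨B, hB, H⟩ := exists_enorm_duhL2_le (ε := ε) hg hu.cubic
  refine ⟨(‖h‖ₑ + B).toReal, fun t => ?_⟩
  rw [← toReal_enorm]
  refine ENNReal.toReal_mono (by finiteness) ?_
  rw [← ofReal_norm, ← Lp.norm_fourier_eq, fourier_mildFlow, ofReal_norm, enorm_phase]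
  refine enorm_sub_le.trans ?_
  rw [enorm_I_smul]
  gcongr
  exact H 0 t

theorem freeSymbol_mul_duhProfile (F : ℝ → ℝ →ᵇ ℂ) (a b t ξ : ℝ) :
    freeSymbol t ξ * duhProfile g ε F a b ξ
      = ∫ s in a..b, freeSymbol (t - s) ξ * cplFourier g ε (F s) ξ := by
  rw [duhProfile, ← intervalIntegral.integral_const_mul]
  refine intervalIntegral.integral_congr fun s _ => ?_
  rw [← mul_assoc, freeSymbol_eq_wave, freeSymbol_eq_wave, freeSymbol_eq_wave, wave_mul_wave,
    add_zero, ← sub_eq_add_neg]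

theorem ae_mildFlow_eq (hg : Integrable g) (hu : MemLp u 4 volume) : ∀ᵐ t,
    (mildFlow g ε h u t : ℝ → ℂ) =ᵐ[volume]
      (freeRep h t - Complex.I • duhRep g ε (fun s => cubic (u s)) t : ℝ →ᵇ ℂ) := by
  filter_upwards [ae_hasRep_phase h, ae_hasRep_duhL2 (ε := ε) hg hu.cubic] with t h1 h2
  rw [mildFlow, phase_sub, phase_smul]
  exact (h1.sub (h2.smul _)).ae_eq

theorem IsMild.ae_mildFlow_eq (hg : Integrable g) (hu : MemLp u 4 volume)
    (hmild : IsMild g ε (freeRep h) u) :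
    ∀ᵐ t, (mildFlow g ε h u t : ℝ → ℂ) =ᵐ[volume] (u t : ℝ → ℂ) := by
  filter_upwards [_root_.ae_mildFlow_eq (ε := ε) (h := h) hg hu, hmild] with t h1 h2
  rwa [h2]

variable {μ : SignedMeasure ℝ}

/-- The propagator factors out of the time integral as a phase. Only the values between a and t
matter, so a solution known on an interval may be replaced by a globally defined truncation. -/
theorem isDuhamelIntegral_iff (hg : Integrable g)
    (hμ : ∀ v ξ, cubicFourier μ v ξ = cplFourier g ε (cubic v) ξ) (hu : MemLp u 4 volume)
    {a t : ℝ} (hv : ∀ s ∈ uIoc a t, v s = u s) {w : L2R} :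
    IsDuhamelIntegral μ v a t w ↔ 𝓕 w = phase t (duhL2 g ε (fun s => cubic (u s)) a t) := by
  have e : (phase t (duhL2 g ε (fun s => cubic (u s)) a t) : ℝ → ℂ) =ᵐ[volume]
      fun ξ => ∫ s in a..t, freeSymbol (t - s) ξ * cubicFourier μ (v s) ξ := by
    filter_upwards [phase_ae t (duhL2 g ε (fun s => cubic (u s)) a t),
      duhL2_ae (ε := ε) hg hu.cubic a t] with ξ h1 h2
    rw [h1, h2, freeSymbol_mul_duhProfile]
    simp_rw [hμ]
    refine intervalIntegral.integral_congr_ae (ae_of_all _ fun s hs => ?_)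
    rw [hv s hs]
  constructor
  · intro H
    refine Lp.ext ?_
    filter_upwards [H, e] with ξ h1 h2
    rw [h1, h2]
  · intro H
    rw [IsDuhamelIntegral, H]
    exact e

theorem freeEvolution_fourierInv (t : ℝ) (k : L2R) : freeEvolution t (𝓕⁻ k) = 𝓕⁻ (phase t k) := by
  rw [freeEvolution_eq, FourierTransform.fourier_fourierInv_eq]

theorem isNLSSolution_mildFlow (hg : Integrable g)
    (hμ : ∀ v ξ, cubicFourier μ v ξ = cplFourier g ε (cubic v) ξ) (hu : MemLp u 4 volume)
    (hmild : IsMild g ε (freeRep h) u) {I : Set ℝ} (hI : I.OrdConnected) (h0 : 0 ∈ I) :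
    IsNLSSolution μ I (mildFlow g ε h u) := by
  obtain ⟨C, hC⟩ := exists_norm_mildFlow_le (ε := ε) (h := h) hg hu
  refine ⟨hI, (continuous_mildFlow hg hu).continuousOn, ⟨C, fun t _ => hC t⟩, u,
    fun J _ _ => hu.restrict J, ae_restrict_of_ae (hmild.ae_mildFlow_eq hg hu), 0, h0, fun t _ => ?_⟩
  refine ⟨𝓕⁻ (phase t (duhL2 g ε (fun s => cubic (u s)) 0 t)), ?_, ?_⟩
  · rw [isDuhamelIntegral_iff hg hμ hu fun _ _ => rfl]
    exact FourierTransform.fourier_fourierInv_eq _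
  · rw [mildFlow_zero, sub_zero, freeEvolution_fourierInv, mildFlow, phase_sub, phase_smul,
      fourierInv_sub_smul]

/-- A solution on an arbitrary interval is truncated to a compact one, which makes its
representative globally L⁴, and its base time is moved from t₀ to 0 by additivity of Duhamel
integrals. -/
theorem IsNLSSolution.exists_mild (hg : Integrable g)
    (hμ : ∀ v ξ, cubicFourier μ v ξ = cplFourier g ε (cubic v) ξ) {I : Set ℝ} {φ : ℝ → L2R}
    (hφ : IsNLSSolution μ I φ) (h0 : 0 ∈ I) {t : ℝ} (ht : t ∈ I) :
    ∃ a b v, 0 ∈ Icc a b ∧ t ∈ Icc a b ∧ MemLp v 4 volume ∧ (∀ s ∉ Icc a b, v s = 0) ∧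
      (∀ s ∈ Icc a b, φ s = mildFlow g ε (𝓕 (φ 0)) v s) ∧
      ∀ᵐ s ∂(volume.restrict (Icc a b)),
        v s = freeRep (𝓕 (φ 0)) s - Complex.I • duhRep g ε (fun r => cubic (v r)) s := by
  obtain ⟨hI, -, -, u, hu, hrep, t₀, ht₀, hduh⟩ := hφ
  -- The interval must also contain t₀, since the Duhamel formula for the solution is anchored
  -- there.
  set a := min (min 0 t) t₀ with ha
  set b := max (max 0 t) t₀ with hb
  have h0J : 0 ∈ Icc a b := by simp [ha, hb]
  have htJ : t ∈ Icc a b := by simp [ha, hb]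
  have ht₀J : t₀ ∈ Icc a b := by simp [ha, hb]
  have hJI : Icc a b ⊆ I := by
    refine hI.out ?_ ?_
    · rcases min_choice (min 0 t) t₀ with h | h <;> rw [ha, h]
      · rcases min_choice 0 t with h | h <;> rwa [h]
      · exact ht₀
    · rcases max_choice (max 0 t) t₀ with h | h <;> rw [hb, h]
      · rcases max_choice 0 t with h | h <;> rwa [h]
      · exact ht₀
  set v := (Icc a b).indicator u with hv
  have hvm : MemLp v 4 volume :=
    (memLp_indicator_iff_restrict measurableSet_Icc).2 (hu _ isCompact_Icc hJI)
  have hphase : ∀ s ∈ Icc a b, 𝓕 (φ s) = phase s (phase (-t₀) (𝓕 (φ t₀))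
      - Complex.I • duhL2 g ε (fun r => cubic (v r)) t₀ s) := fun s hs => by
    obtain ⟨w, hw, hws⟩ := hduh s (hJI hs)
    rw [isDuhamelIntegral_iff hg hμ hvm fun r hr => ?_] at hw
    · rw [phase_sub, phase_smul, ← hw, phase_phase, ← sub_eq_add_neg]
      have h1 : 𝓕 (φ s) = 𝓕 (freeEvolution (s - t₀) (φ t₀)) - Complex.I • 𝓕 w := by
        rw [hws, fourier_sub_smul]
      rw [h1, freeEvolution_eq, FourierTransform.fourier_fourierInv_eq]
    · rw [hv, indicator_of_mem]
      exact uIoc_subset_uIcc.trans (uIcc_subset_Icc ht₀J hs) hr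
  have hflow : ∀ s ∈ Icc a b, φ s = mildFlow g ε (𝓕 (φ 0)) v s := fun s hs => by
    have h1 := hphase 0 h0J
    rw [phase_zero] at h1
    have h2 : 𝓕 (φ s) = phase s (𝓕 (φ 0) - Complex.I • duhL2 g ε (fun r => cubic (v r)) 0 s) := by
      rw [hphase s hs, h1, ← duhL2_add_adjacent hg hvm.cubic t₀ 0 s, smul_add]
      congr 1
      abel
    rw [mildFlow, ← h2, FourierTransform.fourierInv_fourier_eq]
  refine ⟨a, b, v, h0J, htJ, hvm, fun s hs => indicator_of_notMem hs _, hflow, ?_⟩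
  filter_upwards [ae_restrict_of_ae (_root_.ae_mildFlow_eq (ε := ε) (h := 𝓕 (φ 0)) hg hvm),
    ae_restrict_of_ae_restrict_of_subset hJI hrep, ae_restrict_mem measurableSet_Icc]
    with s h1 h2 h3
  rw [← hflow s h3] at h1
  -- At almost every time the given representative and the one from the linear theory represent the
  -- same L² function. Both are continuous in space, hence equal everywhere.
  have h4 := (Continuous.ae_eq_iff_eq volume (u s).continuous (BoundedContinuousFunction.continuous _)).1
    (h2.symm.trans h1)
  rw [hv, indicator_of_mem h3]
  exact DFunLike.coe_injective h4

/-- The truncation of the global solution solves the same integral equation on the compact interval,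
because Duhamel integrals started at 0 never look outside it. Uniqueness for mild solutions then
identifies the two. -/
theorem IsNLSSolution.eqOn_mildFlow (hg : Integrable g)
    (hμ : ∀ v ξ, cubicFourier μ v ξ = cplFourier g ε (cubic v) ξ) (hu : MemLp u 4 volume)
    (hmild : IsMild g ε (freeRep h) u) {I : Set ℝ} {φ : ℝ → L2R} (hφ : IsNLSSolution μ I φ)
    (h0 : 0 ∈ I) (hφ0 : φ 0 = 𝓕⁻ h) : EqOn φ (mildFlow g ε h u) I := by
  intro t ht
  obtain ⟨a, b, v, h0J, htJ, hv, hv0, hflow, hveq⟩ := hφ.exists_mild hg hμ h0 ht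
  have e : 𝓕 (φ 0) = h := by rw [hφ0, FourierTransform.fourier_fourierInv_eq]
  rw [e] at hflow hveq
  set u' := (Icc a b).indicator u with hu'
  have hsub : ∀ s ∈ Icc a b, uIoc 0 s ⊆ Icc a b := fun s hs =>
    uIoc_subset_uIcc.trans (uIcc_subset_Icc h0J hs)
  have hcub : ∀ s ∈ Icc a b, ∀ᵐ r ∂(volume.restrict (uIoc 0 s)), cubic (u r) = cubic (u' r) :=
    fun s hs => by
      filter_upwards [ae_restrict_mem measurableSet_uIoc] with r hr
      rw [hu', indicator_of_mem (hsub s hs hr)]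
  have huv : u' =ᵐ[volume] v := by
    refine IsMild.ae_eq_on hg measurableSet_Icc (hu.indicator measurableSet_Icc) hv
      (fun s hs => ?_) ?_ hveq
    · rw [hv0 s hs, hu', indicator_of_notMem hs]
    · filter_upwards [ae_restrict_of_ae hmild, ae_restrict_mem measurableSet_Icc] with s h1 h2
      rw [← duhRep_congr (hcub s h2), hu', indicator_of_mem h2, ← h1]
  rw [hflow t htJ, mildFlow, mildFlow, duhL2_congr (hcub t htJ)]
  rw [duhL2_congr (F := fun r => cubic (v r)) (F' := fun r => cubic (u' r))]
  refine ae_restrict_of_ae ?_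
  filter_upwards [huv] with r hr
  rw [hr]

theorem isUniqueGlobalSolution_mildFlow (hg : Integrable g)
    (hμ : ∀ v ξ, cubicFourier μ v ξ = cplFourier g ε (cubic v) ξ) {ψ₀ : L2R}
    (hu : MemLp u 4 volume) (hmild : IsMild g ε (freeRep (𝓕 ψ₀)) u) :
    IsUniqueGlobalSolution μ ψ₀ (mildFlow g ε (𝓕 ψ₀) u) := by
  have e : 𝓕⁻ (𝓕 ψ₀) = ψ₀ := FourierTransform.fourierInv_fourier_eq _
  refine ⟨isNLSSolution_mildFlow hg hμ hu hmild ordConnected_univ (mem_univ _),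
    (mildFlow_zero).trans e, fun I φ h0 hφ hφ0 => ?_⟩
  exact hφ.eqOn_mildFlow hg hμ hu hmild h0 (hφ0.trans e.symm)

end Flow

/-! ### Stability, continuous dependence and scattering -/

section Stability

variable {g : ℝ → ℝ} {ε : ℝ} {u v : ℝ → ℝ →ᵇ ℂ} {h : L2R}

/-- The dual Strichartz estimate and Hölder transfer closeness in L⁴ of the representatives to
closeness in L² of the profiles, uniformly in time and in ε. -/
theorem enorm_duhL2_cubic_sub_le (hg : Integrable g) (hu : MemLp u 4 volume)
    (hv : MemLp v 4 volume) (t : ℝ) :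
    ‖duhL2 g ε (fun s => cubic (u s)) 0 t - duhL2 g ε (fun s => cubic (v s)) 0 t‖ₑ ≤
      8 * mass g * (eLpNorm u 4 volume + eLpNorm v 4 volume) ^ (2 : ℝ)
        * eLpNorm (u - v) 4 volume := by
  have h1 := enorm_duhL2_le (ε := ε) hg (hu.cubic.sub hv.cubic) 0 t
  rw [duhL2_sub hg hu.cubic hv.cubic] at h1
  refine h1.trans ?_
  set a : ℝ → ℝ≥0∞ := fun s => ‖u s‖ₑ + ‖v s‖ₑ with ha
  set b : ℝ → ℝ≥0∞ := fun s => 2 * ‖u s - v s‖ₑ with hb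
  have ham : AEMeasurable a := hu.1.enorm.add hv.1.enorm
  have hbm : AEMeasurable b := ((hu.sub hv).1.enorm.const_mul 2)
  have h2 := lintegral_sq_mul_rpow_le ham hbm
  have ha4 : eLpNorm a 4 volume ≤ eLpNorm u 4 volume + eLpNorm v 4 volume := by
    have h3 := eLpNorm_add_le (μ := volume) hu.1.enorm.aestronglyMeasurable
      hv.1.enorm.aestronglyMeasurable (p := 4) (by norm_num)
    rwa [eLpNorm_enorm, eLpNorm_enorm] at h3
  have hb4 : eLpNorm b 4 volume ≤ 2 * eLpNorm (u - v) 4 volume := by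
    have h3 := eLpNorm_four_le_of_ae_le (μ := volume) (c := 2) (by norm_num) (f := b)
      (h := fun t => ‖(u - v) t‖ₑ) (ae_of_all _ fun t => le_rfl)
    rwa [eLpNorm_enorm] at h3
  have ha' : ∫⁻ s, a s ^ (4 : ℝ) = eLpNorm a 4 volume ^ (4 : ℝ) := (eLpNorm_four_rpow a).symm
  have hb' : ∫⁻ s, b s ^ (4 : ℝ) = eLpNorm b 4 volume ^ (4 : ℝ) := (eLpNorm_four_rpow b).symm
  calc _ ≤ 4 * mass g * (∫⁻ s, (a s ^ (2 : ℝ) * b s) ^ (4 / 3 : ℝ)) ^ (3 / 4 : ℝ) := by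
        gcongr 4 * mass g * ?_ ^ (3 / 4 : ℝ)
        refine (setLIntegral_le_lintegral _ _).trans (lintegral_mono fun s => ?_)
        gcongr
        refine (enorm_cubic_sub_le _ _).trans ?_
        calc _ = (‖u s‖ₑ ^ (2 : ℝ) + ‖v s‖ₑ ^ (2 : ℝ)) * (2 * ‖u s - v s‖ₑ) := by ring
          _ ≤ _ := by
            gcongr
            exact ENNReal.add_rpow_le_rpow_add _ _ (by norm_num)
    _ ≤ 4 * mass g * ((∫⁻ s, a s ^ (4 : ℝ)) ^ (2 / 3 : ℝ)
          * (∫⁻ s, b s ^ (4 : ℝ)) ^ (1 / 3 : ℝ)) ^ (3 / 4 : ℝ) := by gcongr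
    _ = 4 * mass g * (eLpNorm a 4 volume ^ (2 : ℝ) * eLpNorm b 4 volume) := by
        rw [ha', hb', ENNReal.mul_rpow_of_nonneg _ _ (by norm_num)]
        simp only [← ENNReal.rpow_mul]
        norm_num
    _ ≤ 4 * mass g * ((eLpNorm u 4 volume + eLpNorm v 4 volume) ^ (2 : ℝ)
          * (2 * eLpNorm (u - v) 4 volume)) := by gcongr
    _ = _ := by ring

/-- Perturbation theory supplemented by the L² estimate, with a single linear constant for both
norms. -/
theorem exists_stability (hg : Integrable g) (A : NNReal) : ∃ δ : NNReal, 0 < δ ∧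
    ∃ L : NNReal, ∀ (ε : ℝ) (u f d : ℝ → ℝ →ᵇ ℂ), MemLp u 4 volume → eLpNorm u 4 volume ≤ A →
      MemLp d 4 volume → eLpNorm d 4 volume ≤ δ → IsMild g ε f u →
        ∃ v, MemLp v 4 volume ∧ IsMild g ε (f + d) v ∧
          eLpNorm (v - u) 4 volume ≤ L * eLpNorm d 4 volume ∧
          ∀ t, ‖duhL2 g ε (fun s => cubic (v s)) 0 t - duhL2 g ε (fun s => cubic (u s)) 0 t‖ₑ
            ≤ L * eLpNorm d 4 volume := by
  obtain ⟨δ, hδ, C, H⟩ := exists_perturbation hg A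
  set G : NNReal := (mass g).toNNReal with hGdef
  have hG : mass g = G := (ENNReal.coe_toNNReal (mass_ne_top hg)).symm
  -- The second bound keeps the correction below 1 in L⁴. The quadratic factor of the L² estimate is
  -- then at most (1 + 2A)², and the estimate stays linear in d.
  refine ⟨min δ (C + 1)⁻¹, by positivity, max C (8 * G * (1 + A + A) ^ (2 : ℝ) * C),
    fun ε u f d hu huA hd hdδ hmild => ?_⟩
  obtain ⟨r, hr, hmild', hrd⟩ := H ε u f d hu huA hd
    (hdδ.trans (by exact_mod_cast min_le_left _ _)) hmild
  have hr1 : eLpNorm r 4 volume ≤ (1 : NNReal) := by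
    refine hrd.trans ?_
    calc (C : ℝ≥0∞) * eLpNorm d 4 volume ≤ C * ((C + 1)⁻¹ : NNReal) := by
          gcongr
          exact hdδ.trans (by exact_mod_cast min_le_right _ _)
      _ ≤ _ := by
          rw [← ENNReal.coe_mul, ENNReal.coe_le_coe, ← div_eq_mul_inv]
          exact div_le_one_of_le₀ le_self_add (by positivity)
  refine ⟨u + r, hu.add hr, hmild', ?_, fun t => ?_⟩
  · rw [add_sub_cancel_left]
    refine hrd.trans ?_
    gcongr
    exact le_max_left _ _
  · refine (enorm_duhL2_cubic_sub_le hg (hu.add hr) hu t).trans ?_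
    rw [add_sub_cancel_left]
    have hsum : eLpNorm (u + r) 4 volume + eLpNorm u 4 volume ≤ ((1 + A + A : NNReal) : ℝ≥0∞) := by
      push_cast
      rw [add_comm (1 : ℝ≥0∞)]
      refine add_le_add ((eLpNorm_add_le hu.1 hr.1 (by norm_num)).trans (add_le_add huA ?_)) huA
      exact_mod_cast hr1
    calc _ ≤ 8 * (G : ℝ≥0∞) * ((1 + A + A : NNReal) : ℝ≥0∞) ^ (2 : ℝ)
          * (C * eLpNorm d 4 volume) := by
          rw [hG]
          gcongr
      _ = ((8 * G * (1 + A + A) ^ (2 : ℝ) * C : NNReal) : ℝ≥0∞) * eLpNorm d 4 volume := by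
          rw [ENNReal.coe_mul, ENNReal.coe_mul, ENNReal.coe_mul,
            ← ENNReal.coe_rpow_of_nonneg _ (by norm_num : (0 : ℝ) ≤ 2)]
          push_cast
          ring
      _ ≤ _ := by
          gcongr
          exact le_max_right _ _

theorem memLp_freeRep (h : L2R) : MemLp (freeRep h) 4 volume := by
  refine ⟨aestronglyMeasurable_freeRep h, ?_⟩
  rw [eLpNorm_lt_top_iff_lintegral_rpow_enorm_lt_top (by norm_num) (by finiteness)]
  have := (lintegral_freeRep_le h).trans_lt (by finiteness)
  simpa using this

theorem eLpNorm_freeRep_le (h : L2R) : eLpNorm (freeRep h) 4 volume ≤ 12 * ‖h‖ₑ := by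
  rw [← ENNReal.rpow_le_rpow_iff (z := 4) (by norm_num), eLpNorm_four_rpow,
    ENNReal.mul_rpow_of_nonneg _ _ (by norm_num)]
  refine (lintegral_freeRep_le h).trans ?_
  gcongr
  rw [show (4 : ℝ) = ((4 : ℕ) : ℝ) by norm_num, ENNReal.rpow_natCast]
  norm_num

theorem ae_freeRep_add_sub (h h' : L2R) :
    ∀ᵐ t, (freeRep h + freeRep (h' - h)) t = freeRep h' t := by
  filter_upwards [ae_hasRep_phase h, ae_hasRep_phase h', ae_hasRep_phase (h' - h)] with t h1 h2 h3
  have h4 := h1.add h3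
  rw [← phase_add, add_sub_cancel] at h4
  exact h4.unique h2

theorem IsMild.congr {f f' : ℝ → ℝ →ᵇ ℂ} (hu : IsMild g ε f u) (hf : ∀ᵐ t, f t = f' t) :
    IsMild g ε f' u := by
  filter_upwards [hu, hf] with t h1 h2
  rw [h1, h2]

theorem eLpNorm_top_le_enorm (w : ℝ →ᵇ ℂ) : eLpNorm w ∞ volume ≤ ‖w‖ₑ := by
  rw [eLpNorm_exponent_top]
  exact essSup_le_of_ae_le _ (ae_of_all _ fun x => enorm_apply_le w x)

variable {μ : SignedMeasure ℝ}

/-- Perturbing the data amounts to adding a free solution to the forcing. Stability is global in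
time, so the dependence on T is trivial; uniqueness shows that every solution on [-T, T] is the one
constructed. -/
theorem dependsContinuouslyAt_mildFlow (hg : Integrable g)
    (hμ : ∀ v ξ, cubicFourier μ v ξ = cplFourier g ε (cubic v) ξ) (hu : MemLp u 4 volume)
    (hmild : IsMild g ε (freeRep h) u) : DependsContinuouslyAt μ (mildFlow g ε h u) := by
  obtain ⟨δ, hδ, L, H⟩ := exists_stability hg (eLpNorm u 4 volume).toNNReal
  intro T hT η hη
  -- The factor 12 is the Strichartz constant for free solutions. The flow error is at most (1 +
  -- 12L) times the data error, the first summand being that of the data itself.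
  refine ⟨min (δ / 12) (η / (1 + 12 * L)), by positivity, fun φ₀ hφ₀ => ?_⟩
  rw [mildFlow_zero] at hφ₀
  set x := ‖φ₀ - 𝓕⁻ h‖ with hx
  set h' := (𝓕 φ₀ : L2R) with hh'
  have hφ₀' : φ₀ = 𝓕⁻ h' := (FourierTransform.fourierInv_fourier_eq _).symm
  have hxe : ‖h' - h‖ₑ = ENNReal.ofReal x := by
    rw [← enorm_fourierInv_sub, ← hφ₀', ← ofReal_norm]
  have hx0 : 0 ≤ x := norm_nonneg _
  have hd := (eLpNorm_freeRep_le (h' - h))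
  rw [hxe] at hd
  have hd' : eLpNorm (freeRep (h' - h)) 4 volume ≤ ENNReal.ofReal (12 * x) := by
    rwa [ENNReal.ofReal_mul (by norm_num), ENNReal.ofReal_ofNat]
  have hxL : (1 + 12 * L) * x ≤ η := by
    have := (hφ₀.trans_le (min_le_right _ _)).le
    rwa [le_div_iff₀ (by positivity), mul_comm] at this
  have hLd : L * eLpNorm (freeRep (h' - h)) 4 volume ≤ ENNReal.ofReal (12 * L * x) := by
    calc _ ≤ L * ENNReal.ofReal (12 * x) := by gcongr
      _ = _ := by
        rw [← ENNReal.ofReal_coe_nnreal, ← ENNReal.ofReal_mul (by positivity)]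
        congr 1
        ring
  obtain ⟨v, hv, hvmild, hvu, hvduh⟩ := H ε u (freeRep h) (freeRep (h' - h)) hu
    (ENNReal.coe_toNNReal hu.2.ne).ge (memLp_freeRep _) (hd'.trans (by
      rw [← ENNReal.ofReal_coe_nnreal]
      refine ENNReal.ofReal_le_ofReal ?_
      have := (hφ₀.trans_le (min_le_left _ _)).le
      linarith)) hmild
  replace hvmild := hvmild.congr (ae_freeRep_add_sub h h')
  have h0 : (0 : ℝ) ∈ Icc (-T) T := ⟨by linarith, hT.le⟩
  refine ⟨⟨mildFlow g ε h' v, isNLSSolution_mildFlow hg hμ hv hvmild ordConnected_Icc h0,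
    by rw [mildFlow_zero, ← hφ₀']⟩, fun φ hφ hφ0 => ?_⟩
  have hφeq := hφ.eqOn_mildFlow hg hμ hv hvmild h0 (hφ0.trans hφ₀')
  constructor
  · intro t ht
    rw [hφeq ht, ← ENNReal.ofReal_le_ofReal_iff hη.le, ofReal_norm]
    refine (enorm_mildFlow_sub_le t).trans ((add_le_add hxe.le ((hvduh t).trans hLd)).trans ?_)
    rw [← ENNReal.ofReal_add hx0 (by positivity)]
    refine ENNReal.ofReal_le_ofReal ?_
    linarith
  · calc _ ≤ ∫⁻ t in Icc (-T) T, ‖(v - u) t‖ₑ ^ (4 : ℝ) := by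
          refine lintegral_mono_ae ?_
          filter_upwards [ae_restrict_mem measurableSet_Icc,
            ae_restrict_of_ae (hmild.ae_mildFlow_eq hg hu),
            ae_restrict_of_ae (hvmild.ae_mildFlow_eq hg hv)] with t h1 h2 h3
          rw [show (4 : ℝ) = ((4 : ℕ) : ℝ) by norm_num, ENNReal.rpow_natCast]
          gcongr
          refine le_trans (le_of_eq (eLpNorm_congr_ae ?_)) (eLpNorm_top_le_enorm _)
          rw [hφeq h1]
          filter_upwards [Lp.coeFn_sub (mildFlow g ε h' v t) (mildFlow g ε h u t), h2, h3]
            with y e1 e2 e3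
          rw [e1, Pi.sub_apply, e2, e3]
          rfl
      _ ≤ ∫⁻ t, ‖(v - u) t‖ₑ ^ (4 : ℝ) := setLIntegral_le_lintegral _ _
      _ = eLpNorm (v - u) 4 volume ^ (4 : ℝ) := (eLpNorm_four_rpow _).symm
      _ ≤ ENNReal.ofReal η ^ (4 : ℝ) := by
          gcongr
          refine hvu.trans (hLd.trans (ENNReal.ofReal_le_ofReal ?_))
          linarith
      _ = _ := by
          rw [show (4 : ℝ) = ((4 : ℕ) : ℝ) by norm_num, ENNReal.rpow_natCast,
            ENNReal.ofReal_pow hη.le]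

/-- Increments of the Duhamel integral are bounded by increments of the primitive of the L^{4/3}
mass, which converges along l, so the Cauchy criterion applies. The abstract filter covers both time
directions. -/
theorem exists_tendsto_duhL2 (hg : Integrable g) {F : ℝ → ℝ →ᵇ ℂ} (hF : MemLp F (4 / 3) volume)
    {l : Filter ℝ} [l.NeBot]
    (hl : ∀ f : ℝ → ℝ, Integrable f → ∃ c, Tendsto (fun t => ∫ s in (0 : ℝ)..t, f s) l (𝓝 c)) :
    ∃ k, Tendsto (fun t => duhL2 g ε F 0 t) l (𝓝 k) := by
  obtain ⟨f, hfi, -, hmass⟩ := exists_primitive_rpow_four_thirds hF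
  obtain ⟨c, hc⟩ := hl f hfi
  have hG := mass_ne_top hg
  refine cauchy_map_iff_exists_tendsto.1 (cauchy_map_iff'.2 ?_)
  rw [tendsto_uniformity_iff_dist_tendsto_zero]
  have h1 : Tendsto (fun p : ℝ × ℝ => ENNReal.ofReal
      |(∫ s in (0 : ℝ)..p.1, f s) - ∫ s in (0 : ℝ)..p.2, f s|) (l ×ˢ l) (𝓝 0) := by
    have := ((hc.comp tendsto_fst).sub (hc.comp tendsto_snd) : Tendsto _ (l ×ˢ l) _).abs
    rw [sub_self, abs_zero] at this
    simpa using ENNReal.tendsto_ofReal this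
  have h2 := ENNReal.Tendsto.const_mul (a := 4 * mass g)
    ((ENNReal.continuous_rpow_const (y := 3 / 4)).tendsto _ |>.comp h1) (Or.inr (by finiteness))
  rw [ENNReal.zero_rpow_of_pos (by norm_num), mul_zero] at h2
  have h3 : Tendsto (fun p : ℝ × ℝ => ‖duhL2 g ε F 0 p.1 - duhL2 g ε F 0 p.2‖ₑ) (l ×ˢ l) (𝓝 0) := by
    refine tendsto_of_tendsto_of_tendsto_of_le_of_le tendsto_const_nhds h2 (fun _ => bot_le)
      fun p => ?_
    simp only [Function.comp_apply]
    rw [← hmass, ← duhL2_add_adjacent hg hF 0 p.2 p.1, add_sub_cancel_left]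
    exact enorm_duhL2_le hg hF _ _
  have h4 := (ENNReal.tendsto_toReal (by simp : (0 : ℝ≥0∞) ≠ ∞)).comp h3
  simpa [Function.comp_def, dist_eq_norm] using h4

theorem exists_tendsto_freeEvolution (hg : Integrable g) (hu : MemLp u 4 volume)
    {l : Filter ℝ} [l.NeBot]
    (hl : ∀ f : ℝ → ℝ, Integrable f → ∃ c, Tendsto (fun t => ∫ s in (0 : ℝ)..t, f s) l (𝓝 c)) :
    ∃ ψp : L2R, Tendsto (fun t => ‖mildFlow g ε h u t - freeEvolution t ψp‖) l (𝓝 0) := by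
  obtain ⟨k, hk⟩ := exists_tendsto_duhL2 (ε := ε) hg hu.cubic hl
  refine ⟨𝓕⁻ (h - Complex.I • k), ?_⟩
  have h1 := tendsto_iff_norm_sub_tendsto_zero.1 ((hk.const_smul Complex.I).const_sub h)
  refine h1.congr fun t => ?_
  rw [freeEvolution_fourierInv, mildFlow, ← toReal_enorm (𝓕⁻ _ - _), enorm_fourierInv_sub,
    ← phase_sub, enorm_phase, toReal_enorm]

theorem scatters_mildFlow (hg : Integrable g) (hu : MemLp u 4 volume) :
    Scatters (mildFlow g ε h u) := by
  constructor
  · exact exists_tendsto_freeEvolution hg hu fun f hf =>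
      ⟨_, intervalIntegral_tendsto_integral_Ioi 0 hf.integrableOn tendsto_id⟩
  · refine exists_tendsto_freeEvolution hg hu fun f hf => ?_
    have := (intervalIntegral_tendsto_integral_Iic 0 hf.integrableOn tendsto_id).neg
    refine ⟨_, this.congr fun t => ?_⟩
    rw [id, ← intervalIntegral.integral_symm]

end Stability

/-! ### The concentration limit -/

section Limit

variable {g : ℝ → ℝ} {F : ℝ → ℝ →ᵇ ℂ}

theorem tendsto_eLpNorm_duhRep_nhdsGT (hg : Integrable g) (hg1 : ∫ y, g y = 1)
    (hF : MemLp F (4 / 3) volume) :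
    Tendsto (fun ε => eLpNorm (duhRep g ε F - duhRep g 0 F) 4 volume) (𝓝[>] 0) (𝓝 0) :=
  tendsto_of_seq_tendsto fun _ he =>
    tendsto_eLpNorm_duhRep_sub hg hg1 hF (he.mono_right nhdsWithin_le_nhds)

theorem tendsto_iSup_enorm_duhL2_nhdsGT (hg : Integrable g) (hg1 : ∫ y, g y = 1)
    (hF : MemLp F (4 / 3) volume) :
    Tendsto (fun ε => ⨆ t, ‖duhL2 g ε F 0 t - duhL2 g 0 F 0 t‖ₑ) (𝓝[>] 0) (𝓝 0) := by
  refine tendsto_of_seq_tendsto fun e he => ENNReal.tendsto_nhds_zero.2 fun η hη => ?_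
  filter_upwards [eventually_enorm_duhL2_sub_le hg hg1 hF (he.mono_right nhdsWithin_le_nhds) hη]
    with n hn
  exact iSup_le hn

/-- The forcing error that is made when a solution of the point-concentrated equation is regarded
as an approximate solution of the equation with rescaled coupling. -/
def forcingError (g : ℝ → ℝ) (F : ℝ → ℝ →ᵇ ℂ) (k : L2R) (ε : ℝ) : ℝ → ℝ →ᵇ ℂ :=
  freeRep k - Complex.I • (duhRep g ε F - duhRep g 0 F)

theorem memLp_forcingError (hg : Integrable g) (hF : MemLp F (4 / 3) volume) (k : L2R) (ε : ℝ) :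
    MemLp (forcingError g F k ε) 4 volume :=
  (memLp_freeRep k).sub (((memLp_duhRep hg hF).sub (memLp_duhRep hg hF)).const_smul _)

theorem tendsto_eLpNorm_forcingError (hg : Integrable g) (hg1 : ∫ y, g y = 1)
    (hF : MemLp F (4 / 3) volume) {k : ℝ → L2R} (hk : Tendsto k (𝓝[>] 0) (𝓝 0)) :
    Tendsto (fun ε => eLpNorm (forcingError g F (k ε) ε) 4 volume) (𝓝[>] 0) (𝓝 0) := by
  have h1 := (ENNReal.Tendsto.const_mul (a := 12) hk.enorm (Or.inr (by norm_num))).add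
    (tendsto_eLpNorm_duhRep_nhdsGT hg hg1 hF)
  simp only [enorm_zero, mul_zero, add_zero] at h1
  refine tendsto_of_tendsto_of_tendsto_of_le_of_le tendsto_const_nhds h1 (fun _ => bot_le)
    fun ε => ?_
  have hD := (memLp_duhRep (ε := ε) hg hF).sub (memLp_duhRep (ε := 0) hg hF)
  refine (eLpNorm_sub_le (memLp_freeRep _).1 (hD.const_smul _).1 (by norm_num)).trans
    (add_le_add (eLpNorm_freeRep_le _) (le_of_eq ?_))
  rw [eLpNorm_const_smul]
  simp [enorm_eq_nnnorm]

/-- Mild solutions with rescaled coupling exist close to a mild solution of the point-concentrated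
equation. -/
theorem exists_mild_rescaled (hg : Integrable g) (hg1 : ∫ y, g y = 1) {h : L2R} {k : ℝ → L2R}
    (hk : Tendsto k (𝓝[>] 0) (𝓝 h)) {u : ℝ → ℝ →ᵇ ℂ} (hu : MemLp u 4 volume)
    (hmild : IsMild g 0 (freeRep h) u) :
    ∃ ε₀ > (0 : ℝ), ∃ v : ℝ → ℝ → ℝ →ᵇ ℂ,
      (∀ ε, 0 < ε → ε ≤ ε₀ → MemLp (v ε) 4 volume ∧ IsMild g ε (freeRep (k ε)) (v ε)) ∧
      Tendsto (fun ε => ⨆ t, ‖mildFlow g ε (k ε) (v ε) t - mildFlow g 0 h u t‖ₑ) (𝓝[>] 0)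
        (𝓝 0) := by
  obtain ⟨δ, hδ, L, H⟩ := exists_stability hg (eLpNorm u 4 volume).toNNReal
  set F : ℝ → ℝ →ᵇ ℂ := fun s => cubic (u s) with hFdef
  have hF : MemLp F (4 / 3) volume := hu.cubic
  have hkh : Tendsto (fun ε => k ε - h) (𝓝[>] 0) (𝓝 0) := by simpa using hk.sub_const h
  set d : ℝ → ℝ → ℝ →ᵇ ℂ := fun ε => forcingError g F (k ε - h) ε with hd
  have hN : Tendsto (fun ε => eLpNorm (d ε) 4 volume) (𝓝[>] 0) (𝓝 0) :=
    tendsto_eLpNorm_forcingError hg hg1 hF hkh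
  obtain ⟨ε₀, hε₀, hsub⟩ := mem_nhdsGT_iff_exists_Ioc_subset.1
    (hN.eventually (ge_mem_nhds (by exact_mod_cast hδ : (0 : ℝ≥0∞) < δ)))
  -- The selection in ε is over all reals; outside the range of small positive ε the choice is
  -- irrelevant.
  have hex : ∀ ε, ∃ v, ε ∈ Ioc 0 ε₀ → MemLp v 4 volume ∧ IsMild g ε (freeRep (k ε)) v ∧
      ∀ t, ‖duhL2 g ε (fun s => cubic (v s)) 0 t - duhL2 g ε F 0 t‖ₑ
        ≤ L * eLpNorm (d ε) 4 volume := by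
    intro ε
    by_cases hε : ε ∈ Ioc 0 ε₀
    -- The limit solution solves the equation for ε exactly, with the Duhamel discrepancy added to
    -- its forcing. The perturbation `d ε` removes this discrepancy and exchanges the free data h
    -- for k(ε).
    · obtain ⟨v, hv, hvmild, -, hvd⟩ := H ε u
        (freeRep h + Complex.I • (duhRep g ε F - duhRep g 0 F)) (d ε) hu
        (ENNReal.coe_toNNReal hu.2.ne).ge (memLp_forcingError hg hF _ _) (hsub hε) (by
          filter_upwards [hmild] with t ht
          rw [ht]
          simp only [Pi.add_apply, Pi.smul_apply, Pi.sub_apply, smul_sub]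
          abel)
      refine ⟨v, fun _ => ⟨hv, hvmild.congr ?_, hvd⟩⟩
      filter_upwards [ae_freeRep_add_sub h (k ε)] with t ht
      rw [← ht, hd]
      simp only [forcingError, Pi.add_apply, Pi.sub_apply]
      abel
    · exact ⟨0, fun h => absurd h hε⟩
  choose v hv using hex
  refine ⟨ε₀, hε₀, v, fun ε h1 h2 => ⟨(hv ε ⟨h1, h2⟩).1, (hv ε ⟨h1, h2⟩).2.1⟩, ?_⟩
  -- Three errors add up: that of the data, that of the nonlinear correction, and that of the
  -- Duhamel integrals with the forcing of the limit solution kept fixed.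
  have hlim := (hkh.enorm.add (ENNReal.Tendsto.const_mul (a := (L : ℝ≥0∞)) hN
    (Or.inr (by finiteness)))).add (tendsto_iSup_enorm_duhL2_nhdsGT hg hg1 hF)
  simp only [enorm_zero, mul_zero, add_zero] at hlim
  refine tendsto_of_tendsto_of_tendsto_of_le_of_le' tendsto_const_nhds hlim
    (Eventually.of_forall fun _ => bot_le) ?_
  filter_upwards [Ioc_mem_nhdsGT hε₀] with ε hε
  refine iSup_le fun t => (enorm_mildFlow_sub_le t).trans ?_
  rw [add_assoc]
  gcongr
  rw [← sub_add_sub_cancel _ (duhL2 g ε F 0 t)]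
  exact (enorm_add_le _ _).trans (add_le_add ((hv ε hε).2.2 t)
    (le_iSup (fun t => ‖duhL2 g ε F 0 t - duhL2 g 0 F 0 t‖ₑ) t))

end Limit

end

theorem theorem1p2 (g : ℝ → ℝ) (hg : Integrable g volume) (hg_one : ∫ x, g x = 1)
    (ψ₀ : L2R) (ψ₀ε : ℝ → L2R) (hψ₀ : Tendsto ψ₀ε (𝓝[>] (0 : ℝ)) (𝓝 ψ₀)) :
    ∃ ψ : ℝ → L2R, IsUniqueGlobalSolution deltaMeasure ψ₀ ψ ∧
      ∃ ψε : ℝ → ℝ → L2R,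
        (∃ ε₀ > (0 : ℝ), ∀ ε : ℝ, 0 < ε → ε ≤ ε₀ →
          IsGloballyWellPosedAt (couplingMeasure g ε) (ψ₀ε ε) (ψε ε) ∧ Scatters (ψε ε)) ∧
        Tendsto (fun ε : ℝ => ⨆ t : ℝ, ‖ψε ε t - ψ t‖ₑ) (𝓝[>] (0 : ℝ)) (𝓝 (0 : ℝ≥0∞)) := by
  have hg1 : ∫ y, g y = 1 := hg_one
  have hk : Tendsto (fun ε => (𝓕 (ψ₀ε ε) : L2R)) (𝓝[>] 0) (𝓝 (𝓕 ψ₀)) :=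
    ((Lp.fourierTransformₗᵢ ℝ ℂ).continuous.tendsto ψ₀).comp hψ₀
  obtain ⟨u, hu, hmild⟩ := exists_isMild_zero hg hg1 (memLp_freeRep (𝓕 ψ₀))
  obtain ⟨ε₀, hε₀, v, hv, hlim⟩ := exists_mild_rescaled hg hg1 hk hu hmild
  refine ⟨mildFlow g 0 (𝓕 ψ₀) u,
    isUniqueGlobalSolution_mildFlow hg (cubicFourier_deltaMeasure hg1) hu hmild,
    fun ε => mildFlow g ε (𝓕 (ψ₀ε ε)) (v ε), ⟨ε₀, hε₀, fun ε h1 h2 => ?_⟩, hlim⟩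
  obtain ⟨hvm, hvmild⟩ := hv ε h1 h2
  have hμ := cubicFourier_couplingMeasure hg h1
  exact ⟨⟨isUniqueGlobalSolution_mildFlow hg hμ hvm hvmild,
    dependsContinuouslyAt_mildFlow hg hμ hvm hvmild⟩, scatters_mildFlow hg hvm⟩
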